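/- **Setting.** Let $w:[0,1]\to[0,1]$ be continuous and strictly increasing with $w(0)=0$, $w(1)=1$, one-sided derivatives $w'(0),w'(1)\in(1,\infty]$, and $w'''>0$ on $(0,1)$. Let $w_+=w_-=w$, suppose $w(p)+w(1-p)=1$ for all $p\in[0,1]$, and let $\lambda=1$ and $\theta>0$. A buyer with one joint account who faces a random net outcome $Y$ has payoff $$\overline{CPT}(Y)=\int_0^\infty w_+(P(Y>y))\,dy-\int_{-\infty}^0 w_-(P(\lambda Y<y))\,dy ,$$ and a buyer with separate accounts has payoff $CPT(\theta,X,T)=\theta w_+(P(X=1))-\lambda\int_0^\infty w_-(P(T>y))\,dy$ from a random delivery $X\in\{0,1\}$ and a random payment $T\ge 0$. (Values in $[-\infty,\infty)$.) *Static problem.* An offer is a pair $(X,T)$ of random variables with $X\in\{0,1\}$, $T\ge0$; it is feasible if $\overline{CPT}(\theta X-T)\ge0$, and optimal if it is feasible and maximizes the revenue $\int_0^\infty P(T>y)\,dy$ among feasible offers. *Dynamic problem.* A dynamic pricing process is a random time $\tau\in[0,\infty]$ whose distribution function on $[0,\infty)$ is the sum of an increasing absolutely continuous function and an increasing jump function,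 both nonnegative, and a deterministic function $T(t)=\int_0^t f(s)\,ds+\sum_i 1_{t_i<t}T_i$ with $f\ge0$ locally integrable on $[0,\infty)$, $t_i,T_i\ge0$ (countably many) and the sum finite for every $t$; put $T(\infty)=\lim_{t\to\infty}T(t)$. It is feasible if for every $s\ge0$ with $P(\tau>s)>0$, the payoff $\overline{CPT}$ of $\theta 1_{\tau<\infty}-(T(\tau)-T(s))$ computed under $P(\,\cdot\mid\tau>s)$ is $\ge0$, and optimal if it is feasible and maximizes $\int_0^\infty P(T(\tau)>y)\,dy$ among feasible processes. **Proposition.** (a) For every random payment $T\ge0$, $\overline{CPT}(\theta-T)=CPT(\theta,1,T)$. (b) The maximum $\mu^*=\max_{p\in(0,1]}p/w(p)$ exists, and there is a unique $p^*\in(0,1)$ with $\mu^*w(p^*)=p^*$. The maximal revenue of the static problem is attained and equals $\mu^*\theta/\lambda$, and an offer $(X,T)$ is optimal if and only if $P(X=1)=1$ and, for all $y\ge0$, $P(T>y)=p^*$ if $y<\frac{\mu^*\theta}{p^*\lambda}$ and $P(T>y)=0$ if $y\ge\frac{\mu^*\theta}{p^*\lambda}$. (c) There is a unique $p_1\in(0,1)$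 with $w(p_1)=p_1$. There is a function $g_0\in L^1[0,-\log p_1]$, unique up to null sets, with $$e^{-t}-w(e^{-t})-\int_0^t w(e^{-t+s})g_0(s)\,ds=0\qquad\text{for all }t\in[0,-\log p_1],$$ and it has a representative that is continuous on $(0,-\log p_1]$. For this representative the minimum $t_0=\min\{t\in(0,-\log p_1]: g_0(t)\le0\}$ exists. There is $f\in L^1[0,t_0]$, unique up to null sets, with $$w(e^{-t_0+t})+\int_t^{t_0}w(e^{-s+t})f(s)\,ds=1\qquad\text{for all }t\in[0,t_0].$$ Let $T^*(t)=\frac{\theta}{\lambda}\Big(1_{t>t_0}+\int_0^{\min\{t,t_0\}}f(s)\,ds\Big)$ and let $\tau_0$ be any random time with $P(\tau_0>t)=e^{-t}$ for $t\ge0$. Then $(\tau_0,T^*)$ is an optimal dynamic pricing process. Moreover, a dynamic pricing process $(\tau,T)$ is optimal if and only if $P(\tau<\infty)=1$ and $P(T(\tau)\le y)=P(T^*(\tau_0)\le y)$ for all $y\ge0$. -/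

import Mathlib

open MeasureTheory Set Filter Topology
open scoped ENNReal NNReal

noncomputable section

namespace CPTPricing

/-- A reverse-S-shaped probability weighting function on `[0,1]` (only the values on `[0,1]`
matter): continuous, strictly increasing, `w 0 = 0`, `w 1 = 1`, one-sided derivatives
`w'(0), w'(1) > 1` (the value `+∞` is allowed) and `w''' > 0` on `(0,1)`. -/
structure IsWeighting (w : ℝ → ℝ) : Prop where
  continuousOn : ContinuousOn w (Icc 0 1)
  strictMonoOn : StrictMonoOn w (Icc 0 1)
  map_zero : w 0 = 0
  map_one : w 1 = 1
  deriv_zero : ∃ d : EReal, 1 < d ∧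
    Tendsto (fun p : ℝ => (((w p - w 0) / (p - 0) : ℝ) : EReal)) (𝓝[>] 0) (𝓝 d)
  deriv_one : ∃ d : EReal, 1 < d ∧
    Tendsto (fun p : ℝ => (((w p - w 1) / (p - 1) : ℝ) : EReal)) (𝓝[<] 1) (𝓝 d)
  differentiable : ∀ k < 3, ∀ p ∈ Ioo (0 : ℝ) 1, DifferentiableAt ℝ (iteratedDeriv k w) p
  third_pos : ∀ p ∈ Ioo (0 : ℝ) 1, 0 < iteratedDeriv 3 w p

section Payoffs

variable {Ω : Type*} [MeasurableSpace Ω]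

/-- The payoff of a buyer with one joint account whose net outcome (value of the good minus
payment) is the random variable `Y`:
`∫_0^∞ w₊(P(Y > y)) dy - ∫_{-∞}^0 w₋(P(λ Y < y)) dy`.
Both integrals are computed in `[0,∞]`. In all uses below `Y` is bounded above, so the first one
is finite, and the payoff is a well-defined element of `[-∞,∞)`. -/
def jointCPT (wp wm : ℝ → ℝ) (lam : ℝ) (P : Measure Ω) (Y : Ω → EReal) : EReal :=
  ((∫⁻ y in Ioi (0 : ℝ), ENNReal.ofReal (wp (P.real {ω | (y : EReal) < Y ω})) : ℝ≥0∞) : EReal)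
  - ((∫⁻ y in Iio (0 : ℝ),
      ENNReal.ofReal (wm (P.real {ω | (lam : EReal) * Y ω < (y : EReal)})) : ℝ≥0∞) : EReal)

/-- The payoff of a buyer of type `θ` with separate accounts from the offer `(X, T)`:
`θ w₊(P(X = 1)) - λ ∫_0^∞ w₋(P(T > y)) dy`, an element of `[-∞,∞)`. -/
def separateCPT (wp wm : ℝ → ℝ) (lam θ : ℝ) (P : Measure Ω) (X T : Ω → ℝ) : EReal :=
  ((θ * wp (P.real {ω | X ω = 1}) : ℝ) : EReal)
  - ((ENNReal.ofReal lam *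
      ∫⁻ y in Ioi (0 : ℝ), ENNReal.ofReal (wm (P.real {ω | y < T ω})) : ℝ≥0∞) : EReal)

/-- The net outcome `θ X - T` of a static offer. -/
def staticNet (θ : ℝ) (X T : Ω → ℝ) : Ω → EReal := fun ω => ((θ * X ω - T ω : ℝ) : EReal)

/-- The seller's expected revenue `∫_0^∞ P(T > y) dy` from a random total payment `T`. -/
def revenue (P : Measure Ω) (T : Ω → EReal) : ℝ≥0∞ :=
  ∫⁻ y in Ioi (0 : ℝ), P {ω | (y : EReal) < T ω}

/-- Revenue of a static offer with random payment `T`. -/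
def staticRevenue (P : Measure Ω) (T : Ω → ℝ) : ℝ≥0∞ := revenue P (fun ω => (T ω : EReal))

/-! ### Static offers under joint accounting -/

/-- A static offer: random delivery `X ∈ {0,1}` and random payment `T ≥ 0`. -/
structure IsOffer (X T : Ω → ℝ) : Prop where
  measurable_X : Measurable X
  measurable_T : Measurable T
  zero_or_one : ∀ ω, X ω = 0 ∨ X ω = 1
  nonneg : ∀ ω, 0 ≤ T ω

/-- Offers that satisfy the ex ante participation constraint of a joint-accounting buyer. -/
structure IsFeasibleOffer (wp wm : ℝ → ℝ) (lam θ : ℝ) (P : Measure Ω) (X T : Ω → ℝ) : Prop where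
  offer : IsOffer X T
  ir : 0 ≤ jointCPT wp wm lam P (staticNet θ X T)

/-- The set of revenues of feasible offers, over all probability spaces. -/
def feasibleRevenues (wp wm : ℝ → ℝ) (lam θ : ℝ) : Set ℝ≥0∞ :=
  {R | ∃ (Ω : Type) (_ : MeasurableSpace Ω) (P : Measure Ω) (_ : IsProbabilityMeasure P)
    (X T : Ω → ℝ), IsFeasibleOffer wp wm lam θ P X T ∧ staticRevenue P T = R}

/-- Optimal offers: feasible, with maximal revenue among feasible offers. -/
def IsOptimalOffer (wp wm : ℝ → ℝ) (lam θ : ℝ) (P : Measure Ω) (X T : Ω → ℝ) : Prop :=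
  IsFeasibleOffer wp wm lam θ P X T ∧
    ∀ R ∈ feasibleRevenues wp wm lam θ, R ≤ staticRevenue P T

/-! ### Dynamic pricing processes under joint accounting -/

/-- A cumulative payment function with a regular decomposition: nonnegative flow payments and
countably many nonnegative lump sums. `T t` excludes a lump sum due at `t`. -/
def IsRegularPayment (T : ℝ≥0 → ℝ) : Prop :=
  ∃ (f : ℝ → ℝ) (a : ℕ → ℝ) (J : ℕ → ℝ),
    (∀ t, 0 ≤ f t) ∧ (∀ t : ℝ≥0, IntervalIntegrable f volume 0 t) ∧
    (∀ i, 0 ≤ a i) ∧ (∀ i, 0 ≤ J i) ∧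
    (∀ t : ℝ≥0, Summable fun i => if a i < t then J i else 0) ∧
    ∀ t : ℝ≥0, T t = (∫ s in (0 : ℝ)..t, f s) + ∑' i, if a i < t then J i else 0

/-- The cumulative distribution function of `τ` on `[0,∞)` is the sum of an absolutely continuous
and a pure jump part, both nonnegative and increasing. -/
def HasRegularCDF (P : Measure Ω) (τ : Ω → ℝ≥0∞) : Prop :=
  ∃ (ρ : ℝ → ℝ) (a : ℕ → ℝ) (q : ℕ → ℝ),
    (∀ t, 0 ≤ ρ t) ∧ IntegrableOn ρ (Ici 0) ∧
    (∀ i, 0 ≤ a i) ∧ (∀ i, 0 ≤ q i) ∧ Summable q ∧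
    ∀ t : ℝ≥0, P.real {ω | τ ω ≤ t} =
      (∫ s in (0 : ℝ)..t, ρ s) + ∑' i, if a i ≤ t then q i else 0

/-- A dynamic pricing process: delivery time `τ ∈ [0,∞]` and cumulative payment function `T`. -/
structure IsPricingProcess (P : Measure Ω) (τ : Ω → ℝ≥0∞) (T : ℝ≥0 → ℝ) : Prop where
  measurable : Measurable τ
  regular_time : HasRegularCDF P τ
  regular_payment : IsRegularPayment T

/-- The cumulative payment at a time in `[0,∞]`; at `∞` it is the limit of the increasing
function `T`, which may be infinite. -/
def payAt (T : ℝ≥0 → ℝ) (t : ℝ≥0∞) : EReal :=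
  if t = ⊤ then ⨆ s : ℝ≥0, (T s : EReal) else (T t.toNNReal : EReal)

/-- Seen from time `s`, the net outcome `θ 1_{τ < ∞} - (T(τ) - T(s))` of remaining forever. -/
def dynamicNet (θ : ℝ) (τ : Ω → ℝ≥0∞) (T : ℝ≥0 → ℝ) (s : ℝ≥0) : Ω → EReal := fun ω =>
  (((if τ ω < ⊤ then θ else 0 : ℝ)) : EReal) - (payAt T (τ ω) - (T s : EReal))

/-- Dynamic individual rationality of a joint-accounting buyer: at each time `s` that is reached
with positive probability without delivery, given the belief conditional on `τ > s`, remaining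
forever is weakly better than quitting immediately. -/
def JointDIR (wp wm : ℝ → ℝ) (lam θ : ℝ) (P : Measure Ω) (τ : Ω → ℝ≥0∞) (T : ℝ≥0 → ℝ) : Prop :=
  ∀ s : ℝ≥0, 0 < P {ω | (s : ℝ≥0∞) < τ ω} →
    0 ≤ jointCPT wp wm lam (ProbabilityTheory.cond P {ω | (s : ℝ≥0∞) < τ ω})
      (dynamicNet θ τ T s)

/-- The random total payment `T(τ)`. -/
def totalPayment (τ : Ω → ℝ≥0∞) (T : ℝ≥0 → ℝ) : Ω → EReal := fun ω => payAt T (τ ω)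

/-- Optimal dynamic pricing processes under joint accounting. -/
def IsOptimalProcess (wp wm : ℝ → ℝ) (lam θ : ℝ) (P : Measure Ω) (τ : Ω → ℝ≥0∞)
    (T : ℝ≥0 → ℝ) : Prop :=
  IsPricingProcess P τ T ∧ JointDIR wp wm lam θ P τ T ∧
    ∀ (Ω' : Type) (_ : MeasurableSpace Ω') (P' : Measure Ω') (_ : IsProbabilityMeasure P')
      (τ' : Ω' → ℝ≥0∞) (T' : ℝ≥0 → ℝ),
      IsPricingProcess P' τ' T' → JointDIR wp wm lam θ P' τ' T' →
        revenue P' (totalPayment τ' T') ≤ revenue P (totalPayment τ T)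

/-- A standard exponential time: `P(τ > t) = e^{-t}`. -/
def IsExponentialTime (P : Measure Ω) (τ : Ω → ℝ≥0∞) : Prop :=
  Measurable τ ∧
    ∀ t : ℝ≥0, P {ω | (t : ℝ≥0∞) < τ ω} = ENNReal.ofReal (Real.exp (-(t : ℝ)))

end Payoffs

/-! ### The payment function `T*` -/

/-- `g ∈ L¹[0,L]` solves `e^{-t} - w(e^{-t}) - ∫_0^t w(e^{-t+s}) g(s) ds = 0` on `[0,L]`. -/
def SolvesMultiplierEq (w : ℝ → ℝ) (L : ℝ) (g : ℝ → ℝ) : Prop :=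
  IntegrableOn g (Icc 0 L) ∧ ∀ t ∈ Icc 0 L,
    Real.exp (-t) - w (Real.exp (-t)) - ∫ s in (0 : ℝ)..t, w (Real.exp (-t + s)) * g s = 0

/-- `f ∈ L¹[0,t₀]` solves `w(e^{-t₀+t}) + ∫_t^{t₀} w(e^{-s+t}) f(s) ds = 1` on `[0,t₀]`. -/
def SolvesBindingEq (w : ℝ → ℝ) (t₀ : ℝ) (f : ℝ → ℝ) : Prop :=
  IntegrableOn f (Icc 0 t₀) ∧ ∀ t ∈ Icc 0 t₀,
    w (Real.exp (-t₀ + t)) + ∫ s in t..t₀, w (Real.exp (-s + t)) * f s = 1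

/-- `T*(t) = (θ/λ) (1_{t > t₀} + ∫_0^{min(t,t₀)} f(s) ds)`. -/
def paymentStar (lam θ t₀ : ℝ) (f : ℝ → ℝ) : ℝ≥0 → ℝ := fun t =>
  θ / lam * ((if t₀ < t then 1 else 0) + ∫ s in (0 : ℝ)..(min (t : ℝ) t₀), f s)

end CPTPricing

end

/-! Since `w (1 - p) = 1 - w p`, the joint payoff of sure delivery at a random price `Z ≥ 0` is `θ`
minus the distorted mean `∫ w (P(Z > y)) dy` (`jointCPT_const_sub`). Not delivering on an event is
worth the same as delivering and raising the price there by `θ`. Hence every participation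
constraint says that a distorted mean is at most `θ`, while revenue is the undistorted integral of
the tail function `h y = P(Z > y)`.

Static problem: `x ≤ μ * w x` on `[0,1]`, with equality only at `0` and `p`. Integrating at `x = h
y` bounds revenue by `μ * θ`, and equality forces `h` to take only the values `0` and `p`.

Dynamic problem: look at the process when the tail of the total payment has fallen to `e^{-t}`. The
constraint there bounds by `θ` the integral of `w (e^t h y)` over the levels with `h y ≤ e^{-t}`
(`condMean`). These constraints are linear in the distribution of the values of `h`, so linear
programming duality applies. The multiplier is `δ₀ + g` on `[0,t₀]`. Its potential equals `x` for
`x` in `[e^{-t₀}, 1]` and exceeds `x` on `(0, e^{-t₀})`. Integrating the constraints against it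
gives the bound `θ (1 + ∫ g)` (`lintegral_tail_le`).

The multiplier comes from renewal theory. Let `k u = w (e^{-u})`, with density `K = -k'`. The
renewal series of `K` has a density `r` with `k + k * r = 1`, so `δ₀ + r` inverts `k` up to the
constant function one. Then `δ₀ + g` is the product of `δ₀ + r` and `δ₀ - e^{-t}`, and the flow `f`
is `r` reversed in time. Uniqueness in both Volterra equations comes from the same inverse. Near
zero `K > e^{-t}`, because `w' > 1` near one, so `g > 0` there; at `log 2` the multiplier equation
has right side `1/2 - w (1/2) = 0`, so `g` cannot stay positive. This produces `t₀`.

The strict inequality on `(0, e^{-t₀})` is the delicate point (`multiplierSlack_pos`). It uses `w'''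
> 0`, as positivity of third divided differences, together with `g t₀ = 0`.

If a tail attains the bound, complementary slackness makes it avoid `(0, e^{-t₀})` and makes almost
all constraints bind (`isBindingTail_of_le`). Integrating against shifted renewal measures then
determines the size of its level sets, hence the tail itself (`IsBindingTail.unique`). The candidate
process satisfies all these equalities, and the binding constraint at time zero forces almost sure
delivery. -/

namespace CPTPricing

/-! ### Divided differences, the fixed point `1/2` and the shape of the derivative of `w`. -/

namespace IsWeighting

variable {w : ℝ → ℝ}

theorem hasDerivAt_iteratedDeriv (hw : IsWeighting w) {k : ℕ} (hk : k < 3) {p : ℝ}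
    (hp : p ∈ Ioo (0 : ℝ) 1) :
    HasDerivAt (iteratedDeriv k w) (iteratedDeriv (k + 1) w p) p := by
  rw [iteratedDeriv_succ]
  exact (hw.differentiable k hk p hp).hasDerivAt

theorem hasDerivAt (hw : IsWeighting w) {p : ℝ} (hp : p ∈ Ioo (0 : ℝ) 1) :
    HasDerivAt w (deriv w p) p := by
  simpa using hw.hasDerivAt_iteratedDeriv (k := 0) (by norm_num) hp

/-- The third divided difference of `w` at the points `0 < b < c < d` is positive. -/
theorem divided_difference_pos (hw : IsWeighting w) {b c d : ℝ} (hb : 0 < b) (hbc : b < c)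
    (hcd : c < d) (hd : d ≤ 1) :
    0 < w b / (b * ((c - b) * (d - b))) - w c / (c * ((c - b) * (d - c)))
      + w d / (d * ((d - b) * (d - c))) := by
  set A := w b / (b * ((c - b) * (d - b))) - w c / (c * ((c - b) * (d - c)))
      + w d / (d * ((d - b) * (d - c))) with hA
  set B := (w c / c - w b / b) / (c - b) with hB
  have hc : 0 < c := hb.trans hbc
  have hd0 : 0 < d := hc.trans hcd
  have h1 : c - b ≠ 0 := by linarith
  have h2 : d - b ≠ 0 := by linarith
  have h3 : d - c ≠ 0 := by linarith
  -- This is the cubic interpolating `w` at `0, b, c, d`: the Newton form `x (w b / b + B (x - b) +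
  -- A (x - b) (x - c))` multiplied out. The four zeros of `w - q` and repeated use of Rolle's
  -- theorem give a point where the third derivative of `w` is `6 A`.
  set q : ℝ → ℝ := fun x => (w b / b - B * b + A * b * c) * x + (B - A * (b + c)) * x ^ 2
    + A * x ^ 3 with hq
  set q1 : ℝ → ℝ := fun x => (w b / b - B * b + A * b * c) + (B - A * (b + c)) * (2 * x)
    + A * (3 * x ^ 2) with hq1
  set q2 : ℝ → ℝ := fun x => (B - A * (b + c)) * 2 + A * (3 * (2 * x)) with hq2
  have dq : ∀ x, HasDerivAt q (q1 x) x := by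
    intro x
    have e1 := (hasDerivAt_id x).const_mul (w b / b - B * b + A * b * c)
    have e2 := (hasDerivAt_pow 2 x).const_mul (B - A * (b + c))
    have e3 := (hasDerivAt_pow 3 x).const_mul A
    refine ((e1.add e2).add e3).congr_deriv ?_
    simp [hq1]
  have dq1 : ∀ x, HasDerivAt q1 (q2 x) x := by
    intro x
    have e1 := (hasDerivAt_const x (w b / b - B * b + A * b * c))
    have e2 := ((hasDerivAt_id x).const_mul (2 : ℝ)).const_mul (B - A * (b + c))
    have e3 := ((hasDerivAt_pow 2 x).const_mul (3 : ℝ)).const_mul A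
    refine ((e1.add e2).add e3).congr_deriv ?_
    simp [hq2]
  have dq2 : ∀ x, HasDerivAt q2 (6 * A) x := by
    intro x
    have e1 := (hasDerivAt_const x ((B - A * (b + c)) * 2))
    have e3 := (((hasDerivAt_id x).const_mul (2 : ℝ)).const_mul (3 : ℝ)).const_mul A
    refine (e1.add e3).congr_deriv ?_
    ring
  have q0 : q 0 = w 0 := by simp [hq, hw.map_zero]
  have qb : q b = w b := by
    simp only [hq]; field_simp; ring
  have qc : q c = w c := by
    simp only [hq, hB]; field_simp; ring
  have qd : q d = w d := by
    simp only [hq, hB, hA]; field_simp; ring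
  have step0 : ∀ x y, 0 ≤ x → x < y → y ≤ 1 → q x = w x → q y = w y →
      ∃ z ∈ Ioo x y, iteratedDeriv 1 w z - q1 z = 0 := by
    intro x y hx hxy hy ex ey
    refine exists_hasDerivAt_eq_zero (f := fun x => w x - q x)
      (f' := fun z => iteratedDeriv 1 w z - q1 z) hxy ?_ (by simp [ex, ey]) ?_
    · exact (hw.continuousOn.mono (Icc_subset_Icc hx hy)).sub
        (fun z _ => (dq z).continuousAt.continuousWithinAt)
    · intro z hz
      have := (hw.hasDerivAt (p := z) ⟨hx.trans_lt hz.1, hz.2.trans_le hy⟩).sub (dq z)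
      rw [iteratedDeriv_one]
      exact this
  have step : ∀ (k : ℕ) (r r' : ℝ → ℝ), k < 3 → (∀ x, HasDerivAt r (r' x) x) →
      ∀ x y, 0 < x → x < y → y < 1 → iteratedDeriv k w x - r x = 0 →
      iteratedDeriv k w y - r y = 0 →
      ∃ z ∈ Ioo x y, iteratedDeriv (k + 1) w z - r' z = 0 := by
    intro k r r' hk hr x y hx hxy hy ex ey
    have hd : ∀ z ∈ Icc x y, HasDerivAt (fun x => iteratedDeriv k w x - r x)
        (iteratedDeriv (k + 1) w z - r' z) z := fun z hz =>
      (hw.hasDerivAt_iteratedDeriv hk ⟨hx.trans_le hz.1, hz.2.trans_lt hy⟩).sub (hr z)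
    exact exists_hasDerivAt_eq_zero hxy
      (fun z hz => (hd z hz).continuousAt.continuousWithinAt) (by rw [ex, ey])
      (fun z hz => hd z (Ioo_subset_Icc_self hz))
  obtain ⟨x1, hx1, e1⟩ := step0 0 b le_rfl hb (by linarith) q0 qb
  obtain ⟨x2, hx2, e2⟩ := step0 b c hb.le hbc (by linarith) qb qc
  obtain ⟨x3, hx3, e3⟩ := step0 c d hc.le hcd hd qc qd
  obtain ⟨y1, hy1, f1⟩ := step 1 q1 q2 (by norm_num) dq1 x1 x2 hx1.1 (hx1.2.trans hx2.1)
    (by linarith [hx2.2]) e1 e2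
  obtain ⟨y2, hy2, f2⟩ := step 1 q1 q2 (by norm_num) dq1 x2 x3 (hb.trans hx2.1)
    (hx2.2.trans hx3.1) (by linarith [hx3.2]) e2 e3
  obtain ⟨z, hz, hz'⟩ := step 2 q2 (fun _ => 6 * A) (by norm_num) dq2 y1 y2 (hx1.1.trans hy1.1)
    (hy1.2.trans hy2.1) (by linarith [hy2.2, hx3.2]) f1 f2
  have := hw.third_pos z ⟨by linarith [hx1.1, hy1.1, hz.1], by linarith [hz.2, hy2.2, hx3.2]⟩
  simp only [Nat.reduceAdd] at hz'
  linarith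

theorem le_one (hw : IsWeighting w) {p : ℝ} (hp : p ∈ Icc (0 : ℝ) 1) : w p ≤ 1 :=
  hw.map_one ▸ hw.strictMonoOn.monotoneOn hp (right_mem_Icc.2 zero_le_one) hp.2

theorem nonneg (hw : IsWeighting w) {p : ℝ} (hp : p ∈ Icc (0 : ℝ) 1) : 0 ≤ w p :=
  hw.map_zero ▸ hw.strictMonoOn.monotoneOn (left_mem_Icc.2 zero_le_one) hp hp.1

theorem pos (hw : IsWeighting w) {p : ℝ} (hp : p ∈ Ioc (0 : ℝ) 1) : 0 < w p :=
  hw.map_zero ▸ hw.strictMonoOn (left_mem_Icc.2 zero_le_one) ⟨hp.1.le, hp.2⟩ hp.1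

theorem half (hsymm : ∀ p ∈ Icc (0 : ℝ) 1, w p + w (1 - p) = 1) : w (1 / 2) = 1 / 2 := by
  have := hsymm (1 / 2) (by norm_num)
  norm_num at this ⊢
  linarith

/-- The graph of `w` meets the diagonal at `0`, `1/2` and `1`, so the divided difference at `0, 1/2,
p, 1` is a positive multiple of `p - w p`. -/
theorem lt_self (hw : IsWeighting w) (hsymm : ∀ p ∈ Icc (0 : ℝ) 1, w p + w (1 - p) = 1)
    {p : ℝ} (hp : p ∈ Ioo (1 / 2 : ℝ) 1) : w p < p := by
  obtain ⟨h1, h2⟩ := hp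
  have := hw.divided_difference_pos (b := 1 / 2) (c := p) (d := 1) (by norm_num) h1 h2 le_rfl
  rw [half hsymm, hw.map_one] at this
  have e : (1 / 2 : ℝ) / (1 / 2 * ((p - 1 / 2) * (1 - 1 / 2))) - w p / (p * ((p - 1 / 2) * (1 - p)))
      + 1 / (1 * ((1 - 1 / 2) * (1 - p))) = (p - w p) / (p * ((p - 1 / 2) * (1 - p))) := by
    have a1 : 2 * p - 1 ≠ 0 := by linarith
    have a2 : 1 - p ≠ 0 := by linarith
    have a3 : p ≠ 0 := by linarith
    rw [show p - 1 / 2 = (2 * p - 1) / 2 by ring]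
    field_simp
    ring
  rw [e] at this
  have hpos : 0 < p * ((p - 1 / 2) * (1 - p)) :=
    mul_pos (by linarith) (mul_pos (by linarith) (by linarith))
  linarith [(div_pos_iff_of_pos_right hpos).1 this]

theorem self_lt (hw : IsWeighting w) (hsymm : ∀ p ∈ Icc (0 : ℝ) 1, w p + w (1 - p) = 1)
    {p : ℝ} (hp : p ∈ Ioo (0 : ℝ) (1 / 2)) : p < w p := by
  have h1 := hsymm p ⟨hp.1.le, by linarith [hp.2]⟩
  have h2 := hw.lt_self hsymm (p := 1 - p) ⟨by linarith [hp.2], by linarith [hp.1]⟩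
  linarith

theorem continuousOn_deriv (hw : IsWeighting w) : ContinuousOn (deriv w) (Ioo 0 1) := by
  intro p hp
  have := (hw.hasDerivAt_iteratedDeriv (k := 1) (by norm_num) hp).continuousAt
  rw [iteratedDeriv_one] at this
  exact this.continuousWithinAt

theorem deriv_nonneg (hw : IsWeighting w) {p : ℝ} (hp : p ∈ Ioo (0 : ℝ) 1) : 0 ≤ deriv w p := by
  have h := (hw.hasDerivAt hp).hasDerivWithinAt (s := Ioo 0 1)
  rw [← h.derivWithin (isOpen_Ioo.uniqueDiffWithinAt hp)]
  exact (hw.strictMonoOn.monotoneOn.mono Ioo_subset_Icc_self).derivWithin_nonneg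

theorem deriv_symm (hw : IsWeighting w) (hsymm : ∀ p ∈ Icc (0 : ℝ) 1, w p + w (1 - p) = 1)
    {p : ℝ} (hp : p ∈ Ioo (0 : ℝ) 1) : deriv w (1 - p) = deriv w p := by
  have hp' : 1 - p ∈ Ioo (0 : ℝ) 1 := ⟨by linarith [hp.2], by linarith [hp.1]⟩
  have h1 : HasDerivAt (fun x => 1 - w (1 - x)) (deriv w (1 - p)) p := by
    have := ((hw.hasDerivAt hp').comp p ((hasDerivAt_id p).const_sub 1)).const_sub 1
    simpa using this
  refine (h1.congr_of_eventuallyEq ?_).deriv.symm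
  filter_upwards [isOpen_Ioo.mem_nhds hp] with x hx
  have := hsymm x (Ioo_subset_Icc_self hx)
  linarith

theorem convexOn_deriv (hw : IsWeighting w) : ConvexOn ℝ (Ioo 0 1) (deriv w) := by
  have h1 : ∀ p ∈ Ioo (0 : ℝ) 1, HasDerivAt (deriv w) (iteratedDeriv 2 w p) p := fun p hp => by
    have := hw.hasDerivAt_iteratedDeriv (k := 1) (by norm_num) hp
    rwa [iteratedDeriv_one] at this
  refine convexOn_of_hasDerivWithinAt2_nonneg (f' := iteratedDeriv 2 w)
    (f'' := iteratedDeriv 3 w) (convex_Ioo 0 1) hw.continuousOn_deriv ?_ ?_ ?_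
  · intro x hx; rw [interior_Ioo] at hx ⊢; exact (h1 x hx).hasDerivWithinAt
  · intro x hx; rw [interior_Ioo] at hx ⊢
    exact (hw.hasDerivAt_iteratedDeriv (k := 2) (by norm_num) hx).hasDerivWithinAt
  · intro x hx; rw [interior_Ioo] at hx; exact (hw.third_pos x hx).le

/-- The derivative is convex and symmetric about `1/2`; between `1 - y` and `y` it stays below its
common value at the two ends. -/
theorem monotoneOn_deriv (hw : IsWeighting w)
    (hsymm : ∀ p ∈ Icc (0 : ℝ) 1, w p + w (1 - p) = 1) :
    MonotoneOn (deriv w) (Ico (1 / 2) 1) := by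
  intro x hx y hy hxy
  have hy' : y ∈ Ioo (0 : ℝ) 1 := ⟨by linarith [hy.1], hy.2⟩
  have := hw.convexOn_deriv.le_max_of_mem_Icc (x := 1 - y) (y := y) (z := x)
    ⟨by linarith [hy.2], by linarith [hy.1]⟩ hy' ⟨by linarith [hx.1, hy.1], hxy⟩
  rwa [hw.deriv_symm hsymm hy', max_self] at this

/-- Because `w (3/4) < 3/4`, the chord over `[3/4, 1]` has slope above one. The derivative takes
this slope at some `ξ` and does not decrease afterwards. -/
theorem exists_one_lt_deriv (hw : IsWeighting w)
    (hsymm : ∀ p ∈ Icc (0 : ℝ) 1, w p + w (1 - p) = 1) :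
    ∃ ξ ∈ Ioo (1 / 2 : ℝ) 1, ∀ x ∈ Ico ξ 1, 1 < deriv w x := by
  obtain ⟨ξ, hξ, e⟩ := exists_hasDerivAt_eq_slope w (deriv w) (a := 3 / 4) (b := 1) (by norm_num)
    (hw.continuousOn.mono (Icc_subset_Icc (by norm_num) le_rfl))
    (fun x hx => hw.hasDerivAt ⟨by linarith [hx.1], hx.2⟩)
  have hlt := hw.lt_self hsymm (p := 3 / 4) (by norm_num)
  have h1 : 1 < deriv w ξ := by
    rw [e, hw.map_one, lt_div_iff₀ (by norm_num)]
    linarith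
  refine ⟨ξ, ⟨by linarith [hξ.1], hξ.2⟩, fun x hx => h1.trans_le ?_⟩
  exact hw.monotoneOn_deriv hsymm ⟨by linarith [hξ.1], hξ.2⟩
    ⟨by linarith [hξ.1, hx.1], hx.2⟩ hx.1

end IsWeighting

/-! ### The kernel `K`: integrability, behaviour at zero, comparison with `e^{-t}`. -/

/-- The renewal density associated with `w`: minus the derivative of `u ↦ w (e^{-u})`. -/
noncomputable def kernelDensity (w : ℝ → ℝ) (t : ℝ) : ℝ :=
  if 0 < t then Real.exp (-t) * deriv w (Real.exp (-t)) else 0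

theorem exp_neg_mem_Ioo {t : ℝ} (ht : 0 < t) : Real.exp (-t) ∈ Ioo (0 : ℝ) 1 :=
  ⟨Real.exp_pos _, by rw [Real.exp_lt_one_iff]; linarith⟩

theorem exp_neg_mem_Icc {t : ℝ} (ht : 0 ≤ t) : Real.exp (-t) ∈ Icc (0 : ℝ) 1 :=
  ⟨(Real.exp_pos _).le, by rw [Real.exp_le_one_iff]; linarith⟩

section kernel

variable {w : ℝ → ℝ}

theorem kernelDensity_of_pos {t : ℝ} (ht : 0 < t) :
    kernelDensity w t = Real.exp (-t) * deriv w (Real.exp (-t)) := if_pos ht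

theorem kernelDensity_of_nonpos {t : ℝ} (ht : t ≤ 0) : kernelDensity w t = 0 :=
  if_neg ht.not_gt

theorem IsWeighting.kernelDensity_nonneg (hw : IsWeighting w) (t : ℝ) :
    0 ≤ kernelDensity w t := by
  rcases lt_or_ge 0 t with ht | ht
  · rw [kernelDensity_of_pos ht]
    exact mul_nonneg (Real.exp_pos _).le (hw.deriv_nonneg (exp_neg_mem_Ioo ht))
  · rw [kernelDensity_of_nonpos ht]

theorem IsWeighting.continuousOn_kernelDensity (hw : IsWeighting w) :
    ContinuousOn (kernelDensity w) (Ioi 0) := by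
  have : ContinuousOn (fun t : ℝ => Real.exp (-t) * deriv w (Real.exp (-t))) (Ioi 0) := by
    refine ContinuousOn.mul (by fun_prop) (hw.continuousOn_deriv.comp (by fun_prop) ?_)
    exact fun t ht => exp_neg_mem_Ioo ht
  exact this.congr fun t ht => kernelDensity_of_pos ht

theorem IsWeighting.measurable_kernelDensity (hw : IsWeighting w) :
    Measurable (kernelDensity w) := by
  refine measurable_of_restrict_of_restrict_compl (s := Ioi 0) measurableSet_Ioi ?_ ?_
  · exact (continuousOn_iff_continuous_domRestrict.1 hw.continuousOn_kernelDensity).measurable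
  · have : (Ioi (0 : ℝ))ᶜ.domRestrict (kernelDensity w) = fun _ => 0 := by
      funext t
      exact kernelDensity_of_nonpos (not_lt.1 t.2)
    rw [this]
    exact measurable_const

theorem IsWeighting.hasDerivAt_comp_exp (hw : IsWeighting w) {t : ℝ} (ht : 0 < t) :
    HasDerivAt (fun t => - w (Real.exp (-t))) (kernelDensity w t) t := by
  have h : HasDerivAt (fun t : ℝ => Real.exp (-t)) (Real.exp (-t) * -1) t :=
    (hasDerivAt_neg t).exp
  refine ((hw.hasDerivAt (exp_neg_mem_Ioo ht)).comp t h).neg.congr_deriv ?_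
  rw [kernelDensity_of_pos ht]
  ring

theorem IsWeighting.continuousOn_comp_exp (hw : IsWeighting w) :
    ContinuousOn (fun t => w (Real.exp (-t))) (Ici 0) :=
  hw.continuousOn.comp (by fun_prop) fun _ ht => exp_neg_mem_Icc ht

/-- The derivative of `w` may blow up at one, so the kernel may be unbounded at zero; integrability
comes from its sign and the continuity of its primitive. -/
theorem IsWeighting.intervalIntegrable_kernelDensity (hw : IsWeighting w) {a b : ℝ}
    (ha : 0 ≤ a) (hab : a ≤ b) : IntervalIntegrable (kernelDensity w) volume a b := by
  refine intervalIntegral.intervalIntegrable_deriv_of_nonneg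
    (g := fun t => - w (Real.exp (-t))) ?_ ?_ ?_
  · rw [uIcc_of_le hab]
    exact (hw.continuousOn_comp_exp.mono fun x hx => ha.trans hx.1).neg
  · intro x hx
    rw [min_eq_left hab] at hx
    exact hw.hasDerivAt_comp_exp (ha.trans_lt hx.1)
  · exact fun x _ => hw.kernelDensity_nonneg x

theorem IsWeighting.integral_kernelDensity (hw : IsWeighting w) {a b : ℝ}
    (ha : 0 ≤ a) (hab : a ≤ b) :
    ∫ t in a..b, kernelDensity w t = w (Real.exp (-a)) - w (Real.exp (-b)) := by
  rw [intervalIntegral.integral_eq_sub_of_hasDerivAt_of_le hab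
    (f := fun t => - w (Real.exp (-t)))
    (hw.continuousOn_comp_exp.mono fun x hx => ha.trans hx.1).neg
    (fun x hx => hw.hasDerivAt_comp_exp (ha.trans_lt hx.1))
    (hw.intervalIntegrable_kernelDensity ha hab)]
  ring

theorem exp_neg_log_two : Real.exp (-Real.log 2) = 1 / 2 := by
  rw [Real.exp_neg, Real.exp_log (by norm_num)]; norm_num

theorem IsWeighting.antitoneOn_kernelDensity (hw : IsWeighting w)
    (hsymm : ∀ p ∈ Icc (0 : ℝ) 1, w p + w (1 - p) = 1) :
    AntitoneOn (kernelDensity w) (Ioc 0 (Real.log 2)) := by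
  intro s hs t ht hst
  have h2 : ∀ t ∈ Ioc (0 : ℝ) (Real.log 2), Real.exp (-t) ∈ Ico (1 / 2 : ℝ) 1 := fun t ht =>
    ⟨by rw [← exp_neg_log_two]; exact Real.exp_le_exp.2 (by linarith [ht.2]),
      (exp_neg_mem_Ioo ht.1).2⟩
  rw [kernelDensity_of_pos hs.1, kernelDensity_of_pos ht.1]
  have h3 : Real.exp (-t) ≤ Real.exp (-s) := Real.exp_le_exp.2 (by linarith)
  exact mul_le_mul h3 (hw.monotoneOn_deriv hsymm (h2 t ht) (h2 s hs) h3)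
    (hw.deriv_nonneg (exp_neg_mem_Ioo ht.1)) (Real.exp_pos _).le

/-- The kernel decreases on `(0, log 2]`, so `t / 2` times its value at `t` is at most its integral
over `[t/2, t]`, which is at most `1 - w (e^{-t})`. Thus `t K(t)` is continuous on the whole line
even if `K` is unbounded at zero. -/
theorem IsWeighting.tendsto_mul_kernelDensity (hw : IsWeighting w)
    (hsymm : ∀ p ∈ Icc (0 : ℝ) 1, w p + w (1 - p) = 1) :
    Tendsto (fun t => t * kernelDensity w t) (𝓝[>] 0) (𝓝 0) := by
  have hc : Tendsto (fun t : ℝ => 2 * (1 - w (Real.exp (-t)))) (𝓝[>] 0) (𝓝 0) := by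
    have h := (hw.continuousOn_comp_exp 0 self_mem_Ici).tendsto
    simp only [neg_zero, Real.exp_zero, hw.map_one] at h
    have h' := (h.mono_left (nhdsWithin_mono (0 : ℝ) Ioi_subset_Ici_self)).const_sub 1
    simpa using h'.const_mul 2
  refine tendsto_of_tendsto_of_tendsto_of_le_of_le' tendsto_const_nhds hc ?_ ?_
  · filter_upwards [self_mem_nhdsWithin] with t ht
    exact mul_nonneg (le_of_lt ht) (hw.kernelDensity_nonneg t)
  · filter_upwards [Ioc_mem_nhdsGT (Real.log_pos one_lt_two)] with t ht
    have ht0 : 0 < t := ht.1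
    have h1 : ∫ s in (t / 2)..t, kernelDensity w t ≤ ∫ s in (t / 2)..t, kernelDensity w s := by
      refine intervalIntegral.integral_mono_on (by linarith) (by simp)
        (hw.intervalIntegrable_kernelDensity (by linarith) (by linarith)) ?_
      intro s hs
      exact hw.antitoneOn_kernelDensity hsymm ⟨by linarith [hs.1], hs.2.trans ht.2⟩ ht hs.2
    rw [hw.integral_kernelDensity (by linarith) (by linarith), intervalIntegral.integral_const,
      smul_eq_mul] at h1
    have h2 := hw.le_one (exp_neg_mem_Icc (t := t / 2) (by linarith))
    nlinarith

/-- For `t ≤ -log ξ` the argument `e^{-t}` lies in `[ξ, 1)`, where the derivative of `w` exceeds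
one. This is the source of the positivity of the multiplier near zero. -/
theorem IsWeighting.exists_exp_lt_kernelDensity (hw : IsWeighting w)
    (hsymm : ∀ p ∈ Icc (0 : ℝ) 1, w p + w (1 - p) = 1) :
    ∃ δ ∈ Ioo (0 : ℝ) (Real.log 2), ∀ t ∈ Ioc 0 δ, Real.exp (-t) < kernelDensity w t := by
  obtain ⟨ξ, hξ, h⟩ := hw.exists_one_lt_deriv hsymm
  have hξ0 : 0 < ξ := by linarith [hξ.1]
  refine ⟨-Real.log ξ, ⟨by linarith [Real.log_neg hξ0 hξ.2], ?_⟩, fun t ht => ?_⟩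
  · rw [neg_lt, ← Real.log_inv]
    exact Real.log_lt_log (by norm_num) (by linarith [hξ.1])
  · rw [kernelDensity_of_pos ht.1]
    have : ξ ≤ Real.exp (-t) := by
      rw [← Real.log_le_iff_le_exp hξ0]; linarith [ht.2]
    have := h _ ⟨this, (exp_neg_mem_Ioo ht.1).2⟩
    nlinarith [Real.exp_pos (-t)]

end kernel

/-! ### Convolution of `[0,∞]`-valued functions and the regularity of the renewal series. -/

section lconvolution

variable {f g h : ℝ → ℝ≥0∞}

theorem lconvolution_add (hg : Measurable g) (hf : Measurable f) :
    f ⋆ₗ (g + h) = f ⋆ₗ g + f ⋆ₗ h := by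
  ext x
  simp only [lconvolution_def, Pi.add_apply, mul_add]
  exact lintegral_add_left (by fun_prop) _

theorem add_lconvolution (hf : Measurable f) (hh : Measurable h) :
    (f + g) ⋆ₗ h = f ⋆ₗ h + g ⋆ₗ h := by
  ext x
  simp only [lconvolution_def, Pi.add_apply, add_mul]
  exact lintegral_add_left (by fun_prop) _

theorem lintegral_lconvolution (hf : Measurable f) (hg : Measurable g) :
    ∫⁻ x, (f ⋆ₗ g) x = (∫⁻ x, f x) * ∫⁻ x, g x := by
  simp only [lconvolution_def]
  rw [lintegral_lintegral_swap (by fun_prop), ← lintegral_mul_const _ hf]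
  refine lintegral_congr fun y => ?_
  rw [lintegral_const_mul _ (by fun_prop), lintegral_add_left_eq_self g (-y)]

theorem lconvolution_of_nonpos (hf : ∀ t ≤ 0, f t = 0) (hg : ∀ t ≤ 0, g t = 0) {x : ℝ}
    (hx : x ≤ 0) : (f ⋆ₗ g) x = 0 := by
  rw [lconvolution_def]
  refine (lintegral_congr fun y => ?_).trans lintegral_zero
  rcases le_or_gt y 0 with hy | hy
  · rw [hf y hy, zero_mul]
  · rw [hg (-y + x) (by linarith), mul_zero]

/-- Multiplication by the identity is a derivation of the convolution algebra of functions on the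
positive half-line. -/
theorem ofReal_mul_lconvolution (hf : ∀ t ≤ 0, f t = 0) (hg : ∀ t ≤ 0, g t = 0)
    (mf : Measurable f) (mg : Measurable g) :
    (fun t => ENNReal.ofReal t * (f ⋆ₗ g) t) =
      (fun t => ENNReal.ofReal t * f t) ⋆ₗ g + f ⋆ₗ (fun t => ENNReal.ofReal t * g t) := by
  ext x
  simp only [lconvolution_def, Pi.add_apply]
  rw [← lintegral_const_mul _ (by fun_prop), ← lintegral_add_left (by fun_prop)]
  refine lintegral_congr fun y => ?_
  rcases le_or_gt y 0 with hy | hy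
  · simp [hf y hy]
  rcases le_or_gt (-y + x) 0 with hy' | hy'
  · simp [hg _ hy']
  have : ENNReal.ofReal x = ENNReal.ofReal y + ENNReal.ofReal (-y + x) := by
    rw [← ENNReal.ofReal_add hy.le hy'.le]; congr 1; ring
  rw [this]
  ring

theorem lconvolution_congr_on {f' g' : ℝ → ℝ≥0∞} (hf : ∀ t ≤ 0, f t = 0)
    (hg : ∀ t ≤ 0, g t = 0) (hf' : ∀ t ≤ 0, f' t = 0) (hg' : ∀ t ≤ 0, g' t = 0) {x : ℝ}
    (hff' : ∀ t ≤ x, f t = f' t) (hgg' : ∀ t ≤ x, g t = g' t) :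
    (f ⋆ₗ g) x = (f' ⋆ₗ g') x := by
  simp only [lconvolution_def]
  refine lintegral_congr fun y => ?_
  rcases le_or_gt y 0 with hy | hy
  · simp [hf y hy, hf' y hy]
  rcases le_or_gt (-y + x) 0 with hy' | hy'
  · simp [hg _ hy', hg' _ hy']
  rw [hff' y (by linarith), hgg' _ (by linarith)]

/-- Read `f` as a finite measure: averaging translates of a bounded continuous function against it
preserves boundedness and, by dominated convergence, continuity. -/
theorem exists_continuous_lconvolution {a : ℝ → ℝ} (ha : Continuous a) (ha0 : ∀ t, 0 ≤ a t)
    {C : ℝ} (hC : ∀ t, a t ≤ C) (mf : Measurable f) (hf : ∫⁻ t, f t ≠ ∞) :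
    ∃ b : ℝ → ℝ, Continuous b ∧ (∀ t, 0 ≤ b t) ∧ (∃ C', ∀ t, b t ≤ C') ∧
      ∀ t, (f ⋆ₗ fun s => ENNReal.ofReal (a s)) t = ENNReal.ofReal (b t) := by
  set ν : Measure ℝ := volume.withDensity f with hν
  have : IsFiniteMeasure ν := isFiniteMeasure_withDensity hf
  have hi : ∀ t, Integrable (fun y => a (-y + t)) ν := fun t =>
    (integrable_const C).mono' (by fun_prop) (Eventually.of_forall fun y => by
      rw [Real.norm_of_nonneg (ha0 _)]; exact hC _)
  refine ⟨fun t => ∫ y, a (-y + t) ∂ν, ?_, fun t => integral_nonneg fun y => ha0 _,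
    ⟨∫ _, C ∂ν, fun t => integral_mono (hi t) (integrable_const C) fun y => hC _⟩, fun t => ?_⟩
  · refine continuous_of_dominated (bound := fun _ => C) (fun t => (hi t).1) ?_
      (integrable_const C) ?_
    · exact fun t => Eventually.of_forall fun y => by
        rw [Real.norm_of_nonneg (ha0 _)]; exact hC _
    · exact Eventually.of_forall fun y => by fun_prop
  · rw [ofReal_integral_eq_lintegral_ofReal (hi t) (Eventually.of_forall fun y => ha0 _), hν,
      lintegral_withDensity_eq_lintegral_mul _ mf (by fun_prop)]
    rfl

/-- The renewal series `∑ₙ K^{⋆(n+1)}`. -/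
noncomputable def renewalSeries (K : ℝ → ℝ≥0∞) : ℝ → ℝ≥0∞ :=
  fun t => ∑' n : ℕ, ((fun f => K ⋆ₗ f)^[n] K) t

variable {K : ℝ → ℝ≥0∞}

theorem measurable_iterate_lconvolution (mK : Measurable K) (n : ℕ) :
    Measurable ((fun f => K ⋆ₗ f)^[n] K) := by
  induction n with
  | zero => exact mK
  | succ n ih =>
    rw [Function.iterate_succ_apply']
    exact measurable_lconvolution _ mK ih

theorem measurable_renewalSeries (mK : Measurable K) : Measurable (renewalSeries K) :=
  Measurable.tsum (measurable_iterate_lconvolution mK)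

theorem renewalSeries_eq (mK : Measurable K) :
    renewalSeries K = K + K ⋆ₗ renewalSeries K := by
  ext t
  rw [Pi.add_apply, lconvolution_def, renewalSeries, tsum_eq_zero_add' ENNReal.summable]
  congr 1
  simp only [renewalSeries, ← ENNReal.tsum_mul_left]
  rw [lintegral_tsum]
  · exact tsum_congr fun n => by rw [Function.iterate_succ_apply']; rfl
  · intro n
    have := measurable_iterate_lconvolution mK n
    fun_prop

theorem renewalSeries_of_nonpos (hK : ∀ t ≤ 0, K t = 0) {t : ℝ} (ht : t ≤ 0) :
    renewalSeries K t = 0 := by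
  have : ∀ n : ℕ, ∀ t ≤ 0, ((fun f => K ⋆ₗ f)^[n] K) t = 0 := by
    intro n
    induction n with
    | zero => exact hK
    | succ n ih =>
      rw [Function.iterate_succ_apply']
      exact fun t ht => lconvolution_of_nonpos hK ih ht
  simp [renewalSeries, fun n => this n t ht]

/-- Masses multiply under convolution, so the total mass is a geometric series with ratio below one.
-/
theorem lintegral_renewalSeries_ne_top (mK : Measurable K) (hK : ∫⁻ t, K t < 1) :
    ∫⁻ t, renewalSeries K t ≠ ∞ := by
  have : ∀ n : ℕ, ∫⁻ t, ((fun f => K ⋆ₗ f)^[n] K) t = (∫⁻ t, K t) ^ (n + 1) := by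
    intro n
    induction n with
    | zero => simp
    | succ n ih =>
      rw [Function.iterate_succ_apply', lintegral_lconvolution mK
        (measurable_iterate_lconvolution mK n), ih]
      ring
  simp only [renewalSeries]
  rw [lintegral_tsum fun n => (measurable_iterate_lconvolution mK n).aemeasurable]
  simp only [this, pow_succ, ENNReal.tsum_mul_right, ENNReal.tsum_geometric]
  refine ENNReal.mul_ne_top (ENNReal.inv_ne_top.2 ?_) (hK.trans ENNReal.one_lt_top).ne
  exact (tsub_pos_of_lt hK).ne'

/-- If `t K(t)` has a continuous bounded version on `(-∞,1]`, so has `t r(t)`, where `r` is the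
renewal series of `K`. -/
theorem exists_continuous_renewalSeries (mK : Measurable K) (hK0 : ∀ t ≤ 0, K t = 0)
    (hK : ∫⁻ t, K t < 1) {a : ℝ → ℝ} (ha : Continuous a) (ha0 : ∀ t, 0 ≤ a t)
    {C : ℝ} (hC : ∀ t, a t ≤ C) (haK : ∀ t ≤ 1, ENNReal.ofReal t * K t = ENNReal.ofReal (a t))
    (hneg : ∀ t ≤ 0, a t = 0) :
    ∃ ρ : ℝ → ℝ, Continuous ρ ∧ (∀ t, 0 ≤ ρ t) ∧
      ∀ᵐ t, t ≤ 1 → ENNReal.ofReal t * renewalSeries K t = ENNReal.ofReal (ρ t) := by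
  set r := renewalSeries K with hr
  have mr : Measurable r := measurable_renewalSeries mK
  have r0 : ∀ t ≤ 0, r t = 0 := fun t ht => renewalSeries_of_nonpos hK0 ht
  have hr1 : ∫⁻ t, r t ≠ ∞ := lintegral_renewalSeries_ne_top mK hK
  have hrK : r = K + K ⋆ₗ r := renewalSeries_eq mK
  set X : (ℝ → ℝ≥0∞) → ℝ → ℝ≥0∞ := fun f t => ENNReal.ofReal t * f t with hX
  have mX : ∀ {f}, Measurable f → Measurable (X f) := fun hf => by simp only [hX]; fun_prop
  have X0 : ∀ f, ∀ t ≤ 0, X f t = 0 := fun f t ht => by simp [hX, ENNReal.ofReal_of_nonpos ht]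
  -- Applying the derivation `X` to `r = K + K ⋆ r` gives `X r = V + K ⋆ X r`, again a renewal
  -- equation. Its solution should be `X r = V + r ⋆ V`, in which only `X K`, continuous by
  -- hypothesis, is convolved with `r`.
  set V : ℝ → ℝ≥0∞ := X K + X K ⋆ₗ r with hV
  have mXKr : Measurable (X K ⋆ₗ r) := measurable_lconvolution _ (mX mK) mr
  have mV : Measurable V := (mX mK).add mXKr
  have e1 : X r = V + K ⋆ₗ X r := by
    conv_lhs => rw [hrK]
    have : X (K + K ⋆ₗ r) = X K + X (K ⋆ₗ r) := by ext t; simp [hX, mul_add]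
    rw [this, hV, add_assoc]
    congr 1
    exact ofReal_mul_lconvolution hK0 r0 mK mr
  have mKX : Measurable (K ⋆ₗ X r) := measurable_lconvolution _ mK (mX mr)
  have e2 : r ⋆ₗ X r = r ⋆ₗ V + r ⋆ₗ (K ⋆ₗ X r) := by
    conv_lhs => rw [e1]
    exact lconvolution_add mV mr
  have e3 : ∀ g, Measurable g → r ⋆ₗ g = K ⋆ₗ g + r ⋆ₗ (K ⋆ₗ g) := by
    intro g mg
    conv_lhs => rw [hrK]
    rw [add_lconvolution mK mg, lconvolution_comm (f := K) (g := r), lconvolution_assoc mr mK mg]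
  -- The solution is obtained by cancelling `r ⋆ (K ⋆ X r)`, which must be finite. For `t ≤ 1` one
  -- has `X r ≤ r`, so it is dominated by `r ⋆ (K ⋆ r)`, which is integrable and hence almost
  -- everywhere finite.
  have hfin : ∀ᵐ t, (r ⋆ₗ (K ⋆ₗ r)) t < ∞ := by
    refine ae_lt_top (measurable_lconvolution _ mr (measurable_lconvolution _ mK mr)) ?_
    rw [lintegral_lconvolution mr (measurable_lconvolution _ mK mr),
      lintegral_lconvolution mK mr]
    exact ENNReal.mul_ne_top hr1 (ENNReal.mul_ne_top (hK.trans ENNReal.one_lt_top).ne hr1)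
  have hle : ∀ t ≤ 1, (r ⋆ₗ (K ⋆ₗ X r)) t ≤ (r ⋆ₗ (K ⋆ₗ r)) t := by
    intro t ht
    have hXr : ∀ t ≤ 1, X r t ≤ r t := fun t ht => by
      have : ENNReal.ofReal t ≤ 1 := by simpa using ENNReal.ofReal_le_ofReal ht
      simpa [hX] using mul_le_mul_left this (r t)
    have h1 : ∀ t ≤ 1, (K ⋆ₗ X r) t ≤ (K ⋆ₗ r) t := by
      intro t ht
      simp only [lconvolution_def]
      refine lintegral_mono fun y => ?_
      rcases le_or_gt y 0 with hy | hy
      · simp [hK0 y hy]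
      · exact mul_le_mul_right (hXr _ (by linarith)) _
    simp only [lconvolution_def (f := r)]
    refine lintegral_mono fun y => ?_
    rcases le_or_gt y 0 with hy | hy
    · simp [r0 y hy]
    · exact mul_le_mul_right (h1 _ (by linarith)) _
  have e4 : ∀ᵐ t, t ≤ 1 → X r t = V t + (r ⋆ₗ V) t := by
    filter_upwards [hfin] with t ht ht1
    have hne : (r ⋆ₗ (K ⋆ₗ X r)) t ≠ ∞ := ((hle t ht1).trans_lt ht).ne
    have h := congrFun (e2.symm.trans (e3 _ (mX mr))) t
    simp only [Pi.add_apply] at h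
    rw [ENNReal.add_left_inj hne] at h
    rw [h]
    exact congrFun e1 t
  obtain ⟨b, hb, hb0, ⟨C', hC'⟩, hbe⟩ := exists_continuous_lconvolution ha ha0 hC mr hr1
  have hVab : ∀ t ≤ 1, V t = ENNReal.ofReal (a t + b t) := by
    intro t ht
    rw [hV, Pi.add_apply, ENNReal.ofReal_add (ha0 t) (hb0 t), ← hbe, ← haK t ht,
      lconvolution_comm (f := r)]
    congr 1
    exact lconvolution_congr_on (X0 K) r0 (fun t ht => by simp [hneg t ht]) r0
      (fun s hs => haK s (hs.trans ht)) fun _ _ => rfl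
  have b0 : ∀ t ≤ 0, b t = 0 := by
    intro t ht
    have := hbe t
    rw [lconvolution_of_nonpos r0 (fun t ht => by simp [hneg t ht]) ht] at this
    exact le_antisymm (ENNReal.ofReal_eq_zero.1 this.symm) (hb0 t)
  obtain ⟨c, hc, hc0, -, hce⟩ := exists_continuous_lconvolution (a := fun t => a t + b t)
    (ha.add hb) (fun t => add_nonneg (ha0 t) (hb0 t)) (fun t => add_le_add (hC t) (hC' t)) mr hr1
  refine ⟨fun t => (a t + b t) + c t, (ha.add hb).add hc,
    fun t => add_nonneg (add_nonneg (ha0 t) (hb0 t)) (hc0 t), ?_⟩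
  filter_upwards [e4] with t ht ht1
  rw [ENNReal.ofReal_add (add_nonneg (ha0 t) (hb0 t)) (hc0 t), ← hce, ← hVab t ht1]
  refine (ht ht1).trans ?_
  congr 1
  have hab : ∀ t ≤ 0, ENNReal.ofReal (a t + b t) = 0 := fun t ht => by simp [hneg t ht, b0 t ht]
  exact lconvolution_congr_on r0 (fun t ht => (hVab t (by linarith)).trans (hab t ht)) r0 hab
    (fun _ _ => rfl) fun s hs => hVab s (hs.trans ht1)

end lconvolution

/-! ### Construction of the renewal density. -/

theorem nonneg_of_ae_nonneg_of_continuousOn {q : ℝ → ℝ} {U : Set ℝ} (hU : IsOpen U)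
    (hq : ContinuousOn q U) (h : ∀ᵐ x, x ∈ U → 0 ≤ q x) : ∀ x ∈ U, 0 ≤ q x := by
  intro x hx
  by_contra! hlt
  have ho : IsOpen (U ∩ q ⁻¹' Iio 0) := hq.isOpen_inter_preimage hU isOpen_Iio
  refine (ho.measure_pos volume ⟨x, hx, hlt⟩).ne' ?_
  refine measure_mono_null (fun y hy => ?_) h
  simp only [mem_compl_iff, mem_ofPred_eq, not_forall]
  exact ⟨hy.1, not_le.2 hy.2⟩

variable {w : ℝ → ℝ}

theorem IsWeighting.continuous_mul_kernelDensity (hw : IsWeighting w)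
    (hsymm : ∀ p ∈ Icc (0 : ℝ) 1, w p + w (1 - p) = 1) :
    Continuous fun t => t * kernelDensity w t := by
  rw [continuous_iff_continuousAt]
  intro t
  rcases lt_trichotomy t 0 with ht | rfl | ht
  · refine (continuousAt_const (y := (0 : ℝ))).congr ?_
    filter_upwards [Iio_mem_nhds ht] with s hs
    rw [kernelDensity_of_nonpos (le_of_lt hs), mul_zero]
  · rw [continuousAt_iff_continuous_left'_right']
    simp only [ContinuousWithinAt, zero_mul]
    refine ⟨tendsto_const_nhds.congr' ?_, hw.tendsto_mul_kernelDensity hsymm⟩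
    filter_upwards [self_mem_nhdsWithin] with s hs
    rw [kernelDensity_of_nonpos (le_of_lt hs), mul_zero]
  · exact continuousAt_id.mul (hw.continuousOn_kernelDensity.continuousAt (Ioi_mem_nhds ht))

theorem IsWeighting.lintegral_kernelDensity (hw : IsWeighting w) {b : ℝ} (hb : 0 ≤ b) :
    ∫⁻ t in Ioc 0 b, ENNReal.ofReal (kernelDensity w t) =
      ENNReal.ofReal (1 - w (Real.exp (-b))) := by
  have h := hw.integral_kernelDensity le_rfl hb
  rw [neg_zero, Real.exp_zero, hw.map_one, intervalIntegral.integral_of_le hb] at h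
  rw [← h, ofReal_integral_eq_lintegral_ofReal
    ((intervalIntegrable_iff_integrableOn_Ioc_of_le hb).1
      (hw.intervalIntegrable_kernelDensity le_rfl hb))
    (Eventually.of_forall hw.kernelDensity_nonneg)]

/-- The renewal density of `-log`-transformed weighting: the solution of the renewal equation
`w (e^{-u}) + ∫_0^u w (e^{-(u-v)}) r(v) dv = 1`. -/
theorem IsWeighting.exists_renewalDensity (hw : IsWeighting w)
    (hsymm : ∀ p ∈ Icc (0 : ℝ) 1, w p + w (1 - p) = 1) :
    ∃ r : ℝ → ℝ, (∀ t, 0 ≤ r t) ∧ Measurable r ∧ ContinuousOn r (Ioi 0) ∧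
      IntervalIntegrable r volume 0 1 ∧
      (∀ u ∈ Icc (0 : ℝ) 1,
        w (Real.exp (-u)) + ∫ v in (0 : ℝ)..u, w (Real.exp (-(u - v))) * r v = 1) ∧
      ∃ δ ∈ Ioo (0 : ℝ) (Real.log 2), ∀ t ∈ Ioc 0 δ,
        Real.exp (-t) + ∫ s in (0 : ℝ)..t, Real.exp (-(t - s)) * r s < r t := by
  set κ := kernelDensity w with hκ
  have mκ : Measurable κ := hw.measurable_kernelDensity
  -- Cutting the kernel at `1` lowers its mass to `1 - w (e^{-1}) < 1`, so the renewal series is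
  -- integrable. By causality the equations on `[0,1]` are unaffected, and `1 > log 2` leaves room
  -- for all horizons used later.
  set K : ℝ → ℝ≥0∞ := (Ioc 0 1).indicator fun t => ENNReal.ofReal (κ t) with hKdef
  have mK : Measurable K := mκ.ennreal_ofReal.indicator measurableSet_Ioc
  have K0 : ∀ t ≤ 0, K t = 0 := fun t ht => indicator_of_notMem (fun h => ht.not_gt h.1) _
  have Kκ : ∀ t ≤ 1, K t = ENNReal.ofReal (κ t) := by
    intro t ht
    rcases le_or_gt t 0 with h | h
    · rw [K0 t h, hκ, kernelDensity_of_nonpos h, ENNReal.ofReal_zero]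
    · exact indicator_of_mem (show t ∈ Ioc (0 : ℝ) 1 from ⟨h, ht⟩) _
  have K1 : ∫⁻ t, K t < 1 := by
    rw [hKdef, lintegral_indicator measurableSet_Ioc, hw.lintegral_kernelDensity zero_le_one,
      ← ENNReal.ofReal_one]
    refine (ENNReal.ofReal_lt_ofReal_iff one_pos).2 ?_
    linarith [hw.pos ⟨(exp_neg_mem_Ioo one_pos).1, (exp_neg_mem_Ioo one_pos).2.le⟩]
  have hcont := hw.continuous_mul_kernelDensity hsymm
  have ha : Continuous fun t => min t 1 * κ (min t 1) :=
    hcont.comp (continuous_id.min continuous_const)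
  obtain ⟨C, hC⟩ := (isCompact_Icc (a := (0 : ℝ)) (b := 1)).exists_bound_of_continuousOn
    hcont.continuousOn
  have hneg : ∀ t ≤ 0, min t 1 * κ (min t 1) = 0 := fun t ht => by
    rw [hκ, kernelDensity_of_nonpos ((min_le_left _ _).trans ht), mul_zero]
  have hC0 : 0 ≤ C := (norm_nonneg _).trans (hC 0 (by simp))
  obtain ⟨ρ, hρ, hρ0, hρr⟩ := exists_continuous_renewalSeries mK K0 K1 ha
    (fun t => by
      rcases le_or_gt t 0 with h | h
      · exact (hneg t h).ge
      · exact mul_nonneg (le_min h.le zero_le_one) (hw.kernelDensity_nonneg _))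
    (C := C) (fun t => by
      rcases le_or_gt t 0 with h | h
      · rw [hneg t h]; exact hC0
      · exact (le_abs_self _).trans (hC _ ⟨le_min h.le zero_le_one, min_le_right _ _⟩))
    (fun t ht => by
      rw [Kκ t ht, min_eq_left ht]
      rcases le_or_gt t 0 with h | h
      · rw [hκ, kernelDensity_of_nonpos h]; simp
      · rw [ENNReal.ofReal_mul h.le]) hneg
  set R := renewalSeries K with hR
  have mR : Measurable R := measurable_renewalSeries mK
  have R0 : ∀ t ≤ 0, R t = 0 := fun t ht => renewalSeries_of_nonpos K0 ht
  have R1 : ∫⁻ t, R t ≠ ∞ := lintegral_renewalSeries_ne_top mK K1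
  have hRK : R = K + K ⋆ₗ R := renewalSeries_eq mK
  -- Dividing the continuous version of `t R(t)` by `t` gives a representative of `R` on `(-∞, 1]`
  -- that is finite everywhere and continuous away from zero.
  set r : ℝ → ℝ := (Ioi 0).indicator fun t => ρ t / t with hr
  have rpos : ∀ t, 0 < t → r t = ρ t / t := fun t ht =>
    indicator_of_mem (show t ∈ Ioi (0 : ℝ) from ht) _
  have r0 : ∀ t, 0 ≤ r t := fun t => indicator_nonneg
    (fun t ht => div_nonneg (hρ0 t) (le_of_lt ht)) t
  have mr : Measurable r := (hρ.measurable.div measurable_id).indicator measurableSet_Ioi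
  have cr : ContinuousOn r (Ioi 0) := by
    refine ContinuousOn.congr (f := fun t => ρ t / t) ?_ fun t ht => rpos t ht
    exact hρ.continuousOn.div continuousOn_id fun t ht => (ne_of_gt ht)
  have hRr : ∀ᵐ t, t ≤ 1 → R t = ENNReal.ofReal (r t) := by
    filter_upwards [hρr] with t ht ht1
    rcases le_or_gt t 0 with h | h
    · rw [R0 t h, hr, indicator_of_notMem (by simpa using h), ENNReal.ofReal_zero]
    · rw [rpos t h, ENNReal.ofReal_div_of_pos h, ← ht ht1, mul_comm, mul_div_assoc,
        ENNReal.div_self (by simpa using h) ENNReal.ofReal_ne_top, mul_one]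
  have ir : IntervalIntegrable r volume 0 1 := by
    rw [intervalIntegrable_iff_integrableOn_Ioc_of_le zero_le_one]
    refine ⟨mr.aestronglyMeasurable, ?_⟩
    rw [hasFiniteIntegral_iff_ofReal (Eventually.of_forall r0)]
    refine lt_of_le_of_lt ?_ (lt_top_iff_ne_top.2 R1)
    refine le_trans (le_of_eq ?_) (setLIntegral_le_lintegral (Ioc 0 1) R)
    refine setLIntegral_congr_fun_ae measurableSet_Ioc ?_
    filter_upwards [hRr] with t ht ht1
    exact (ht ht1.2).symm
  have ir' : ∀ u ∈ Icc (0 : ℝ) 1, IntervalIntegrable r volume 0 u := fun u hu =>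
    ir.mono_set (by rw [uIcc_of_le hu.1, uIcc_of_le zero_le_one]; exact Icc_subset_Icc le_rfl hu.2)
  have hconv : ∀ (G : ℝ → ℝ≥0∞) (u : ℝ), u ≤ 1 → (∀ t < 0, G t = 0) →
      (R ⋆ₗ G) u = ∫⁻ y in Ioc 0 u, ENNReal.ofReal (r y) * G (u - y) := by
    intro G u hu hG
    rw [lconvolution_def, ← lintegral_indicator measurableSet_Ioc]
    refine lintegral_congr_ae ?_
    filter_upwards [hRr] with y hy
    by_cases hyu : y ∈ Ioc 0 u
    · rw [indicator_of_mem hyu, hy (hyu.2.trans hu), neg_add_eq_sub]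
    · rw [indicator_of_notMem hyu]
      rcases le_or_gt y 0 with h | h
      · rw [R0 y h, zero_mul]
      · rw [hG _ (by have : u < y := by by_contra! h'; exact hyu ⟨h, h'⟩
                     linarith), mul_zero]
  have toReal : ∀ (F : ℝ → ℝ) (u : ℝ), 0 ≤ u → IntervalIntegrable F volume 0 u →
      (∀ y ∈ Ioc 0 u, 0 ≤ F y) →
      ∫⁻ y in Ioc 0 u, ENNReal.ofReal (F y) = ENNReal.ofReal (∫ y in (0 : ℝ)..u, F y) := by
    intro F u hu hF hF0
    rw [intervalIntegral.integral_of_le hu, ofReal_integral_eq_lintegral_ofReal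
      ((intervalIntegrable_iff_integrableOn_Ioc_of_le hu).1 hF)
      ((ae_restrict_iff' measurableSet_Ioc).2 (Eventually.of_forall hF0))]
  have ik : ∀ u ∈ Icc (0 : ℝ) 1,
      IntervalIntegrable (fun v => w (Real.exp (-(u - v))) * r v) volume 0 u := by
    intro u hu
    refine (ir' u hu).continuousOn_mul ?_
    rw [uIcc_of_le hu.1]
    exact hw.continuousOn_comp_exp.comp (t := Ici 0) (f := fun v => u - v) (by fun_prop)
      (fun v hv => by simpa using hv.2)
  refine ⟨r, r0, mr, cr, ir, ?_, ?_⟩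
  · intro u hu
    -- With the Heaviside function `J`, `K ⋆ J` is `1 - w (e^{-t})` on `[0,1]`; convolving `R = K +
    -- K ⋆ R` with `J` turns the equation for densities into the integrated renewal equation.
    set J : ℝ → ℝ≥0∞ := (Ici 0).indicator 1 with hJ
    have mJ : Measurable J := measurable_one.indicator measurableSet_Ici
    have J0 : ∀ t < 0, J t = 0 := fun t ht => indicator_of_notMem (by simpa using ht) _
    have J1 : ∀ t, 0 ≤ t → J t = 1 := fun t ht => by
      rw [hJ, indicator_of_mem (by simpa using ht)]; rfl
    have hKJ : ∀ t ∈ Icc (0 : ℝ) 1, (K ⋆ₗ J) t = ENNReal.ofReal (1 - w (Real.exp (-t))) := by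
      intro t ht
      rw [← hw.lintegral_kernelDensity ht.1, lconvolution_def,
        ← lintegral_indicator measurableSet_Ioc]
      refine lintegral_congr fun y => ?_
      by_cases hy : y ∈ Ioc 0 t
      · rw [indicator_of_mem hy, J1 _ (by linarith [hy.2]), mul_one, Kκ y (hy.2.trans ht.2)]
      · rw [indicator_of_notMem hy]
        rcases le_or_gt y 0 with h | h
        · rw [K0 y h, zero_mul]
        · rw [J0 _ (by have : t < y := by by_contra! h'; exact hy ⟨h, h'⟩
                       linarith), mul_zero]
    have hKJ0 : ∀ t < 0, (K ⋆ₗ J) t = 0 := by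
      intro t ht
      rw [lconvolution_def]
      refine (lintegral_congr fun y => ?_).trans lintegral_zero
      rcases le_or_gt y 0 with h | h
      · rw [K0 y h, zero_mul]
      · rw [J0 _ (by linarith), mul_zero]
    have e : R ⋆ₗ J = K ⋆ₗ J + R ⋆ₗ (K ⋆ₗ J) := by
      conv_lhs => rw [hRK]
      rw [add_lconvolution mK mJ, lconvolution_comm (f := K) (g := R),
        lconvolution_assoc mR mK mJ]
    have e1 := congrFun e u
    rw [Pi.add_apply, hconv J u hu.2 J0, hconv _ u hu.2 hKJ0, hKJ u hu] at e1
    have e2 : ∫⁻ y in Ioc 0 u, ENNReal.ofReal (r y) * J (u - y) =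
        ENNReal.ofReal (∫ y in (0 : ℝ)..u, r y) := by
      rw [← toReal r u hu.1 (ir' u hu) fun y _ => r0 y]
      refine setLIntegral_congr_fun measurableSet_Ioc fun y hy => ?_
      rw [J1 _ (by linarith [hy.2]), mul_one]
    have e3 : ∫⁻ y in Ioc 0 u, ENNReal.ofReal (r y) * (K ⋆ₗ J) (u - y) =
        ENNReal.ofReal (∫ y in (0 : ℝ)..u, (r y - w (Real.exp (-(u - y))) * r y)) := by
      rw [← toReal _ u hu.1 ((ir' u hu).sub (ik u hu)) fun y hy => ?_]
      · refine setLIntegral_congr_fun measurableSet_Ioc fun y hy => ?_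
        rw [hKJ _ ⟨by linarith [hy.2], by linarith [hy.1, hu.2]⟩, ← ENNReal.ofReal_mul (r0 y)]
        congr 1
        ring
      · have := hw.le_one (exp_neg_mem_Icc (t := u - y) (by linarith [hy.2]))
        nlinarith [r0 y]
    have h1 := hw.le_one (exp_neg_mem_Icc hu.1)
    have n1 : 0 ≤ ∫ y in (0 : ℝ)..u, r y := intervalIntegral.integral_nonneg hu.1 fun y _ => r0 y
    have n2 : 0 ≤ ∫ y in (0 : ℝ)..u, (r y - w (Real.exp (-(u - y))) * r y) := by
      refine intervalIntegral.integral_nonneg hu.1 fun y hy => ?_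
      have := hw.le_one (exp_neg_mem_Icc (t := u - y) (by linarith [hy.2]))
      nlinarith [r0 y]
    rw [e2, e3, ← ENNReal.ofReal_add (by linarith) n2,
      ENNReal.ofReal_eq_ofReal_iff n1 (by linarith),
      intervalIntegral.integral_sub (ir' u hu) (ik u hu)] at e1
    linarith
  · obtain ⟨δ, hδ, hlt⟩ := hw.exists_exp_lt_kernelDensity hsymm
    have hδ1 : δ < 1 := hδ.2.trans (by linarith [Real.log_two_lt_d9])
    have ie : ∀ u ∈ Icc (0 : ℝ) 1,
        IntervalIntegrable (fun v => Real.exp (-(u - v)) * r v) volume 0 u := fun u hu =>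
      (ir' u hu).continuousOn_mul (by fun_prop)
    -- Replacing the kernel by the smaller `e^{-t}` inside the convolution in `R = K + R ⋆ K` gives
    -- the lower bound `κ + e * r` for `r`.
    have hae : ∀ᵐ t, t ∈ Ioo 0 δ →
        0 ≤ r t - (κ t + ∫ s in (0 : ℝ)..t, Real.exp (-(t - s)) * r s) := by
      filter_upwards [hRr] with t ht htδ
      have ht1 : t ≤ 1 := (htδ.2.trans hδ1).le
      have e1 := congrFun hRK t
      rw [Pi.add_apply, lconvolution_comm, hconv K t ht1 (fun t ht => K0 t ht.le), ht ht1,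
        Kκ t ht1] at e1
      have e2 : ENNReal.ofReal (∫ s in (0 : ℝ)..t, Real.exp (-(t - s)) * r s) ≤
          ∫⁻ y in Ioc 0 t, ENNReal.ofReal (r y) * K (t - y) := by
        rw [← toReal _ t htδ.1.le (ie t ⟨htδ.1.le, ht1⟩)
          (fun y _ => mul_nonneg (Real.exp_pos _).le (r0 y)),
          setLIntegral_congr (Ioo_ae_eq_Ioc (μ := volume)).symm,
          setLIntegral_congr (Ioo_ae_eq_Ioc (μ := volume)).symm]
        refine setLIntegral_mono' measurableSet_Ioo fun y hy => ?_
        rw [Kκ _ (by linarith [hy.1]), ← ENNReal.ofReal_mul (r0 y), mul_comm]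
        refine ENNReal.ofReal_le_ofReal (mul_le_mul_of_nonneg_left ?_ (r0 y))
        exact (hlt (t - y) ⟨by linarith [hy.2], by linarith [hy.1, htδ.2]⟩).le
      have e3 : ENNReal.ofReal (κ t + ∫ s in (0 : ℝ)..t, Real.exp (-(t - s)) * r s) ≤
          ENNReal.ofReal (r t) := by
        rw [e1, ENNReal.ofReal_add (hw.kernelDensity_nonneg t)
          (intervalIntegral.integral_nonneg htδ.1.le
            fun y _ => mul_nonneg (Real.exp_pos _).le (r0 y))]
        gcongr
      linarith [(ENNReal.ofReal_le_ofReal_iff (r0 t)).1 e3]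
    have hfac : ∀ t, ∫ s in (0 : ℝ)..t, Real.exp (-(t - s)) * r s =
        Real.exp (-t) * ∫ s in (0 : ℝ)..t, Real.exp s * r s := by
      intro t
      rw [← intervalIntegral.integral_const_mul]
      refine intervalIntegral.integral_congr fun s _ => ?_
      rw [← mul_assoc, ← Real.exp_add]
      congr 2
      ring
    -- The renewal identity for densities holds only almost everywhere; continuity on `(0, δ)` makes
    -- the weak inequality pointwise, and strictness returns with `e^{-t} < κ t`.
    have hq := nonneg_of_ae_nonneg_of_continuousOn isOpen_Ioo ?_ hae
    · refine ⟨δ / 2, ⟨by linarith [hδ.1], by linarith [hδ.1, hδ.2]⟩, fun t ht => ?_⟩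
      have h1 := hq t ⟨ht.1, by linarith [ht.2, hδ.1]⟩
      have h2 := hlt t ⟨ht.1, by linarith [ht.2, hδ.1]⟩
      linarith
    · simp only [hfac]
      refine (cr.mono fun x hx => hx.1).sub ((hw.continuousOn_kernelDensity.mono
        fun x hx => hx.1).add (ContinuousOn.mul (by fun_prop) ?_))
      have := intervalIntegral.continuousOn_primitive_interval (f := fun s => Real.exp s * r s)
        (a := 0) (b := 1) (μ := volume) ?_
      · rw [uIcc_of_le zero_le_one] at this
        exact this.mono fun x hx => ⟨hx.1.le, (hx.2.trans hδ1).le⟩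
      · exact (intervalIntegrable_iff' (by simp)).1 (ir.continuousOn_mul (by fun_prop))

/-! ### Causal convolution: existence and uniqueness for the two Volterra equations. -/

/-- The causal convolution `∫_0^t k(t-s) φ(s) ds`. -/
noncomputable def causalConv (k φ : ℝ → ℝ) (t : ℝ) : ℝ := ∫ s in (0 : ℝ)..t, k (t - s) * φ s

theorem causalConv_comm (k φ : ℝ → ℝ) (t : ℝ) : causalConv k φ t = causalConv φ k t := by
  have := intervalIntegral.integral_comp_sub_left (a := 0) (b := t)
    (fun s => k s * φ (t - s)) t
  simp only [sub_sub_cancel, sub_self, sub_zero] at this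
  simp only [causalConv]
  rw [this]
  simp only [mul_comm]

theorem causalConv_congr {k k' φ φ' : ℝ → ℝ} {t : ℝ} (ht : 0 ≤ t)
    (h : ∀ s ∈ Icc 0 t, k s = k' s) (h' : ∀ s ∈ Icc 0 t, φ s = φ' s) :
    causalConv k φ t = causalConv k' φ' t := by
  refine intervalIntegral.integral_congr fun s hs => ?_
  rw [uIcc_of_le ht] at hs
  rw [h _ ⟨by linarith [hs.2], by linarith [hs.1]⟩, h' s hs]

/-- Fubini's theorem on a triangle. -/
theorem causalConv_causalConv {k φ ψ : ℝ → ℝ} {t : ℝ} (ht : 0 ≤ t)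
    (hk : ContinuousOn k (Icc 0 t)) (hφ : IntervalIntegrable φ volume 0 t)
    (hψ : IntervalIntegrable ψ volume 0 t) :
    causalConv (causalConv k ψ) φ t = causalConv (causalConv k φ) ψ t := by
  -- A bounded continuous extension of `k` lets the integrand live on the full square, dominated by
  -- a multiple of `|φ s * ψ v|`; the triangle enters as an indicator symmetric in the two
  -- variables.
  set k' : ℝ → ℝ := IccExtend ht ((Icc 0 t).domRestrict k) with hk'
  have ck' : Continuous k' := (continuousOn_iff_continuous_domRestrict.1 hk).Icc_extend'
  have ek' : ∀ s ∈ Icc 0 t, k' s = k s := fun s hs => by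
    rw [hk', IccExtend_of_mem _ _ hs]; rfl
  obtain ⟨C, hC⟩ := isCompact_Icc.exists_bound_of_continuousOn hk
  have hC' : ∀ s, ‖k' s‖ ≤ C := fun s => hC _ (projIcc 0 t ht s).2
  set μ := (volume : Measure ℝ).restrict (Ioc 0 t) with hμ
  have iφ : Integrable φ μ := (intervalIntegrable_iff_integrableOn_Ioc_of_le ht).1 hφ
  have iψ : Integrable ψ μ := (intervalIntegrable_iff_integrableOn_Ioc_of_le ht).1 hψ
  set S : Set (ℝ × ℝ) := {p | p.1 + p.2 ≤ t} with hS
  have mS : MeasurableSet S := measurableSet_le (by fun_prop) measurable_const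
  set F : ℝ → ℝ → ℝ := fun s v => S.indicator (fun p => k' (t - p.1 - p.2)) (s, v) * (φ s * ψ v)
    with hF
  have iF : Integrable (Function.uncurry F) (μ.prod μ) := by
    refine (iφ.mul_prod iψ).bdd_mul (c := C) ?_ ?_
    · exact ((Continuous.measurable (by fun_prop)).indicator mS).aestronglyMeasurable
    · refine Eventually.of_forall fun p => ?_
      rw [indicator_apply]
      split_ifs
      · exact hC' _
      · rw [norm_zero]; exact (norm_nonneg _).trans (hC' 0)
  have aux : ∀ α : ℝ → ℝ, ∀ s ∈ Ioc 0 t,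
      ∫ v in Ioc 0 t, S.indicator (fun p => k' (t - p.1 - p.2)) (s, v) * α v =
        causalConv k α (t - s) := by
    intro α s hs
    rw [causalConv, intervalIntegral.integral_of_le (by linarith [hs.2]),
      ← integral_indicator measurableSet_Ioc, ← integral_indicator measurableSet_Ioc]
    refine integral_congr_ae (Eventually.of_forall fun v => ?_)
    simp only [indicator_apply, hS, mem_ofPred_eq, mem_Ioc]
    by_cases h1 : 0 < v ∧ v ≤ t - s
    · rw [if_pos ⟨h1.1, by linarith [hs.1]⟩, if_pos (by linarith), if_pos h1,
        ek' _ ⟨by linarith [h1.2], by linarith [hs.1]⟩]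
    · rw [if_neg h1]
      split_ifs with h2 h3
      · exact absurd ⟨h2.1, by linarith⟩ h1
      · rw [zero_mul]
      · rfl
  have e1 : causalConv (causalConv k ψ) φ t = ∫ s, ∫ v, F s v ∂μ ∂μ := by
    rw [causalConv, intervalIntegral.integral_of_le ht]
    refine setIntegral_congr_fun measurableSet_Ioc fun s hs => ?_
    simp only [hF]
    rw [← aux ψ s hs, ← integral_mul_const]
    refine integral_congr_ae (Eventually.of_forall fun v => ?_)
    simp only
    ring
  have e2 : causalConv (causalConv k φ) ψ t = ∫ v, ∫ s, F s v ∂μ ∂μ := by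
    rw [causalConv, intervalIntegral.integral_of_le ht]
    refine setIntegral_congr_fun measurableSet_Ioc fun v hv => ?_
    simp only [hF]
    rw [← aux φ v hv, ← integral_mul_const]
    refine integral_congr_ae (Eventually.of_forall fun s => ?_)
    have : S.indicator (fun p => k' (t - p.1 - p.2)) (v, s) =
        S.indicator (fun p => k' (t - p.1 - p.2)) (s, v) := by
      simp only [indicator_apply, hS, mem_ofPred_eq, add_comm v s, sub_right_comm t v s]
    simp only [this]
    ring
  rw [e1, e2, integral_integral_swap iF]

/-- A nonnegative density `r` whose renewal measure `δ₀ + r` is the convolution inverse of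
`u ↦ w (e^{-u})` on `[0,1]`. -/
structure IsRenewalDensity (w r : ℝ → ℝ) : Prop where
  nonneg : ∀ t, 0 ≤ r t
  measurable : Measurable r
  continuousOn : ContinuousOn r (Ioi 0)
  intervalIntegrable : IntervalIntegrable r volume 0 1
  renewal : ∀ u ∈ Icc (0 : ℝ) 1,
    w (Real.exp (-u)) + causalConv (fun u => w (Real.exp (-u))) r u = 1
  lt_near_zero : ∃ δ ∈ Ioo (0 : ℝ) (Real.log 2), ∀ t ∈ Ioc 0 δ,
    Real.exp (-t) + causalConv (fun u => Real.exp (-u)) r t < r t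

theorem log_two_lt_one : Real.log 2 < 1 := by linarith [Real.log_two_lt_d9]

/-- The multiplier density `g = r - e - e * r` with `e(t) = e^{-t}`. -/
noncomputable def multiplier (r : ℝ → ℝ) (t : ℝ) : ℝ :=
  r t - Real.exp (-t) - causalConv (fun u => Real.exp (-u)) r t

namespace IsRenewalDensity

variable {w r : ℝ → ℝ}

theorem intervalIntegrable_of_le (hr : IsRenewalDensity w r) {t : ℝ} (ht : t ∈ Icc (0 : ℝ) 1) :
    IntervalIntegrable r volume 0 t :=
  hr.intervalIntegrable.mono_set
    (by rw [uIcc_of_le ht.1, uIcc_of_le zero_le_one]; exact Icc_subset_Icc le_rfl ht.2)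

/-- Writing `k u = w (e^{-u})`, convolve `k * φ = 0` with `r`. Since `k * r = 1 - k`, this leaves `1
* φ = k * φ = 0`: all primitives of `φ` vanish, and Lebesgue differentiation concludes. Uniqueness
in both integral equations reduces to this. -/
theorem ae_eq_zero_of_causalConv_eq_zero (hw : IsWeighting w) (hr : IsRenewalDensity w r)
    {b : ℝ} (hb : b ∈ Icc (0 : ℝ) 1) {φ : ℝ → ℝ} (hφ : IntervalIntegrable φ volume 0 b)
    (h : ∀ t ∈ Icc 0 b, causalConv (fun u => w (Real.exp (-u))) φ t = 0) :
    ∀ᵐ t, t ∈ Icc 0 b → φ t = 0 := by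
  set k : ℝ → ℝ := fun u => w (Real.exp (-u)) with hk
  have hprim : ∀ t ∈ Icc 0 b, ∫ s in (0 : ℝ)..t, φ s = 0 := by
    intro t ht
    have ht1 : t ≤ 1 := ht.2.trans hb.2
    have ck : ContinuousOn k (Icc 0 t) := hw.continuousOn_comp_exp.mono fun x hx => hx.1
    have iφ : IntervalIntegrable φ volume 0 t := hφ.mono_set
      (by rw [uIcc_of_le ht.1, uIcc_of_le hb.1]; exact Icc_subset_Icc le_rfl ht.2)
    have ck' : ContinuousOn (fun s => k (t - s)) (uIcc 0 t) := by
      rw [uIcc_of_le ht.1]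
      exact ck.comp (by fun_prop) fun s hs => ⟨by linarith [hs.2], by linarith [hs.1]⟩
    have e1 : causalConv (causalConv k φ) r t = 0 := by
      rw [causalConv_congr (k' := fun _ => 0) (φ' := r) ht.1
        (fun s hs => h s ⟨hs.1, hs.2.trans ht.2⟩) fun _ _ => rfl]
      simp [causalConv]
    rw [causalConv_causalConv ht.1 ck (hr.intervalIntegrable_of_le ⟨ht.1, ht1⟩) iφ,
      causalConv_congr (k' := fun s => 1 - k s) (φ' := φ) ht.1
        (fun s hs => by linarith [hr.renewal s ⟨hs.1, hs.2.trans ht1⟩]) fun _ _ => rfl] at e1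
    have e2 := h t ht
    simp only [causalConv, sub_mul, one_mul] at e1 e2
    rw [intervalIntegral.integral_sub iφ (iφ.continuousOn_mul ck'), e2, sub_zero] at e1
    exact e1
  have hne : ∀ c : ℝ, ∀ᵐ x : ℝ, x ≠ c := fun c => by simp [ae_iff, measure_singleton]
  filter_upwards [hφ.ae_hasDerivAt_integral, hne 0, hne b] with t ht h0 hb' htb
  have hI : t ∈ Ioo 0 b := ⟨lt_of_le_of_ne htb.1 (Ne.symm h0), lt_of_le_of_ne htb.2 hb'⟩
  have hd := ht (by rwa [uIcc_of_le hb.1]) 0 left_mem_uIcc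
  have hd' : HasDerivAt (fun x => ∫ s in (0 : ℝ)..x, φ s) 0 t := by
    refine (hasDerivAt_const t (0 : ℝ)).congr_of_eventuallyEq ?_
    filter_upwards [isOpen_Ioo.mem_nhds hI] with x hx
    exact hprim x (Ioo_subset_Icc_self hx)
  exact hd.unique hd'

theorem causalConv_exp (r : ℝ → ℝ) (t : ℝ) : causalConv (fun u => Real.exp (-u)) r t =
    Real.exp (-t) * ∫ s in (0 : ℝ)..t, Real.exp s * r s := by
  rw [causalConv, ← intervalIntegral.integral_const_mul]
  refine intervalIntegral.integral_congr fun s _ => ?_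
  rw [← mul_assoc, ← Real.exp_add]
  congr 2
  ring

theorem continuousOn_causalConv_exp (hr : IsRenewalDensity w r) :
    ContinuousOn (causalConv (fun u => Real.exp (-u)) r) (Icc 0 1) := by
  have : ContinuousOn (fun t => Real.exp (-t) * ∫ s in (0 : ℝ)..t, Real.exp s * r s)
      (Icc 0 1) := by
    refine ContinuousOn.mul (by fun_prop) ?_
    have := intervalIntegral.continuousOn_primitive_interval (f := fun s => Real.exp s * r s)
      (a := 0) (b := 1) (μ := volume)
      ((intervalIntegrable_iff' (by simp)).1 (hr.intervalIntegrable.continuousOn_mul (by fun_prop)))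
    rwa [uIcc_of_le zero_le_one] at this
  exact this.congr fun t _ => causalConv_exp r t

theorem continuousOn_multiplier (hr : IsRenewalDensity w r) :
    ContinuousOn (multiplier r) (Ioc 0 1) :=
  ((hr.continuousOn.mono fun _ hx => hx.1).sub (by fun_prop)).sub
    (hr.continuousOn_causalConv_exp.mono Ioc_subset_Icc_self)

theorem intervalIntegrable_multiplier (hr : IsRenewalDensity w r) {t : ℝ}
    (ht : t ∈ Icc (0 : ℝ) 1) : IntervalIntegrable (multiplier r) volume 0 t := by
  refine ((hr.intervalIntegrable_of_le ht).sub (Continuous.intervalIntegrable (by fun_prop) _ _)).sub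
    (ContinuousOn.intervalIntegrable ?_)
  rw [uIcc_of_le ht.1]
  exact hr.continuousOn_causalConv_exp.mono (Icc_subset_Icc le_rfl ht.2)

/-- Here `δ₀ + multiplier r` is the product of `δ₀ + r` and `δ₀ - e`. The first factor takes `k` to
the constant one, and the second takes one to `1 - ∫_0^t e^{-s} ds = e^{-t}`. Hence `k * (δ₀ +
multiplier r) = e`. -/
theorem causalConv_multiplier (hw : IsWeighting w) (hr : IsRenewalDensity w r) {t : ℝ}
    (ht : t ∈ Icc (0 : ℝ) 1) :
    causalConv (fun u => w (Real.exp (-u))) (multiplier r) t =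
      Real.exp (-t) - w (Real.exp (-t)) := by
  set k : ℝ → ℝ := fun u => w (Real.exp (-u)) with hk
  set e : ℝ → ℝ := fun u => Real.exp (-u) with he
  have ce : Continuous e := by fun_prop
  have ck : ContinuousOn k (Icc 0 t) := hw.continuousOn_comp_exp.mono fun x hx => hx.1
  have ck' : ContinuousOn (fun s => k (t - s)) (uIcc 0 t) := by
    rw [uIcc_of_le ht.1]
    exact ck.comp (by fun_prop) fun s hs => ⟨by linarith [hs.2], by linarith [hs.1]⟩
  have ir := hr.intervalIntegrable_of_le ht
  have ie : IntervalIntegrable e volume 0 t := ce.intervalIntegrable _ _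
  have ik : IntervalIntegrable k volume 0 t :=
    ContinuousOn.intervalIntegrable (by rwa [uIcc_of_le ht.1])
  have ier : IntervalIntegrable (causalConv e r) volume 0 t := by
    refine ContinuousOn.intervalIntegrable ?_
    rw [uIcc_of_le ht.1]
    exact hr.continuousOn_causalConv_exp.mono (Icc_subset_Icc le_rfl ht.2)
  have e1 : causalConv k (causalConv e r) t = (1 - Real.exp (-t)) - causalConv k e t := by
    rw [causalConv_comm, causalConv_causalConv ht.1 ce.continuousOn ik ir,
      causalConv_congr (k' := causalConv k e) (φ' := r) ht.1
        (fun s _ => causalConv_comm _ _ s) (fun _ _ => rfl),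
      causalConv_causalConv ht.1 ck ir ie,
      causalConv_congr (k' := fun s => 1 - k s) (φ' := e) ht.1
        (fun s hs => by linarith [hr.renewal s ⟨hs.1, hs.2.trans ht.2⟩]) fun _ _ => rfl]
    simp only [causalConv, sub_mul, one_mul]
    rw [intervalIntegral.integral_sub ie (ie.continuousOn_mul ck')]
    congr 1
    simp only [he]
    rw [intervalIntegral.integral_comp_neg, integral_exp]
    simp
  have e2 : causalConv k r t = 1 - k t := by linarith [hr.renewal t ht]
  have e3 : causalConv k (multiplier r) t =
      causalConv k r t - causalConv k e t - causalConv k (causalConv e r) t := by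
    simp only [causalConv, multiplier, mul_sub]
    rw [intervalIntegral.integral_sub, intervalIntegral.integral_sub]
    · exact ir.continuousOn_mul ck'
    · exact ie.continuousOn_mul ck'
    · exact (ir.continuousOn_mul ck').sub (ie.continuousOn_mul ck')
    · exact ier.continuousOn_mul ck'
  rw [e3, e1, e2]
  ring

theorem solvesMultiplierEq (hw : IsWeighting w) (hr : IsRenewalDensity w r) :
    SolvesMultiplierEq w (Real.log 2) (multiplier r) := by
  have h2 := (Real.log_pos one_lt_two).le
  have h1 := log_two_lt_one.le
  refine ⟨(intervalIntegrable_iff_integrableOn_Icc_of_le h2).1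
    (hr.intervalIntegrable_multiplier ⟨h2, h1⟩), fun t ht => ?_⟩
  have := hr.causalConv_multiplier hw (t := t) ⟨ht.1, ht.2.trans h1⟩
  simp only [causalConv, neg_sub, sub_eq_neg_add _ t] at this
  linarith

theorem ae_eq_multiplier (hw : IsWeighting w) (hr : IsRenewalDensity w r) {g : ℝ → ℝ}
    (hg : SolvesMultiplierEq w (Real.log 2) g) :
    g =ᵐ[volume.restrict (Icc 0 (Real.log 2))] multiplier r := by
  have h2 := (Real.log_pos one_lt_two).le
  have h1 := log_two_lt_one.le
  have hm := hr.solvesMultiplierEq hw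
  have i1 := (intervalIntegrable_iff_integrableOn_Icc_of_le h2).2 hg.1
  have i2 := (intervalIntegrable_iff_integrableOn_Icc_of_le h2).2 hm.1
  have := hr.ae_eq_zero_of_causalConv_eq_zero hw (b := Real.log 2) ⟨h2, h1⟩ (i1.sub i2) ?_
  · rw [EventuallyEq, ae_restrict_iff' measurableSet_Icc]
    filter_upwards [this] with t ht htI
    have := ht htI
    linarith
  · intro t ht
    have sub : uIcc 0 t ⊆ uIcc 0 (Real.log 2) := by
      rw [uIcc_of_le ht.1, uIcc_of_le h2]; exact Icc_subset_Icc le_rfl ht.2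
    have ck' : ContinuousOn (fun s => w (Real.exp (-t + s))) (uIcc 0 t) := by
      rw [uIcc_of_le ht.1]
      refine hw.continuousOn.comp (by fun_prop) fun s hs => ?_
      have := exp_neg_mem_Icc (t := t - s) (by linarith [hs.2])
      rwa [neg_sub, sub_eq_neg_add] at this
    have e1 := hg.2 t ht
    have e2 := hm.2 t ht
    simp only [causalConv, mul_sub, neg_sub, sub_eq_neg_add _ t]
    rw [intervalIntegral.integral_sub ((i1.mono_set sub).continuousOn_mul ck')
      ((i2.mono_set sub).continuousOn_mul ck')]
    linarith

/-- The first zero of the multiplier density. -/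
theorem exists_isLeast (hw : IsWeighting w)
    (hsymm : ∀ p ∈ Icc (0 : ℝ) 1, w p + w (1 - p) = 1) (hr : IsRenewalDensity w r) :
    ∃ t₀, IsLeast {t ∈ Ioc 0 (Real.log 2) | multiplier r t ≤ 0} t₀ := by
  have h2 := (Real.log_pos one_lt_two)
  have h1 := log_two_lt_one.le
  obtain ⟨δ, hδ, hlt⟩ := hr.lt_near_zero
  -- Positivity of the multiplier on `(0, δ]` keeps the set away from zero, which makes it compact.
  have hS : {t ∈ Ioc 0 (Real.log 2) | multiplier r t ≤ 0} =
      Icc δ (Real.log 2) ∩ multiplier r ⁻¹' Iic 0 := by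
    ext t
    simp only [mem_ofPred_eq, mem_inter_iff, mem_preimage, mem_Iic]
    refine ⟨fun h => ⟨⟨?_, h.1.2⟩, h.2⟩, fun h => ⟨⟨hδ.1.trans_le h.1.1, h.1.2⟩, h.2⟩⟩
    by_contra! h'
    have := hlt t ⟨h.1.1, h'.le⟩
    have h3 := h.2
    simp only [multiplier] at h3
    linarith
  have hc : IsCompact (Icc δ (Real.log 2) ∩ multiplier r ⁻¹' Iic 0) := by
    refine isCompact_Icc.of_isClosed_subset ?_ inter_subset_left
    exact (hr.continuousOn_multiplier.mono fun x hx =>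
      ⟨hδ.1.trans_le hx.1, hx.2.trans h1⟩).preimage_isClosed_of_isClosed isClosed_Icc isClosed_Iic
  rw [hS]
  refine hc.exists_isLeast ?_
  rw [← hS]
  by_contra! hemp
  have hpos : ∀ t ∈ Ioo 0 (Real.log 2), 0 < multiplier r t := by
    intro t ht
    by_contra! h
    exact (hemp.subset (show t ∈ {t ∈ Ioc 0 (Real.log 2) | multiplier r t ≤ 0} from
      ⟨⟨ht.1, ht.2.le⟩, h⟩)).elim
  -- At `log 2` the right side of the multiplier equation is `1/2 - w (1/2) = 0`, impossible for the
  -- integral of a product of two positive functions.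
  have e := hr.causalConv_multiplier hw (t := Real.log 2) ⟨h2.le, h1⟩
  rw [exp_neg_log_two, IsWeighting.half hsymm, sub_self] at e
  refine e.not_gt (intervalIntegral.intervalIntegral_pos_of_pos_on ?_ ?_ h2)
  · refine (hr.intervalIntegrable_multiplier ⟨h2.le, h1⟩).continuousOn_mul ?_
    rw [uIcc_of_le h2.le]
    exact hw.continuousOn_comp_exp.comp (t := Ici 0) (f := fun v => Real.log 2 - v)
      (by fun_prop) (fun v hv => by simpa using hv.2)
  · intro t ht
    have hx := exp_neg_mem_Ioo (t := Real.log 2 - t) (by linarith [ht.2])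
    exact mul_pos (hw.pos ⟨hx.1, hx.2.le⟩) (hpos t ht)

/-- The reversal `s ↦ t₀ - s` carries the renewal equation at `t₀ - t` into the binding equation at
`t`. -/
theorem solvesBindingEq (hr : IsRenewalDensity w r) {t₀ : ℝ}
    (ht₀ : t₀ ∈ Icc (0 : ℝ) 1) : SolvesBindingEq w t₀ (fun s => r (t₀ - s)) := by
  refine ⟨?_, fun t ht => ?_⟩
  · have := (hr.intervalIntegrable_of_le ht₀).comp_sub_left t₀
    rw [sub_zero, sub_self] at this
    exact (intervalIntegrable_iff_integrableOn_Icc_of_le ht₀.1).1 this.symm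
  · have e := hr.renewal (t₀ - t) ⟨by linarith [ht.2], by linarith [ht.1, ht₀.2]⟩
    have := intervalIntegral.integral_comp_sub_left (a := t) (b := t₀)
      (fun v => w (Real.exp (-(t₀ - t - v))) * r v) t₀
    rw [sub_self] at this
    rw [causalConv, ← this] at e
    rw [← e]
    congr 1
    · congr 2; ring
    · refine intervalIntegral.integral_congr fun s _ => ?_
      simp only
      congr 3
      ring

theorem ae_eq_of_solvesBindingEq (hw : IsWeighting w) (hr : IsRenewalDensity w r) {t₀ : ℝ}
    (ht₀ : t₀ ∈ Icc (0 : ℝ) 1) {f : ℝ → ℝ} (hf : SolvesBindingEq w t₀ f) :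
    f =ᵐ[volume.restrict (Icc 0 t₀)] fun s => r (t₀ - s) := by
  have i1 : IntervalIntegrable (fun v => f (t₀ - v)) volume 0 t₀ := by
    have := ((intervalIntegrable_iff_integrableOn_Icc_of_le ht₀.1).2 hf.1).comp_sub_left t₀
    rw [sub_zero, sub_self] at this
    exact this.symm
  have i2 := hr.intervalIntegrable_of_le ht₀
  have h := hr.ae_eq_zero_of_causalConv_eq_zero hw ht₀ (i1.sub i2) ?_
  · rw [EventuallyEq, ae_restrict_iff' measurableSet_Icc]
    have hq := (Measure.measurePreserving_sub_left volume t₀).quasiMeasurePreserving.ae h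
    filter_upwards [hq] with s hs hsI
    have := hs ⟨by linarith [hsI.2], by linarith [hsI.1]⟩
    simp only [sub_sub_cancel] at this
    linarith
  · intro t ht
    have sub : uIcc 0 t ⊆ uIcc 0 t₀ := by
      rw [uIcc_of_le ht.1, uIcc_of_le ht₀.1]; exact Icc_subset_Icc le_rfl ht.2
    have ck' : ContinuousOn (fun s => w (Real.exp (-(t - s)))) (uIcc 0 t) := by
      rw [uIcc_of_le ht.1]
      exact hw.continuousOn_comp_exp.comp (t := Ici 0) (f := fun v => t - v)
        (by fun_prop) (fun v hv => by simpa using hv.2)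
    have e1 := hf.2 (t₀ - t) ⟨by linarith [ht.2], by linarith [ht.1]⟩
    have e2 := hr.renewal t ⟨ht.1, ht.2.trans ht₀.2⟩
    have e3 := intervalIntegral.integral_comp_sub_left (a := 0) (b := t)
      (fun s => w (Real.exp (-s + (t₀ - t))) * f s) t₀
    rw [sub_zero] at e3
    have e4 : ∫ s in (0 : ℝ)..t, w (Real.exp (-(t - s))) * f (t₀ - s) =
        1 - w (Real.exp (-t)) := by
      rw [← e3] at e1
      have : ∀ x, -(t₀ - x) + (t₀ - t) = -(t - x) := fun x => by ring
      simp only [this] at e1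
      rw [show -t₀ + (t₀ - t) = -t by ring] at e1
      linarith
    simp only [causalConv, mul_sub] at e2 ⊢
    rw [intervalIntegral.integral_sub ((i1.mono_set sub).continuousOn_mul ck')
      ((i2.mono_set sub).continuousOn_mul ck')]
    linarith

end IsRenewalDensity

theorem IsWeighting.exists_isRenewalDensity {w : ℝ → ℝ} (hw : IsWeighting w)
    (hsymm : ∀ p ∈ Icc (0 : ℝ) 1, w p + w (1 - p) = 1) : ∃ r, IsRenewalDensity w r := by
  obtain ⟨r, h1, h2, h3, h4, h5, h6⟩ := hw.exists_renewalDensity hsymm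
  exact ⟨r, h1, h2, h3, h4, h5, h6⟩

/-! ### The horizon `t₀` and the strict positivity of the slack below `e^{-t₀}`. -/

/-- `t₀` is the first time at which the multiplier density is nonpositive. -/
def IsStoppingHorizon (r : ℝ → ℝ) (t₀ : ℝ) : Prop :=
  IsLeast {t ∈ Ioc 0 (Real.log 2) | multiplier r t ≤ 0} t₀

namespace IsStoppingHorizon

variable {w r : ℝ → ℝ} {t₀ : ℝ}

theorem pos (h : IsStoppingHorizon r t₀) : 0 < t₀ := h.1.1.1

theorem lt_one (h : IsStoppingHorizon r t₀) : t₀ < 1 := h.1.1.2.trans_lt log_two_lt_one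

theorem mem_Icc (h : IsStoppingHorizon r t₀) : t₀ ∈ Icc (0 : ℝ) 1 := ⟨h.pos.le, h.lt_one.le⟩

theorem multiplier_pos (h : IsStoppingHorizon r t₀) {t : ℝ} (ht : t ∈ Ioo 0 t₀) :
    0 < multiplier r t := by
  by_contra! hle
  exact ht.2.not_ge (h.2 ⟨⟨ht.1, ht.2.le.trans h.1.1.2⟩, hle⟩)

/-- The value at `t₀` is a left limit of positive values. Its vanishing makes the slack of first
order zero at `e^{-t₀}`, which decides `multiplierSlack_pos`. -/
theorem multiplier_eq_zero (hr : IsRenewalDensity w r) (h : IsStoppingHorizon r t₀) :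
    multiplier r t₀ = 0 := by
  refine le_antisymm h.1.2 ?_
  have hc : ContinuousWithinAt (multiplier r) (Ioo 0 t₀) t₀ :=
    (hr.continuousOn_multiplier t₀ ⟨h.pos, h.lt_one.le⟩).mono
      fun x hx => ⟨hx.1, (hx.2.trans h.lt_one).le⟩
  have : (𝓝[Ioo 0 t₀] t₀).NeBot := by
    rw [nhdsWithin_Ioo_eq_nhdsLT h.pos]; infer_instance
  exact ge_of_tendsto hc.tendsto
    (eventually_nhdsWithin_of_forall fun t ht => (h.multiplier_pos ht).le)

theorem multiplier_nonneg (hr : IsRenewalDensity w r) (h : IsStoppingHorizon r t₀) {t : ℝ}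
    (ht : t ∈ Ioc 0 t₀) : 0 ≤ multiplier r t := by
  rcases ht.2.eq_or_lt with rfl | hlt
  · exact (h.multiplier_eq_zero hr).ge
  · exact (h.multiplier_pos ⟨ht.1, hlt⟩).le

end IsStoppingHorizon

section slack

variable {w r : ℝ → ℝ} {t₀ : ℝ}

theorem IsWeighting.continuousOn_scaled (hw : IsWeighting w) {x a b : ℝ} (hx : 0 ≤ x)
    (hb : Real.exp b * x ≤ 1) : ContinuousOn (fun t => w (Real.exp t * x)) (Icc a b) := by
  refine hw.continuousOn.comp (by fun_prop) fun t ht => ⟨by positivity, ?_⟩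
  exact (mul_le_mul_of_nonneg_right (Real.exp_le_exp.2 ht.2) hx).trans hb

/-- The excess of the potential of the multiplier measure `δ₀ + g` over the identity. -/
noncomputable def multiplierSlack (w r : ℝ → ℝ) (t₀ x : ℝ) : ℝ :=
  w x + (∫ t in (0 : ℝ)..t₀, w (Real.exp t * x) * multiplier r t) - x

/-- The multiplier equation at `s` involves the integral over `[0, s]`, but the slack stops at `t₀`;
what is missing is the piece over `[t₀, s]`. -/
theorem multiplierSlack_exp (hw : IsWeighting w) (hr : IsRenewalDensity w r)
    (ht₀ : IsStoppingHorizon r t₀) {s : ℝ} (hs : s ∈ Icc t₀ 1) :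
    multiplierSlack w r t₀ (Real.exp (-s)) =
      - ∫ t in t₀..s, w (Real.exp t * Real.exp (-s)) * multiplier r t := by
  have hs0 : 0 ≤ s := ht₀.pos.le.trans hs.1
  have e := hr.causalConv_multiplier hw (t := s) ⟨hs0, hs.2⟩
  have h1 : ∀ t, -(s - t) = t + -s := fun t => by ring
  simp only [causalConv, h1, Real.exp_add] at e
  have i : IntervalIntegrable (fun t => w (Real.exp t * Real.exp (-s)) * multiplier r t)
      volume 0 s := by
    refine (hr.intervalIntegrable_multiplier ⟨hs0, hs.2⟩).continuousOn_mul ?_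
    rw [uIcc_of_le hs0]
    exact hw.continuousOn_scaled (Real.exp_pos _).le (by rw [← Real.exp_add]; simp)
  have i1 := i.mono_set (c := 0) (d := t₀)
    (by rw [uIcc_of_le hs0, uIcc_of_le ht₀.pos.le]; exact Icc_subset_Icc le_rfl hs.1)
  have i2 := i.mono_set (c := t₀) (d := s)
    (by rw [uIcc_of_le hs0, uIcc_of_le hs.1]; exact Icc_subset_Icc ht₀.pos.le le_rfl)
  rw [multiplierSlack]
  have := intervalIntegral.integral_add_adjacent_intervals i1 i2
  linarith

/-- The slack is `w` plus a nonnegative mixture of dilations `x ↦ w (e^t x)`, minus the identity,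
whose third divided difference is zero. So its divided difference at `0, c, y, e^{-t₀}` is positive.
As the slack vanishes at both end nodes, this is the stated comparison up to the factor `y - c`. -/
theorem multiplierSlack_div_lt (hw : IsWeighting w) (hr : IsRenewalDensity w r)
    (ht₀ : IsStoppingHorizon r t₀) {c y : ℝ} (hc : 0 < c) (hcy : c < y)
    (hy : y < Real.exp (-t₀)) :
    multiplierSlack w r t₀ y / (y * (Real.exp (-t₀) - y)) <
      multiplierSlack w r t₀ c / (c * (Real.exp (-t₀) - c)) := by
  set x₀ := Real.exp (-t₀) with hx₀
  have hD0 : multiplierSlack w r t₀ x₀ = 0 := by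
    rw [hx₀, multiplierSlack_exp hw hr ht₀ ⟨le_rfl, ht₀.lt_one.le⟩]; simp
  have hx01 : Real.exp t₀ * x₀ = 1 := by rw [hx₀, ← Real.exp_add]; simp
  have hx1 : x₀ ≤ 1 := (exp_neg_mem_Icc ht₀.pos.le).2
  have hy0 : 0 < y := hc.trans hcy
  set α := (c * ((y - c) * (x₀ - c)))⁻¹ with hα
  set β := (y * ((y - c) * (x₀ - y)))⁻¹ with hβ
  set γ := (x₀ * ((x₀ - c) * (x₀ - y)))⁻¹ with hγ
  have n1 : y - c ≠ 0 := by linarith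
  have n2 : x₀ - c ≠ 0 := by linarith
  have n3 : x₀ - y ≠ 0 := by linarith
  have n4 : x₀ ≠ 0 := by linarith
  have key : ∀ t ∈ Icc 0 t₀, 0 < w (Real.exp t * c) * α - w (Real.exp t * y) * β
      + w (Real.exp t * x₀) * γ := by
    intro t ht
    have he := Real.exp_pos t
    have h := hw.divided_difference_pos (b := Real.exp t * c) (c := Real.exp t * y)
      (d := Real.exp t * x₀) (by positivity) (by gcongr) (by gcongr)
      (by rw [← hx01]; gcongr; exact ht.2)
    have e : w (Real.exp t * c) * α - w (Real.exp t * y) * β + w (Real.exp t * x₀) * γ =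
      Real.exp t ^ 3 * (w (Real.exp t * c) / (Real.exp t * c *
        ((Real.exp t * y - Real.exp t * c) * (Real.exp t * x₀ - Real.exp t * c)))
      - w (Real.exp t * y) / (Real.exp t * y *
        ((Real.exp t * y - Real.exp t * c) * (Real.exp t * x₀ - Real.exp t * y)))
      + w (Real.exp t * x₀) / (Real.exp t * x₀ *
        ((Real.exp t * x₀ - Real.exp t * c) * (Real.exp t * x₀ - Real.exp t * y)))) := by
      simp only [← mul_sub, hα, hβ, hγ]
      field_simp
    rw [e]
    exact mul_pos (by positivity) h
  have ig := hr.intervalIntegrable_multiplier ht₀.mem_Icc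
  have ii : ∀ x, 0 ≤ x → x ≤ x₀ →
      IntervalIntegrable (fun t => w (Real.exp t * x) * multiplier r t) volume 0 t₀ := by
    intro x hx hxx
    refine ig.continuousOn_mul ?_
    rw [uIcc_of_le ht₀.pos.le]
    exact hw.continuousOn_scaled hx (by rw [← hx01]; gcongr)
  have ic := ii c hc.le (hcy.trans hy).le
  have iy := ii y hy0.le hy.le
  have ix := ii x₀ (by linarith) le_rfl
  have hint : 0 ≤ (∫ t in (0 : ℝ)..t₀, w (Real.exp t * c) * multiplier r t) * α
      - (∫ t in (0 : ℝ)..t₀, w (Real.exp t * y) * multiplier r t) * β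
      + (∫ t in (0 : ℝ)..t₀, w (Real.exp t * x₀) * multiplier r t) * γ := by
    simp only [← intervalIntegral.integral_mul_const]
    rw [← intervalIntegral.integral_sub (ic.mul_const _) (iy.mul_const _),
      ← intervalIntegral.integral_add ((ic.mul_const _).sub (iy.mul_const _)) (ix.mul_const _),
      intervalIntegral.integral_of_le ht₀.pos.le]
    refine setIntegral_nonneg measurableSet_Ioc fun t ht => ?_
    have h1 := key t ⟨ht.1.le, ht.2⟩
    have h2 := ht₀.multiplier_nonneg hr ht
    nlinarith [mul_nonneg h1.le h2]
  have k0 := key 0 ⟨le_rfl, ht₀.pos.le⟩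
  simp only [Real.exp_zero, one_mul] at k0
  have hlin : c * α - y * β + x₀ * γ = 0 := by
    simp only [hα, hβ, hγ]
    field_simp
    ring
  have hlin' : 0 < multiplierSlack w r t₀ c * α - multiplierSlack w r t₀ y * β
      + multiplierSlack w r t₀ x₀ * γ := by
    simp only [multiplierSlack]
    nlinarith
  rw [hD0, zero_mul, add_zero] at hlin'
  have f1 : multiplierSlack w r t₀ c * α =
      (multiplierSlack w r t₀ c / (c * (x₀ - c))) / (y - c) := by
    simp only [hα]; field_simp
  have f2 : multiplierSlack w r t₀ y * β =
      (multiplierSlack w r t₀ y / (y * (x₀ - y))) / (y - c) := by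
    simp only [hβ]; field_simp
  rw [f1, f2, ← sub_div] at hlin'
  have := (div_pos_iff_of_pos_right (show 0 < y - c by linarith)).1 hlin'
  linarith

/-- If the slack were nonpositive at `c`, the decreasing quotient would keep it below `-η x (x₀ -
x)` past the midpoint `c'`, a loss linear in the distance to `x₀`. By `multiplierSlack_exp` it is
near `x₀` minus an integral of the multiplier just after `t₀`, where the multiplier is continuous
and vanishes, so the loss is of smaller order. -/
theorem multiplierSlack_pos (hw : IsWeighting w) (hr : IsRenewalDensity w r)
    (ht₀ : IsStoppingHorizon r t₀) {c : ℝ} (hc : c ∈ Ioo 0 (Real.exp (-t₀))) :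
    0 < multiplierSlack w r t₀ c := by
  by_contra! hle
  set x₀ := Real.exp (-t₀) with hx₀
  obtain ⟨hc0, hcx⟩ := hc
  set c' := (c + x₀) / 2 with hc'
  have hcc' : c < c' := by linarith
  have hc'x : c' < x₀ := by linarith
  set η := -(multiplierSlack w r t₀ c' / (c' * (x₀ - c'))) with hη
  have hη0 : 0 < η := by
    have h1 := multiplierSlack_div_lt hw hr ht₀ hc0 hcc' hc'x
    have h2 := div_nonpos_of_nonpos_of_nonneg hle
      (mul_nonneg hc0.le (show 0 ≤ x₀ - c by linarith))
    linarith
  have hcont : ContinuousWithinAt (multiplier r) (Ioi t₀) t₀ := by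
    have := hr.continuousOn_multiplier t₀ ⟨ht₀.pos, ht₀.lt_one.le⟩
    have h' : ContinuousWithinAt (multiplier r) (Ioc t₀ 1) t₀ :=
      this.mono (Ioc_subset_Ioc ht₀.pos.le le_rfl)
    exact h'.mono_of_mem_nhdsWithin (Ioc_mem_nhdsGT ht₀.lt_one)
  -- The factor `e^{-2}` is a lower bound for `y * y` with `y = e^{-u}` and `u ≤ 1`; it makes `(u -
  -- t₀) e^{-2} ≤ y (x₀ - y)`.
  have hε : 0 < η * Real.exp (-2) := mul_pos hη0 (Real.exp_pos _)
  have hsmall : ∀ᶠ t in 𝓝[>] t₀, multiplier r t < η * Real.exp (-2) := by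
    have := hcont.tendsto
    rw [ht₀.multiplier_eq_zero hr] at this
    exact this.eventually_lt_const hε
  have hexp : ∀ᶠ t in 𝓝[>] t₀, c' < Real.exp (-t) := by
    have : ContinuousAt (fun t : ℝ => Real.exp (-t)) t₀ := by fun_prop
    exact (this.tendsto.mono_left nhdsWithin_le_nhds).eventually_const_lt hc'x
  obtain ⟨u, hu, hsub⟩ := mem_nhdsGT_iff_exists_Ioc_subset.1
    ((hsmall.and hexp).and (Ioc_mem_nhdsGT ht₀.lt_one))
  have hu0 : t₀ < u := hu
  have hu1 : u ≤ 1 := (hsub ⟨hu0, le_rfl⟩).2.2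
  set y := Real.exp (-u) with hy
  have hyc : c' < y := (hsub ⟨hu0, le_rfl⟩).1.2
  have hyx : y < x₀ := Real.exp_lt_exp.2 (by linarith)
  have hy0 : 0 < y := Real.exp_pos _
  have h1 := multiplierSlack_div_lt hw hr ht₀ (hc0.trans hcc') hyc hyx
  have h2 : multiplierSlack w r t₀ y < -η * (y * (x₀ - y)) := by
    rw [div_lt_iff₀ (mul_pos hy0 (by linarith))] at h1
    simpa [hη] using h1
  rw [hy, multiplierSlack_exp hw hr ht₀ ⟨hu0.le, hu1⟩, ← hy] at h2
  have h3 : ∫ t in t₀..u, w (Real.exp t * y) * multiplier r t ≤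
      ∫ _ in t₀..u, η * Real.exp (-2) := by
    have cw : ContinuousOn (fun t => w (Real.exp t * y)) (Icc t₀ u) :=
      hw.continuousOn_scaled hy0.le (by rw [hy, ← Real.exp_add]; simp)
    refine intervalIntegral.integral_mono_on_of_le_Ioo hu0.le ?_ (by simp) ?_
    · refine ContinuousOn.intervalIntegrable ?_
      rw [uIcc_of_le hu0.le]
      exact cw.mul (hr.continuousOn_multiplier.mono
        fun x hx => ⟨ht₀.pos.trans_le hx.1, hx.2.trans hu1⟩)
    · intro t ht
      have hm : Real.exp t * y ∈ Icc (0 : ℝ) 1 := by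
        refine ⟨by positivity, ?_⟩
        rw [hy, ← Real.exp_add, Real.exp_le_one_iff]
        linarith [ht.2]
      have h4 := (hsub ⟨ht.1, ht.2.le⟩).1.1
      have h4' : multiplier r t < η * Real.exp (-2) := h4
      nlinarith [hw.le_one hm, hw.nonneg hm]
  rw [intervalIntegral.integral_const, smul_eq_mul] at h3
  have h5 : (u - t₀) * y ≤ x₀ - y := by
    have : x₀ = Real.exp (u - t₀) * y := by rw [hy, hx₀, ← Real.exp_add]; congr 1; ring
    nlinarith [Real.add_one_le_exp (u - t₀)]
  have h6 : Real.exp (-2) ≤ y * y := by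
    rw [hy, ← Real.exp_add]; exact Real.exp_le_exp.2 (by linarith)
  have h7 : (u - t₀) * Real.exp (-2) ≤ y * (x₀ - y) := by nlinarith
  nlinarith

end slack

/-! ### Potentials of the multiplier measure and of shifted renewal measures. -/

/-- The weight `w (e^t h)` of a tail probability `h ≤ e^{-t}` conditional on an event of
probability `e^{-t}`. -/
noncomputable def condWeight (w : ℝ → ℝ) (t h : ℝ) : ℝ≥0∞ :=
  (Icc 0 (Real.exp (-t))).indicator (fun h => ENNReal.ofReal (w (Real.exp t * h))) h

section condWeight

variable {w r : ℝ → ℝ} {t₀ : ℝ}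

theorem condWeight_of_mem {t h : ℝ} (hh : h ∈ Icc 0 (Real.exp (-t))) :
    condWeight w t h = ENNReal.ofReal (w (Real.exp t * h)) := indicator_of_mem hh _

theorem condWeight_of_lt {t h : ℝ} (hh : Real.exp (-t) < h) : condWeight w t h = 0 :=
  indicator_of_notMem (fun h' => hh.not_ge h'.2) _

theorem IsWeighting.condWeight_zero_right (hw : IsWeighting w) (t : ℝ) :
    condWeight w t 0 = 0 := by
  rw [condWeight_of_mem ⟨le_rfl, (Real.exp_pos _).le⟩, mul_zero, hw.map_zero, ENNReal.ofReal_zero]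

theorem condWeight_zero_left {h : ℝ} (hh : h ∈ Icc (0 : ℝ) 1) :
    condWeight w 0 h = ENNReal.ofReal (w h) := by
  rw [condWeight_of_mem (by simpa using hh), Real.exp_zero, one_mul]

theorem IsWeighting.measurable_condWeight (hw : IsWeighting w) :
    Measurable fun p : ℝ × ℝ => condWeight w p.1 p.2 := by
  set W : ℝ → ℝ := IccExtend zero_le_one ((Icc (0 : ℝ) 1).domRestrict w) with hW
  have cW : Continuous W := (continuousOn_iff_continuous_domRestrict.1 hw.continuousOn).Icc_extend'
  have mS : MeasurableSet {p : ℝ × ℝ | p.2 ∈ Icc 0 (Real.exp (-p.1))} :=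
    (measurableSet_le measurable_const measurable_snd).inter
      (measurableSet_le measurable_snd (by fun_prop))
  have : (fun p : ℝ × ℝ => condWeight w p.1 p.2) =
      {p : ℝ × ℝ | p.2 ∈ Icc 0 (Real.exp (-p.1))}.indicator
        fun p => ENNReal.ofReal (W (Real.exp p.1 * p.2)) := by
    ext p
    by_cases hp : p.2 ∈ Icc 0 (Real.exp (-p.1))
    · rw [condWeight_of_mem hp, indicator_of_mem (by exact hp), hW, IccExtend_of_mem]
      · rfl
      · refine ⟨mul_nonneg (Real.exp_pos _).le hp.1, ?_⟩
        have := mul_le_mul_of_nonneg_left hp.2 (Real.exp_pos p.1).le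
        rwa [← Real.exp_add, add_neg_cancel, Real.exp_zero] at this
    · rw [indicator_of_notMem (by exact hp), condWeight, indicator_of_notMem hp]
  rw [this]
  have cW' : Continuous fun p : ℝ × ℝ => W (Real.exp p.1 * p.2) := by fun_prop
  exact cW'.measurable.ennreal_ofReal.indicator mS

theorem lintegral_condWeight_exp (hw : IsWeighting w) {a b s : ℝ} (hab : a ≤ b) (hbs : b ≤ s)
    {G : ℝ → ℝ} (hG : IntervalIntegrable G volume a b) (hG0 : ∀ t ∈ Ioc a b, 0 ≤ G t) :
    ∫⁻ t in Ioc a b, condWeight w t (Real.exp (-s)) * ENNReal.ofReal (G t) =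
      ENNReal.ofReal (∫ t in a..b, w (Real.exp t * Real.exp (-s)) * G t) := by
  have hm : ∀ t ≤ b, Real.exp t * Real.exp (-s) ∈ Icc (0 : ℝ) 1 := fun t ht =>
    ⟨by positivity, by rw [← Real.exp_add, Real.exp_le_one_iff]; linarith⟩
  have ii : IntervalIntegrable (fun t => w (Real.exp t * Real.exp (-s)) * G t) volume a b := by
    refine hG.continuousOn_mul ?_
    rw [uIcc_of_le hab]
    exact hw.continuousOn_scaled (Real.exp_pos _).le (hm b le_rfl).2
  rw [intervalIntegral.integral_of_le hab, ofReal_integral_eq_lintegral_ofReal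
    ((intervalIntegrable_iff_integrableOn_Ioc_of_le hab).1 ii)
    ((ae_restrict_iff' measurableSet_Ioc).2 (Eventually.of_forall fun t ht =>
      mul_nonneg (hw.nonneg (hm t ht.2)) (hG0 t ht)))]
  refine setLIntegral_congr_fun measurableSet_Ioc fun t ht => ?_
  rw [ENNReal.ofReal_mul (hw.nonneg (hm t ht.2)), condWeight_of_mem]
  exact ⟨(Real.exp_pos _).le, Real.exp_le_exp.2 (by linarith [ht.2])⟩

theorem lintegral_condWeight_exp_of_le {a b s : ℝ} (hsb : s ≤ b) (G : ℝ → ℝ≥0∞) :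
    ∫⁻ t in Ioc a b, condWeight w t (Real.exp (-s)) * G t =
      ∫⁻ t in Ioc a s, condWeight w t (Real.exp (-s)) * G t := by
  rw [← lintegral_indicator measurableSet_Ioc, ← lintegral_indicator measurableSet_Ioc]
  refine lintegral_congr fun t => ?_
  by_cases h1 : t ∈ Ioc a s
  · rw [indicator_of_mem h1, indicator_of_mem (show t ∈ Ioc a b from ⟨h1.1, h1.2.trans hsb⟩)]
  · rw [indicator_of_notMem h1, indicator_apply]
    split_ifs with h2
    · have : s < t := by by_contra! h; exact h1 ⟨h2.1, h⟩
      rw [condWeight_of_lt (Real.exp_lt_exp.2 (by linarith)), zero_mul]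
    · rfl

theorem exists_exp_neg_eq {h : ℝ} (h0 : 0 < h) : ∃ s, h = Real.exp (-s) :=
  ⟨-Real.log h, by rw [neg_neg, Real.exp_log h0]⟩

/-- The multiplier measure reproduces tail probabilities that are at least `e^{-t₀}`. -/
theorem multiplier_potential_eq (hw : IsWeighting w) (hr : IsRenewalDensity w r)
    (ht₀ : IsStoppingHorizon r t₀) {h : ℝ} (hh : h ∈ Icc (Real.exp (-t₀)) 1) :
    condWeight w 0 h + ∫⁻ t in Ioc 0 t₀, condWeight w t h * ENNReal.ofReal (multiplier r t) =
      ENNReal.ofReal h := by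
  have h0 : 0 < h := (Real.exp_pos _).trans_le hh.1
  rw [condWeight_zero_left ⟨h0.le, hh.2⟩]
  obtain ⟨s, rfl⟩ := exists_exp_neg_eq h0
  have hs0 : 0 ≤ s := by have := hh.2; rw [Real.exp_le_one_iff] at this; linarith
  have hst : s ≤ t₀ := by have := Real.exp_le_exp.1 hh.1; linarith
  have hs1 : s ∈ Icc (0 : ℝ) 1 := ⟨hs0, hst.trans ht₀.lt_one.le⟩
  have e := hr.causalConv_multiplier hw hs1
  have h1 : ∀ t, -(s - t) = t + -s := fun t => by ring
  simp only [causalConv, h1, Real.exp_add] at e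
  have hk := hw.nonneg (exp_neg_mem_Icc hs0)
  rw [lintegral_condWeight_exp_of_le hst, lintegral_condWeight_exp hw hs0 le_rfl
    (hr.intervalIntegrable_multiplier hs1)
    (fun t ht => ht₀.multiplier_nonneg hr ⟨ht.1, ht.2.trans hst⟩), ← ENNReal.ofReal_add hk, e]
  · congr 1; ring
  · refine intervalIntegral.integral_nonneg_of_ae_restrict hs0 ?_
    rw [← restrict_Ioc_eq_restrict_Icc, EventuallyLE, ae_restrict_iff' measurableSet_Ioc]
    refine Eventually.of_forall fun t ht => mul_nonneg (hw.nonneg ⟨by positivity, ?_⟩)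
      (ht₀.multiplier_nonneg hr ⟨ht.1, ht.2.trans hst⟩)
    rw [← Real.exp_add, Real.exp_le_one_iff]; linarith [ht.2]

/-- The gap is exactly `multiplierSlack`. Its strictness is what later excludes optimal tails with
values in `(0, e^{-t₀})`. -/
theorem lt_multiplier_potential (hw : IsWeighting w) (hr : IsRenewalDensity w r)
    (ht₀ : IsStoppingHorizon r t₀) {h : ℝ} (hh : h ∈ Ioo 0 (Real.exp (-t₀))) :
    ENNReal.ofReal h <
      condWeight w 0 h + ∫⁻ t in Ioc 0 t₀, condWeight w t h * ENNReal.ofReal (multiplier r t) := by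
  have hD := multiplierSlack_pos hw hr ht₀ hh
  have h1 : h ≤ 1 := hh.2.le.trans (exp_neg_mem_Icc ht₀.pos.le).2
  rw [condWeight_zero_left ⟨hh.1.le, h1⟩]
  obtain ⟨s, rfl⟩ := exists_exp_neg_eq hh.1
  have hst : t₀ ≤ s := by have := Real.exp_le_exp.1 hh.2.le; linarith
  have hs0 : 0 ≤ s := ht₀.pos.le.trans hst
  rw [lintegral_condWeight_exp hw ht₀.pos.le hst (hr.intervalIntegrable_multiplier ht₀.mem_Icc)
    (fun t ht => ht₀.multiplier_nonneg hr ht), ← ENNReal.ofReal_add (hw.nonneg ⟨hh.1.le, h1⟩)]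
  · rw [multiplierSlack] at hD
    have := Real.exp_pos (-s)
    exact (ENNReal.ofReal_lt_ofReal_iff (by linarith)).2 (by linarith)
  · rw [intervalIntegral.integral_of_le ht₀.pos.le]
    refine setIntegral_nonneg measurableSet_Ioc fun t ht => mul_nonneg
      (hw.nonneg ⟨by positivity, ?_⟩) (ht₀.multiplier_nonneg hr ht)
    rw [← Real.exp_add, Real.exp_le_one_iff]; linarith [ht.2]

theorem multiplier_potential_zero (hw : IsWeighting w) :
    condWeight w 0 0 + ∫⁻ t in Ioc 0 t₀, condWeight w t 0 * ENNReal.ofReal (multiplier r t) =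
      0 := by
  simp [hw.condWeight_zero_right]

/-- The renewal measure shifted to `a` has constant potential on tail probabilities between
`e^{-t₀}` and `e^{-a}`. -/
theorem renewal_potential_eq (hw : IsWeighting w) (hr : IsRenewalDensity w r)
    (ht₀ : IsStoppingHorizon r t₀) {a h : ℝ} (ha : 0 ≤ a)
    (hh : h ∈ Icc (Real.exp (-t₀)) (Real.exp (-a))) :
    condWeight w a h + ∫⁻ t in Ioc a t₀, condWeight w t h * ENNReal.ofReal (r (t - a)) = 1 := by
  have h0 : 0 < h := (Real.exp_pos _).trans_le hh.1
  rw [condWeight_of_mem ⟨h0.le, hh.2⟩]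
  obtain ⟨s, rfl⟩ := exists_exp_neg_eq h0
  have has : a ≤ s := by have := Real.exp_le_exp.1 hh.2; linarith
  have hst : s ≤ t₀ := by have := Real.exp_le_exp.1 hh.1; linarith
  have hsa : s - a ∈ Icc (0 : ℝ) 1 := ⟨by linarith, by linarith [ht₀.lt_one]⟩
  have e := hr.renewal (s - a) hsa
  have ir : IntervalIntegrable (fun t => r (t - a)) volume a s := by
    simpa using (hr.intervalIntegrable_of_le hsa).comp_sub_right a
  have e2 : ∫ t in a..s, w (Real.exp t * Real.exp (-s)) * r (t - a) =
      causalConv (fun u => w (Real.exp (-u))) r (s - a) := by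
    have := intervalIntegral.integral_comp_sub_right (a := a) (b := s)
      (fun v => w (Real.exp (-(s - a - v))) * r v) a
    rw [sub_self] at this
    rw [causalConv, ← this]
    refine intervalIntegral.integral_congr fun t _ => ?_
    rw [← Real.exp_add]
    congr 3
    ring
  have e1 : Real.exp a * Real.exp (-s) = Real.exp (-(s - a)) := by
    rw [← Real.exp_add]; congr 1; ring
  have hk := hw.nonneg (exp_neg_mem_Icc hsa.1)
  have hk1 := hw.le_one (exp_neg_mem_Icc hsa.1)
  rw [lintegral_condWeight_exp_of_le hst, lintegral_condWeight_exp hw has le_rfl ir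
    (fun t _ => hr.nonneg _), e2, e1, ← ENNReal.ofReal_add hk (by linarith), e,
    ENNReal.ofReal_one]

end condWeight

/-! ### Joint payoffs as distorted means, and the equality case of their monotonicity. -/

section payoff

universe u

variable {Ω : Type u} [MeasurableSpace Ω] {w : ℝ → ℝ} {P : Measure Ω}

/-- The distorted expectation `∫_0^∞ w(P(Z > y)) dy` of a nonnegative random variable. -/
noncomputable def distortedMean (w : ℝ → ℝ) (P : Measure Ω) (Z : Ω → EReal) : ℝ≥0∞ :=
  ∫⁻ y in Ioi (0 : ℝ), ENNReal.ofReal (w (P.real {ω | (y : EReal) < Z ω}))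

theorem measureReal_mem_Icc (P : Measure Ω) [IsProbabilityMeasure P] (s : Set Ω) :
    P.real s ∈ Icc (0 : ℝ) 1 := ⟨measureReal_nonneg, measureReal_le_one⟩

theorem IsWeighting.monotone_comp_measureReal (hw : IsWeighting w) [IsProbabilityMeasure P]
    {s t : Set Ω} (h : P.real s ≤ P.real t) : w (P.real s) ≤ w (P.real t) :=
  hw.strictMonoOn.monotoneOn (measureReal_mem_Icc P s) (measureReal_mem_Icc P t) h

theorem IsWeighting.antitone_distorted (hw : IsWeighting w) [IsProbabilityMeasure P]
    (Z : Ω → EReal) :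
    Antitone fun y : ℝ => ENNReal.ofReal (w (P.real {ω | (y : EReal) < Z ω})) := by
  intro x y hxy
  refine ENNReal.ofReal_le_ofReal (hw.monotone_comp_measureReal ?_)
  exact measureReal_mono fun ω hω => lt_of_le_of_lt (EReal.coe_le_coe_iff.2 hxy) hω

theorem distortedMean_mono (hw : IsWeighting w) [IsProbabilityMeasure P] {Z Z' : Ω → EReal}
    (h : ∀ᵐ ω ∂P, Z ω ≤ Z' ω) : distortedMean w P Z ≤ distortedMean w P Z' := by
  refine lintegral_mono fun y => ENNReal.ofReal_le_ofReal (hw.monotone_comp_measureReal ?_)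
  refine ENNReal.toReal_mono (measure_ne_top _ _) (measure_mono_ae ?_)
  filter_upwards [h] with ω hω hy
  exact lt_of_lt_of_le hy hω

theorem jointCPT_congr {wp wm : ℝ → ℝ} {lam : ℝ} {Y Y' : Ω → EReal} (h : Y =ᵐ[P] Y') :
    jointCPT wp wm lam P Y = jointCPT wp wm lam P Y' := by
  have h1 : ∀ y : ℝ, P.real {ω | (y : EReal) < Y ω} = P.real {ω | (y : EReal) < Y' ω} :=
    fun y => measureReal_congr (by
      filter_upwards [h] with ω hω
      exact congrArg ((y : EReal) < ·) hω)
  have h2 : ∀ y : ℝ, P.real {ω | (lam : EReal) * Y ω < y} = P.real {ω | (lam : EReal) * Y' ω < y} :=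
    fun y => measureReal_congr (by
      filter_upwards [h] with ω hω
      exact congrArg (fun z => (lam : EReal) * z < y) hω)
  simp only [jointCPT, h1, h2]

theorem EReal_coe_lt_coe_sub_iff {x y : ℝ} {z : EReal} :
    (y : EReal) < (x : EReal) - z ↔ z < ((x - y : ℝ) : EReal) := by
  induction z with
  | bot => simpa using EReal.bot_lt_coe (x - y)
  | top => simp
  | coe z =>
    rw [← EReal.coe_sub, EReal.coe_lt_coe_iff, EReal.coe_lt_coe_iff]
    constructor <;> intro h <;> linarith

theorem EReal_coe_sub_lt_coe_iff {x y : ℝ} {z : EReal} :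
    (x : EReal) - z < (y : EReal) ↔ ((x - y : ℝ) : EReal) < z := by
  induction z with
  | bot => simp
  | top => simpa using EReal.coe_lt_top (x - y)
  | coe z =>
    rw [← EReal.coe_sub, EReal.coe_lt_coe_iff, EReal.coe_lt_coe_iff]
    constructor <;> intro h <;> linarith

theorem setLIntegral_comp_sub_left (F : ℝ → ℝ≥0∞) (c : ℝ) {s : Set ℝ} (hs : MeasurableSet s) :
    ∫⁻ y in (fun y => c - y) ⁻¹' s, F (c - y) = ∫⁻ y in s, F y := by
  have hs' : MeasurableSet ((fun y => c - y) ⁻¹' s) := (by fun_prop : Measurable _) hs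
  rw [← lintegral_indicator hs, ← lintegral_indicator hs', ← lintegral_sub_left_eq_self (s.indicator F) c]
  rfl

/-- Under a symmetric weighting the joint payoff of `θ - Z` is `θ` minus the distorted mean. -/
theorem jointCPT_const_sub (hw : IsWeighting w)
    (hsymm : ∀ p ∈ Icc (0 : ℝ) 1, w p + w (1 - p) = 1) [IsProbabilityMeasure P] {θ : ℝ}
    (hθ : 0 < θ) {Z : Ω → EReal} (mZ : Measurable Z) (hZ : ∀ᵐ ω ∂P, 0 ≤ Z ω) :
    jointCPT w w 1 P (fun ω => (θ : EReal) - Z ω) =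
      (θ : EReal) - (distortedMean w P Z : EReal) := by
  set F : ℝ → ℝ≥0∞ := fun y => ENNReal.ofReal (w (P.real {ω | (y : EReal) < Z ω})) with hF
  have mF : Measurable F := (hw.antitone_distorted Z).measurable
  have e1 : ∫⁻ y in Ioi (0 : ℝ), ENNReal.ofReal (w (P.real {ω | (y : EReal) < (θ : EReal) - Z ω}))
      = ∫⁻ y in Ioc 0 θ, ENNReal.ofReal (1 - w (P.real {ω | (y : EReal) < Z ω})) := by
    have h1 := setLIntegral_comp_sub_left
      (fun u => ENNReal.ofReal (w (P.real {ω | Z ω < (u : EReal)}))) θ (measurableSet_Iio (a := θ))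
    have h2 : (fun y => θ - y) ⁻¹' Iio θ = Ioi 0 := by ext y; simp
    rw [h2] at h1
    simp only [EReal_coe_lt_coe_sub_iff]
    rw [h1, ← lintegral_indicator measurableSet_Iio, ← lintegral_indicator measurableSet_Ioc]
    -- Outside the countably many atoms of `Z` one has `P(Z < u) = 1 - P(Z > u)`, and the symmetry
    -- of `w` turns the gain weights on `(0, θ]` into one minus the loss weights.
    have hcount : {u : ℝ | 0 < P {ω | Z ω = (u : EReal)}}.Countable :=
      (Measure.countable_meas_level_set_pos (μ := P) mZ).preimage
        (f := fun u : ℝ => (u : EReal)) EReal.coe_injective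
    have hne : ∀ᵐ u : ℝ, u ≠ θ := by simp [ae_iff, measure_singleton]
    refine lintegral_congr_ae ?_
    filter_upwards [hcount.ae_notMem volume, hne] with u hu huθ
    by_cases hI : u ∈ Ioc 0 θ
    · rw [indicator_of_mem hI, indicator_of_mem (show u ∈ Iio θ from lt_of_le_of_ne hI.2 huθ)]
      have hz : P {ω | Z ω = (u : EReal)} = 0 := by simpa using hu
      have hc : P.real {ω | Z ω < (u : EReal)} = 1 - P.real {ω | (u : EReal) < Z ω} := by
        have m1 : MeasurableSet {ω | (u : EReal) < Z ω} := measurableSet_lt measurable_const mZ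
        rw [← probReal_compl_eq_one_sub m1]
        refine measureReal_congr ?_
        filter_upwards [measure_eq_zero_iff_ae_notMem.1 hz] with ω hω
        have hω' : Z ω ≠ u := hω
        simp only [eq_iff_iff]
        exact ⟨fun h => not_lt.2 (le_of_lt h), fun h => lt_of_le_of_ne (not_lt.1 h) hω'⟩
      rw [hc]
      congr 1
      linarith [hsymm _ (measureReal_mem_Icc P {ω | (u : EReal) < Z ω})]
    · rw [indicator_of_notMem hI, indicator_apply]
      split_ifs with h3
      · have hu0 : u ≤ 0 := by
          by_contra! h
          exact hI ⟨h, le_of_lt h3⟩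
        have : P.real {ω | Z ω < (u : EReal)} = 0 := by
          rw [measureReal_eq_zero_iff, measure_eq_zero_iff_ae_notMem]
          filter_upwards [hZ] with ω hω h
          exact (lt_of_le_of_lt hω h).not_ge (by exact_mod_cast hu0)
        rw [this, hw.map_zero, ENNReal.ofReal_zero]
      · rfl
  have e2 : ∫⁻ y in Iio (0 : ℝ), ENNReal.ofReal
      (w (P.real {ω | ((1 : ℝ) : EReal) * ((θ : EReal) - Z ω) < (y : EReal)})) =
      ∫⁻ y in Ioi θ, F y := by
    have h1 := setLIntegral_comp_sub_left F θ (measurableSet_Ioi (a := θ))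
    have h2 : (fun y => θ - y) ⁻¹' Ioi θ = Iio 0 := by ext y; simp
    rw [h2] at h1
    simp only [EReal.coe_one, one_mul, EReal_coe_sub_lt_coe_iff]
    exact h1
  have e3 : distortedMean w P Z = (∫⁻ y in Ioc 0 θ, F y) + ∫⁻ y in Ioi θ, F y := by
    rw [distortedMean, ← lintegral_union measurableSet_Ioi (Ioc_disjoint_Ioi le_rfl),
      Ioc_union_Ioi_eq_Ioi hθ.le]
  have e4 : (∫⁻ y in Ioc 0 θ, ENNReal.ofReal (1 - w (P.real {ω | (y : EReal) < Z ω}))) +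
      ∫⁻ y in Ioc 0 θ, F y = ENNReal.ofReal θ := by
    rw [← lintegral_add_right _ mF]
    have : ∀ y : ℝ, ENNReal.ofReal (1 - w (P.real {ω | (y : EReal) < Z ω})) + F y = 1 := by
      intro y
      have hm := measureReal_mem_Icc P {ω | (y : EReal) < Z ω}
      rw [hF, ← ENNReal.ofReal_add (by linarith [hw.le_one hm]) (hw.nonneg hm)]
      simp
    simp [this]
  rw [jointCPT, e1, e2, e3]
  generalize (∫⁻ y in Ioc 0 θ, ENNReal.ofReal (1 - w (P.real {ω | (y : EReal) < Z ω}))) = A at *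
  generalize (∫⁻ y in Ioc 0 θ, F y) = B at *
  generalize (∫⁻ y in Ioi θ, F y) = D at *
  have hfin : A + B ≠ ∞ := by rw [e4]; exact ENNReal.ofReal_ne_top
  obtain ⟨hA, hB⟩ := ENNReal.add_ne_top.1 hfin
  lift A to ℝ≥0 using hA
  lift B to ℝ≥0 using hB
  have hθ' : θ = A + B := by
    have := congrArg ENNReal.toReal e4
    rw [ENNReal.toReal_ofReal hθ.le] at this
    rw [← this, ← ENNReal.coe_add, ENNReal.coe_toReal, NNReal.coe_add]
  induction D with
  | top => simp
  | coe D =>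
    rw [hθ', ← ENNReal.coe_add]
    simp only [EReal.coe_nnreal_eq_coe_real, NNReal.coe_add]
    rw [← EReal.coe_sub, ← EReal.coe_sub]
    congr 1
    ring

theorem EReal_coe_sub_coe_ennreal_nonneg_iff {θ : ℝ} {I : ℝ≥0∞} (hθ : 0 < θ) :
    0 ≤ (θ : EReal) - (I : EReal) ↔ I ≤ ENNReal.ofReal θ := by
  induction I with
  | top => simp
  | coe I =>
    rw [ENNReal.le_ofReal_iff_toReal_le ENNReal.coe_ne_top hθ.le, ENNReal.coe_toReal,
      EReal.coe_nnreal_eq_coe_real]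
    rw [← EReal.coe_sub, EReal.coe_nonneg, sub_nonneg]

/-- The joint payoff of delivery outside `N` at price `Z` is nonnegative iff the distorted mean of
the price plus the lost value of the good is at most that value. -/
theorem jointCPT_nonneg_iff (hw : IsWeighting w)
    (hsymm : ∀ p ∈ Icc (0 : ℝ) 1, w p + w (1 - p) = 1) [IsProbabilityMeasure P] {θ : ℝ}
    (hθ : 0 < θ) {Z Y : Ω → EReal} (mZ : Measurable Z) (hZ : ∀ᵐ ω ∂P, 0 ≤ Z ω) {N : Set Ω}
    (hN : MeasurableSet N) (hY : ∀ ω, Y ω = ((Nᶜ.indicator (fun _ => θ) ω : ℝ) : EReal) - Z ω) :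
    0 ≤ jointCPT w w 1 P Y ↔
      distortedMean w P (fun ω => Z ω + (N.indicator (fun _ => θ) ω : ℝ)) ≤ ENNReal.ofReal θ := by
  have mI : Measurable fun ω => ((N.indicator (fun _ => θ) ω : ℝ) : EReal) :=
    (measurable_const.indicator hN).coe_real_ereal
  -- On `N` nothing is delivered, which equals delivery with `θ` added to the price; an infinite
  -- price gives `⊥` on both sides.
  have e : Y =ᵐ[P] fun ω => (θ : EReal) - (Z ω + (N.indicator (fun _ => θ) ω : ℝ)) := by
    filter_upwards [hZ] with ω hω
    rw [hY]
    by_cases h : ω ∈ N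
    · rw [indicator_of_mem h, indicator_of_notMem (by simpa using h)]
      induction hz : Z ω with
      | bot => rw [hz] at hω; simp at hω
      | top => simp
      | coe z =>
        rw [← EReal.coe_add, ← EReal.coe_sub, ← EReal.coe_sub]
        congr 1
        ring
    · rw [indicator_of_notMem h, indicator_of_mem (by simpa using h)]
      simp
  rw [jointCPT_congr e, jointCPT_const_sub hw hsymm hθ (Z := fun ω => Z ω + (N.indicator (fun _ => θ) ω : ℝ))
      (mZ.add mI),
    EReal_coe_sub_coe_ennreal_nonneg_iff hθ]
  filter_upwards [hZ] with ω hω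
  refine add_nonneg hω ?_
  exact_mod_cast indicator_nonneg (fun _ _ => hθ.le) ω

/-- Strict monotonicity of `w` forces the nested tail events of `Z` and `Z'` to differ by null sets
for almost every level. If `Z < Z'` on a set of positive measure, two rationals would separate them
there, and a level between those rationals would contradict this. -/
theorem ae_eq_of_distortedMean_le (hw : IsWeighting w) [IsProbabilityMeasure P]
    {Z Z' : Ω → EReal} (mZ : Measurable Z) (hZ : ∀ᵐ ω ∂P, 0 ≤ Z ω)
    (hZZ' : ∀ ω, Z ω ≤ Z' ω) (hfin : distortedMean w P Z ≠ ∞)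
    (hle : distortedMean w P Z' ≤ distortedMean w P Z) : Z =ᵐ[P] Z' := by
  have hsub : ∀ y : ℝ, {ω | (y : EReal) < Z ω} ⊆ {ω | (y : EReal) < Z' ω} :=
    fun y ω hω => lt_of_lt_of_le hω (hZZ' ω)
  have h1 : ∀ᵐ y : ℝ, y ∈ Ioi (0 : ℝ) → P {ω | Z ω ≤ y ∧ (y : EReal) < Z' ω} = 0 := by
    have := ae_eq_of_ae_le_of_lintegral_le (μ := volume.restrict (Ioi (0 : ℝ)))
      (Eventually.of_forall fun y => ENNReal.ofReal_le_ofReal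
        (hw.monotone_comp_measureReal (P := P) (measureReal_mono (hsub y)))) hfin
      (hw.antitone_distorted Z').measurable.aemeasurable hle
    rw [EventuallyEq, ae_restrict_iff' measurableSet_Ioi] at this
    filter_upwards [this] with y hy hy0
    have e := hy hy0
    have m1 := measureReal_mem_Icc P {ω | (y : EReal) < Z ω}
    have m2 := measureReal_mem_Icc P {ω | (y : EReal) < Z' ω}
    rw [ENNReal.ofReal_eq_ofReal_iff (hw.nonneg m1) (hw.nonneg m2)] at e
    have e' := hw.strictMonoOn.injOn m1 m2 e
    have hd : {ω | Z ω ≤ y ∧ (y : EReal) < Z' ω} =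
        {ω | (y : EReal) < Z' ω} \ {ω | (y : EReal) < Z ω} := by
      ext ω; simp [and_comm]
    rw [hd, ← measureReal_eq_zero_iff, measureReal_sdiff (hsub y)
      (measurableSet_lt measurable_const mZ), e', sub_self]
  have h2 : ∀ q₁ q₂ : ℚ, (0 : ℝ) ≤ q₁ → q₁ < q₂ →
      ∀ᵐ ω ∂P, ¬ (Z ω ≤ ((q₁ : ℝ) : EReal) ∧ ((q₂ : ℝ) : EReal) ≤ Z' ω) := by
    intro q₁ q₂ hq hlt
    have hpos : volume (Ioo (q₁ : ℝ) q₂) ≠ 0 := by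
      rw [Real.volume_Ioo]; simpa using hlt
    obtain ⟨y, hy, hy'⟩ := ((frequently_ae_mem_iff.2 hpos).and_eventually h1).exists
    filter_upwards [measure_eq_zero_iff_ae_notMem.1 (hy' (hq.trans_lt hy.1))] with ω hω h
    refine hω ⟨h.1.trans (EReal.coe_le_coe_iff.2 hy.1.le), lt_of_lt_of_le ?_ h.2⟩
    exact EReal.coe_lt_coe_iff.2 hy.2
  have h3 : ∀ᵐ ω ∂P, ∀ q₁ q₂ : ℚ, (0 : ℝ) ≤ q₁ → q₁ < q₂ →
      ¬ (Z ω ≤ ((q₁ : ℝ) : EReal) ∧ ((q₂ : ℝ) : EReal) ≤ Z' ω) := by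
    simp only [ae_all_iff]
    exact h2
  filter_upwards [h3, hZ] with ω hω h0
  by_contra hne
  obtain ⟨q₁, ha, hb⟩ := EReal.exists_rat_btwn_of_lt (lt_of_le_of_ne (hZZ' ω) hne)
  obtain ⟨q₂, hc, hd⟩ := EReal.exists_rat_btwn_of_lt hb
  refine hω q₁ q₂ ?_ (by exact_mod_cast hc) ⟨ha.le, hd.le⟩
  have : (0 : EReal) ≤ ((q₁ : ℝ) : EReal) := h0.trans ha.le
  exact_mod_cast this

/-- Mass at infinity contributes the same positive weight at every level. -/
theorem ae_lt_top_of_distortedMean_ne_top (hw : IsWeighting w) [IsProbabilityMeasure P]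
    {Z : Ω → EReal} (hfin : distortedMean w P Z ≠ ∞) : P {ω | Z ω = ⊤} = 0 := by
  by_contra hne
  have hpos : 0 < P.real {ω | Z ω = ⊤} := by
    rw [measureReal_def]; exact ENNReal.toReal_pos hne (measure_ne_top _ _)
  have hw0 : 0 < w (P.real {ω | Z ω = ⊤}) := hw.pos ⟨hpos, measureReal_le_one⟩
  refine hfin (top_le_iff.1 ?_)
  calc (∞ : ℝ≥0∞) = ∫⁻ _ in Ioi (0 : ℝ), ENNReal.ofReal (w (P.real {ω | Z ω = ⊤})) := by
        simp [hw0]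
    _ ≤ _ := lintegral_mono fun y => ENNReal.ofReal_le_ofReal
        (hw.monotone_comp_measureReal (measureReal_mono fun ω hω => by
          rw [mem_ofPred_eq] at hω ⊢; rw [hω]; exact EReal.coe_lt_top y))

/-- If the distorted mean of the price exhausts the value of the good, a nonnegative payoff forces
almost sure delivery. -/
theorem measure_eq_zero_of_distortedMean (hw : IsWeighting w) [IsProbabilityMeasure P] {θ : ℝ}
    (hθ : 0 < θ) {Z : Ω → EReal} (mZ : Measurable Z) (hZ : ∀ᵐ ω ∂P, 0 ≤ Z ω) {N : Set Ω}
    (hN : MeasurableSet N) (h1 : ENNReal.ofReal θ ≤ distortedMean w P Z)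
    (h2 : distortedMean w P (fun ω => Z ω + (N.indicator (fun _ => θ) ω : ℝ)) ≤
      ENNReal.ofReal θ) : P N = 0 := by
  have mI : Measurable fun ω => ((N.indicator (fun _ => θ) ω : ℝ) : EReal) :=
    (measurable_const.indicator hN).coe_real_ereal
  have hle : ∀ ω, Z ω ≤ Z ω + (N.indicator (fun _ => θ) ω : ℝ) := fun ω => by
    refine le_add_of_nonneg_right ?_
    exact_mod_cast indicator_nonneg (fun _ _ => hθ.le) ω
  have hm := distortedMean_mono hw (P := P) (Eventually.of_forall hle)
  have hfin : distortedMean w P Z ≠ ∞ := ((hm.trans h2).trans_lt ENNReal.ofReal_lt_top).ne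
  -- Adding `θ` on `N` leaves the distorted mean unchanged, hence changes the almost surely finite
  -- `Z` only on a null set.
  have h3 := ae_eq_of_distortedMean_le hw mZ hZ hle hfin (h2.trans h1)
  have h4 := measure_eq_zero_iff_ae_notMem.1 (ae_lt_top_of_distortedMean_ne_top hw hfin)
  rw [measure_eq_zero_iff_ae_notMem]
  filter_upwards [h3, h4, hZ] with ω e ht h0 hω
  rw [indicator_of_mem hω] at e
  induction hz : Z ω with
  | bot => rw [hz] at h0; simp at h0
  | top => exact ht hz
  | coe z =>
    rw [hz] at e
    have : z = z + θ := by exact_mod_cast e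
    linarith

end payoff

/-! ### Duality for tail functions: the bound, its equality case and uniqueness. -/

/-- The distorted mean of the payments beyond the level at which the tail function `h` reaches
`e^{-t}`, conditional on that level. -/
noncomputable def condMean (w h : ℝ → ℝ) (t : ℝ) : ℝ≥0∞ :=
  ∫⁻ y in Ioi (0 : ℝ), condWeight w t (h y)

/-- The total mass of the multiplier measure `δ₀ + g`. -/
noncomputable def multiplierMass (r : ℝ → ℝ) (t₀ : ℝ) : ℝ≥0∞ :=
  1 + ∫⁻ t in Ioc 0 t₀, ENNReal.ofReal (multiplier r t)

/-- A tail function: antitone, with values in `[0,1]`. -/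
structure IsTail (h : ℝ → ℝ) : Prop where
  antitone : Antitone h
  mem : ∀ y, h y ∈ Icc (0 : ℝ) 1

section tail

variable {w r h : ℝ → ℝ} {t₀ θ : ℝ}

theorem IsTail.measurable (hh : IsTail h) : Measurable h := hh.antitone.measurable

theorem measurable_condWeight_comp (hw : IsWeighting w) (hh : IsTail h) (t : ℝ) :
    Measurable fun y => condWeight w t (h y) :=
  hw.measurable_condWeight.comp (measurable_const.prodMk hh.measurable)

theorem lintegral_lintegral_condWeight (hw : IsWeighting w) (hh : IsTail h) {a b : ℝ}
    {G : ℝ → ℝ≥0∞} (hG : AEMeasurable G (volume.restrict (Ioc a b))) :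
    ∫⁻ y in Ioi (0 : ℝ), ∫⁻ t in Ioc a b, condWeight w t (h y) * G t =
      ∫⁻ t in Ioc a b, condMean w h t * G t := by
  have m1 : Measurable fun p : ℝ × ℝ => condWeight w p.2 (h p.1) :=
    hw.measurable_condWeight.comp (measurable_snd.prodMk (hh.measurable.comp measurable_fst))
  rw [lintegral_lintegral_swap (m1.aemeasurable.mul hG.comp_snd)]
  refine lintegral_congr fun t => ?_
  rw [lintegral_mul_const _ (measurable_condWeight_comp hw hh t), condMean]

theorem aemeasurable_multiplier (hr : IsRenewalDensity w r) (ht₀ : IsStoppingHorizon r t₀) :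
    AEMeasurable (fun t => ENNReal.ofReal (multiplier r t)) (volume.restrict (Ioc 0 t₀)) :=
  ((intervalIntegrable_iff_integrableOn_Ioc_of_le ht₀.pos.le).1
    (hr.intervalIntegrable_multiplier ht₀.mem_Icc)).1.aemeasurable.ennreal_ofReal

theorem lintegral_potential (hw : IsWeighting w) (hr : IsRenewalDensity w r)
    (ht₀ : IsStoppingHorizon r t₀) (hh : IsTail h) :
    ∫⁻ y in Ioi (0 : ℝ), (condWeight w 0 (h y) +
      ∫⁻ t in Ioc 0 t₀, condWeight w t (h y) * ENNReal.ofReal (multiplier r t)) =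
    condMean w h 0 + ∫⁻ t in Ioc 0 t₀, condMean w h t * ENNReal.ofReal (multiplier r t) := by
  rw [lintegral_add_left (measurable_condWeight_comp hw hh 0),
    lintegral_lintegral_condWeight hw hh (aemeasurable_multiplier hr ht₀), condMean]

theorem ofReal_le_potential (hw : IsWeighting w) (hr : IsRenewalDensity w r)
    (ht₀ : IsStoppingHorizon r t₀) {x : ℝ} (hx : x ∈ Icc (0 : ℝ) 1) :
    ENNReal.ofReal x ≤ condWeight w 0 x +
      ∫⁻ t in Ioc 0 t₀, condWeight w t x * ENNReal.ofReal (multiplier r t) := by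
  rcases hx.1.eq_or_lt with rfl | h0
  · simp
  rcases lt_or_ge x (Real.exp (-t₀)) with h1 | h1
  · exact (lt_multiplier_potential hw hr ht₀ ⟨h0, h1⟩).le
  · exact (multiplier_potential_eq hw hr ht₀ ⟨h1, hx.2⟩).ge

theorem condMean_sum_le (hA : ∀ t ∈ Icc 0 t₀, condMean w h t ≤ ENNReal.ofReal θ)
    (ht₀ : 0 ≤ t₀) :
    condMean w h 0 + ∫⁻ t in Ioc 0 t₀, condMean w h t * ENNReal.ofReal (multiplier r t) ≤
      ENNReal.ofReal θ * multiplierMass r t₀ := by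
  rw [multiplierMass, mul_add, mul_one]
  refine add_le_add (hA 0 ⟨le_rfl, ht₀⟩) ?_
  rw [← lintegral_const_mul' _ _ ENNReal.ofReal_ne_top]
  refine setLIntegral_mono' measurableSet_Ioc fun t ht => ?_
  exact mul_le_mul_left (hA t ⟨ht.1.le, ht.2⟩) _

/-- Weak duality: the potential dominates the identity, Tonelli exchanges levels and multiplier
times, and each constraint is then bounded by `θ`. -/
theorem lintegral_tail_le (hw : IsWeighting w) (hr : IsRenewalDensity w r)
    (ht₀ : IsStoppingHorizon r t₀) (hh : IsTail h)
    (hA : ∀ t ∈ Icc 0 t₀, condMean w h t ≤ ENNReal.ofReal θ) :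
    ∫⁻ y in Ioi (0 : ℝ), ENNReal.ofReal (h y) ≤ ENNReal.ofReal θ * multiplierMass r t₀ :=
  calc _ ≤ _ := lintegral_mono fun y => ofReal_le_potential hw hr ht₀ (hh.mem y)
    _ = _ := lintegral_potential hw hr ht₀ hh
    _ ≤ _ := condMean_sum_le hA ht₀.pos.le

theorem multiplierMass_ne_top (hr : IsRenewalDensity w r) (ht₀ : IsStoppingHorizon r t₀) :
    multiplierMass r t₀ ≠ ∞ := by
  refine ENNReal.add_ne_top.2 ⟨ENNReal.one_ne_top, ?_⟩
  have := (intervalIntegrable_iff_integrableOn_Ioc_of_le ht₀.pos.le).1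
    (hr.intervalIntegrable_multiplier ht₀.mem_Icc)
  refine ((lintegral_mono fun t => ?_).trans_lt this.2).ne
  rw [← ofReal_norm]
  exact ENNReal.ofReal_le_ofReal (Real.le_norm_self _)

/-- Tail functions for which the constraints bind and which avoid `(0, e^{-t₀})`. -/
structure IsBindingTail (w h : ℝ → ℝ) (t₀ θ : ℝ) : Prop where
  range : ∀ᵐ y, y ∈ Ioi (0 : ℝ) → h y = 0 ∨ Real.exp (-t₀) ≤ h y
  zero : condMean w h 0 = ENNReal.ofReal θ
  ae : ∀ᵐ t, t ∈ Ioo 0 t₀ → condMean w h t = ENNReal.ofReal θ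

/-- Complementary slackness: attaining the finite bound forces equality almost everywhere in both
inequalities of weak duality. The first is strict for values in `(0, e^{-t₀})`; in the second the
multiplier is positive on `(0, t₀)` and has an atom at `0`. -/
theorem isBindingTail_of_le (hw : IsWeighting w) (hr : IsRenewalDensity w r)
    (ht₀ : IsStoppingHorizon r t₀) (hh : IsTail h)
    (hA : ∀ t ∈ Icc 0 t₀, condMean w h t ≤ ENNReal.ofReal θ)
    (hle : ENNReal.ofReal θ * multiplierMass r t₀ ≤ ∫⁻ y in Ioi (0 : ℝ), ENNReal.ofReal (h y)) :
    IsBindingTail w h t₀ θ := by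
  have hfin : ENNReal.ofReal θ * multiplierMass r t₀ ≠ ∞ :=
    ENNReal.mul_ne_top ENNReal.ofReal_ne_top (multiplierMass_ne_top hr ht₀)
  have hsum := condMean_sum_le (r := r) hA ht₀.pos.le
  have hpot := lintegral_potential hw hr ht₀ hh
  have h1 : ∫⁻ y in Ioi (0 : ℝ), ENNReal.ofReal (h y) ≠ ∞ :=
    ((lintegral_tail_le hw hr ht₀ hh hA).trans_lt (lt_top_iff_ne_top.2 hfin)).ne
  have mg := aemeasurable_multiplier hr ht₀
  have mp : AEMeasurable (fun y => condWeight w 0 (h y) +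
      ∫⁻ t in Ioc 0 t₀, condWeight w t (h y) * ENNReal.ofReal (multiplier r t))
      (volume.restrict (Ioi (0 : ℝ))) := by
    refine (measurable_condWeight_comp hw hh 0).aemeasurable.add ?_
    have m1 : Measurable fun p : ℝ × ℝ => condWeight w p.2 (h p.1) :=
      hw.measurable_condWeight.comp (measurable_snd.prodMk (hh.measurable.comp measurable_fst))
    exact (m1.aemeasurable.mul mg.comp_snd).lintegral_prod_right'
  have hsumle : ENNReal.ofReal θ * multiplierMass r t₀ ≤ condMean w h 0 +
      ∫⁻ t in Ioc 0 t₀, condMean w h t * ENNReal.ofReal (multiplier r t) := by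
    rw [← hpot]
    exact hle.trans (lintegral_mono fun y => ofReal_le_potential hw hr ht₀ (hh.mem y))
  refine ⟨?_, ?_, ?_⟩
  · have := ae_eq_of_ae_le_of_lintegral_le (Eventually.of_forall fun y =>
      ofReal_le_potential hw hr ht₀ (hh.mem y)) h1 mp (by rw [hpot]; exact hsum.trans hle)
    rw [EventuallyEq, ae_restrict_iff' measurableSet_Ioi] at this
    filter_upwards [this] with y hy hy0
    by_contra! hcon
    have h0 : 0 < h y := lt_of_le_of_ne (hh.mem y).1 (Ne.symm hcon.1)
    exact (lt_multiplier_potential hw hr ht₀ ⟨h0, hcon.2⟩).ne (hy hy0)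
  · refine le_antisymm (hA 0 ⟨le_rfl, ht₀.pos.le⟩) ?_
    have h2 : condMean w h 0 +
        ∫⁻ t in Ioc 0 t₀, condMean w h t * ENNReal.ofReal (multiplier r t) ≤
        condMean w h 0 + ENNReal.ofReal θ *
          ∫⁻ t in Ioc 0 t₀, ENNReal.ofReal (multiplier r t) := by
      rw [← lintegral_const_mul' _ _ ENNReal.ofReal_ne_top]
      refine add_le_add_right (setLIntegral_mono' measurableSet_Ioc fun t ht => ?_) _
      exact mul_le_mul_left (hA t ⟨ht.1.le, ht.2⟩) _
    have h3 := hsumle.trans h2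
    rw [multiplierMass, mul_add, mul_one] at h3 hfin
    exact (ENNReal.add_le_add_iff_right (ENNReal.add_ne_top.1 hfin).2).1 h3
  · have h2 : ENNReal.ofReal θ * ∫⁻ t in Ioc 0 t₀, ENNReal.ofReal (multiplier r t) ≤
        ∫⁻ t in Ioc 0 t₀, condMean w h t * ENNReal.ofReal (multiplier r t) := by
      have h3 := hsumle.trans (add_le_add_left (hA 0 ⟨le_rfl, ht₀.pos.le⟩) _)
      rw [multiplierMass, mul_add, mul_one] at h3
      exact (ENNReal.add_le_add_iff_left ENNReal.ofReal_ne_top).1 h3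
    have h4 : ∫⁻ t in Ioc 0 t₀, condMean w h t * ENNReal.ofReal (multiplier r t) ≠ ∞ :=
      ((le_add_self.trans hsum).trans_lt (lt_top_iff_ne_top.2 hfin)).ne
    rw [← lintegral_const_mul' _ _ ENNReal.ofReal_ne_top] at h2
    have := ae_eq_of_ae_le_of_lintegral_le (μ := volume.restrict (Ioc 0 t₀))
      ((ae_restrict_iff' measurableSet_Ioc).2 (Eventually.of_forall fun t ht =>
        mul_le_mul_left (hA t ⟨ht.1.le, ht.2⟩) (ENNReal.ofReal (multiplier r t))))
      h4 (mg.const_mul _) h2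
    rw [EventuallyEq, ae_restrict_iff' measurableSet_Ioc] at this
    filter_upwards [this] with t ht htI
    have hpos := ht₀.multiplier_pos htI
    exact (ENNReal.mul_left_inj (by simpa using hpos) ENNReal.ofReal_ne_top).1
      (ht ⟨htI.1, htI.2.le⟩)

/-- The size of the set where a binding tail function lies in `(0, e^{-a}]`. -/
noncomputable def bindingLevel (r : ℝ → ℝ) (t₀ θ a : ℝ) : ℝ≥0∞ :=
  ENNReal.ofReal θ + ENNReal.ofReal θ * ∫⁻ t in Ioc a t₀, ENNReal.ofReal (r (t - a))

/-- The renewal measure started at `a` has as potential, on the admissible values of `h`, the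
indicator of `0 < h ≤ e^{-a}`. Integrating over the levels gives the size of that set on one side
and, all constraints involved being binding, `θ` times the mass of the measure on the other. -/
theorem IsBindingTail.volume_eq (hw : IsWeighting w) (hr : IsRenewalDensity w r)
    (ht₀ : IsStoppingHorizon r t₀) (hh : IsTail h) (hb : IsBindingTail w h t₀ θ) {a : ℝ}
    (ha : 0 ≤ a) (hAa : condMean w h a = ENNReal.ofReal θ) :
    volume {y | 0 < y ∧ 0 < h y ∧ h y ≤ Real.exp (-a)} = bindingLevel r t₀ θ a := by
  have mr : Measurable fun t => ENNReal.ofReal (r (t - a)) :=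
    (hr.measurable.comp (measurable_id.sub_const a)).ennreal_ofReal
  have mS : MeasurableSet {y | 0 < h y ∧ h y ≤ Real.exp (-a)} :=
    (measurableSet_lt measurable_const hh.measurable).inter
      (measurableSet_le hh.measurable measurable_const)
  have e1 : ∫⁻ y in Ioi (0 : ℝ), (condWeight w a (h y) +
      ∫⁻ t in Ioc a t₀, condWeight w t (h y) * ENNReal.ofReal (r (t - a))) =
      volume {y | 0 < y ∧ 0 < h y ∧ h y ≤ Real.exp (-a)} := by
    have : ∫⁻ y in Ioi (0 : ℝ), {y | 0 < h y ∧ h y ≤ Real.exp (-a)}.indicator 1 y =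
        volume {y | 0 < y ∧ 0 < h y ∧ h y ≤ Real.exp (-a)} := by
      rw [lintegral_indicator_one mS, Measure.restrict_apply mS]
      congr 1
      ext y
      simp only [mem_inter_iff, mem_ofPred_eq, mem_Ioi]
      tauto
    rw [← this]
    refine lintegral_congr_ae ((ae_restrict_iff' measurableSet_Ioi).2 ?_)
    filter_upwards [hb.range] with y hy hy0
    by_cases hlt : Real.exp (-a) < h y
    · rw [indicator_of_notMem (fun h' => hlt.not_ge h'.2), condWeight_of_lt hlt, zero_add]
      refine (setLIntegral_congr_fun measurableSet_Ioc fun t ht => ?_).trans lintegral_zero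
      rw [condWeight_of_lt ((Real.exp_lt_exp.2 (by linarith [ht.1])).trans hlt), zero_mul]
    · push Not at hlt
      rcases hy hy0 with h0 | h0
      · rw [indicator_of_notMem (fun h' => h'.1.ne' h0), h0]
        simp [hw.condWeight_zero_right]
      · rw [indicator_of_mem (by exact ⟨(Real.exp_pos _).trans_le h0, hlt⟩),
          renewal_potential_eq hw hr ht₀ ha ⟨h0, hlt⟩]
        rfl
  rw [← e1, lintegral_add_left (measurable_condWeight_comp hw hh a),
    lintegral_lintegral_condWeight hw hh mr.aemeasurable, bindingLevel]
  congr 1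
  rw [← lintegral_const_mul _ mr, setLIntegral_congr (Ioo_ae_eq_Ioc (μ := volume)).symm,
    setLIntegral_congr (Ioo_ae_eq_Ioc (μ := volume)).symm]
  refine setLIntegral_congr_fun_ae measurableSet_Ioo ?_
  filter_upwards [hb.ae] with t ht htI
  rw [ht ⟨ha.trans_lt htI.1, htI.2⟩]

theorem bindingLevel_ne_top (hr : IsRenewalDensity w r) (ht₀ : IsStoppingHorizon r t₀) {a : ℝ}
    (ha : 0 ≤ a) (hat : a ≤ t₀) : bindingLevel r t₀ θ a ≠ ∞ := by
  refine ENNReal.add_ne_top.2 ⟨ENNReal.ofReal_ne_top,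
    ENNReal.mul_ne_top ENNReal.ofReal_ne_top ?_⟩
  have hi := (hr.intervalIntegrable_of_le (t := t₀ - a)
    ⟨by linarith, by linarith [ht₀.lt_one]⟩).comp_sub_right a
  rw [zero_add, sub_add_cancel, intervalIntegrable_iff_integrableOn_Ioc_of_le hat] at hi
  have := hi.2
  rw [hasFiniteIntegral_iff_ofReal (Eventually.of_forall fun t => hr.nonneg _)] at this
  exact this.ne

/-- Constraints bind only for almost every time, so the comparison is made at some `x` of each
interval. Below `e^{-t₀}` the tails take no positive values and any `x` works; above, `bindingLevel`
is subtracted from the common total. -/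
theorem IsBindingTail.volume_lt_eq (hw : IsWeighting w) (hr : IsRenewalDensity w r)
    (ht₀ : IsStoppingHorizon r t₀) {h₁ h₂ : ℝ → ℝ} (hh₁ : IsTail h₁) (hh₂ : IsTail h₂)
    (hb₁ : IsBindingTail w h₁ t₀ θ) (hb₂ : IsBindingTail w h₂ t₀ θ) {p q : ℝ} (hp : 0 ≤ p)
    (hpq : p < q) (hq : q ≤ 1) :
    ∃ x ∈ Ioo p q, volume {y | 0 < y ∧ x < h₁ y} = volume {y | 0 < y ∧ x < h₂ y} := by
  have c : ∀ h, IsTail h → IsBindingTail w h t₀ θ →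
      volume {y | 0 < y ∧ 0 < h y} = bindingLevel r t₀ θ 0 := by
    intro h hh hb
    rw [← hb.volume_eq hw hr ht₀ hh le_rfl hb.zero]
    congr 1
    ext y
    simp only [neg_zero, Real.exp_zero, mem_ofPred_eq]
    exact ⟨fun h' => ⟨h'.1, h'.2, (hh.mem y).2⟩, fun h' => ⟨h'.1, h'.2.1⟩⟩
  rcases lt_or_ge p (Real.exp (-t₀)) with hlt | hge
  · obtain ⟨x, hx1, hx2⟩ := exists_between (lt_min hpq hlt)
    refine ⟨x, ⟨hx1, hx2.trans_le (min_le_left _ _)⟩, ?_⟩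
    have : ∀ h, IsTail h → IsBindingTail w h t₀ θ →
        volume {y | 0 < y ∧ x < h y} = bindingLevel r t₀ θ 0 := by
      intro h hh hb
      rw [← c h hh hb]
      refine measure_congr ?_
      filter_upwards [hb.range] with y hy
      simp only [eq_iff_iff]
      refine ⟨fun h' => ⟨h'.1, (hp.trans_lt hx1).trans h'.2⟩, fun h' => ⟨h'.1, ?_⟩⟩
      rcases hy h'.1 with h0 | h0
      · exact absurd h0 h'.2.ne'
      · exact (hx2.trans_le (min_le_right _ _)).trans_le h0
    rw [this h₁ hh₁ hb₁, this h₂ hh₂ hb₂]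
  · have hp0 : 0 < p := (Real.exp_pos _).trans_le hge
    have hvol : volume (Ioo (-Real.log q) (-Real.log p)) ≠ 0 := by
      rw [Real.volume_Ioo]
      simpa using Real.log_lt_log hp0 hpq
    obtain ⟨a, ha, ha₁, ha₂⟩ :=
      ((frequently_ae_mem_iff.2 hvol).and_eventually (hb₁.ae.and hb₂.ae)).exists
    have ha0 : 0 < a := by linarith [ha.1, Real.log_nonpos (hp0.trans hpq).le hq]
    have hat : a < t₀ := by
      have := (Real.le_log_iff_exp_le hp0).2 hge
      linarith [ha.2]
    refine ⟨Real.exp (-a), ⟨?_, ?_⟩, ?_⟩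
    · rw [← Real.log_lt_iff_lt_exp hp0]; linarith [ha.2]
    · rw [← Real.lt_log_iff_exp_lt (hp0.trans hpq)]; linarith [ha.1]
    have : ∀ h, IsTail h → IsBindingTail w h t₀ θ → condMean w h a = ENNReal.ofReal θ →
        volume {y | 0 < y ∧ Real.exp (-a) < h y} + bindingLevel r t₀ θ a =
          bindingLevel r t₀ θ 0 := by
      intro h hh hb hA
      rw [← c h hh hb, ← hb.volume_eq hw hr ht₀ hh ha0.le hA, ← measure_union]
      · congr 1
        ext y
        simp only [mem_union, mem_ofPred_eq]
        constructor
        · rintro (h' | h')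
          · exact ⟨h'.1, (Real.exp_pos _).trans h'.2⟩
          · exact ⟨h'.1, h'.2.1⟩
        · intro h'
          rcases lt_or_ge (Real.exp (-a)) (h y) with h1 | h1
          · exact Or.inl ⟨h'.1, h1⟩
          · exact Or.inr ⟨h'.1, h'.2, h1⟩
      · exact Set.disjoint_left.2 fun y h1 h2 => h1.2.not_ge h2.2.2
      · exact (measurableSet_lt measurable_const measurable_id).inter
          ((measurableSet_lt measurable_const hh.measurable).inter
            (measurableSet_le hh.measurable measurable_const))
    have e := (this h₁ hh₁ hb₁ (ha₁ ⟨ha0, hat⟩)).trans (this h₂ hh₂ hb₂ (ha₂ ⟨ha0, hat⟩)).symm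
    exact (ENNReal.add_left_inj (bindingLevel_ne_top hr ht₀ ha0.le hat.le)).1 e

/-- Right-continuous binding tail functions are unique. -/
theorem IsBindingTail.unique (hw : IsWeighting w) (hr : IsRenewalDensity w r)
    (ht₀ : IsStoppingHorizon r t₀) {h₁ h₂ : ℝ → ℝ} (hh₁ : IsTail h₁) (hh₂ : IsTail h₂)
    (rc₂ : ∀ y c, c < h₂ y → ∃ z > y, c < h₂ z)
    (hb₁ : IsBindingTail w h₁ t₀ θ) (hb₂ : IsBindingTail w h₂ t₀ θ) {y : ℝ} (hy : 0 ≤ y) :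
    h₂ y ≤ h₁ y := by
  by_contra! hlt
  obtain ⟨α, h1, h2⟩ := exists_between hlt
  -- Right continuity opens a gap: for `x` between `h₁ y` and `α`, the set `x < h₁` lies in `(0, y]`
  -- while `x < h₂` contains `(0, z]`.
  obtain ⟨z, hz, hαz⟩ := rc₂ y α h2
  obtain ⟨x, hx, e⟩ := hb₁.volume_lt_eq hw hr ht₀ hh₁ hh₂ hb₂ (hh₁.mem y).1 h1
    (h2.le.trans (hh₂.mem y).2)
  have hz0 : 0 < z := hy.trans_lt hz
  have l1 : volume {y | 0 < y ∧ x < h₁ y} ≤ ENNReal.ofReal y := by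
    have : {y | 0 < y ∧ x < h₁ y} ⊆ Ioc 0 y := fun u hu => ⟨hu.1, by
      by_contra! hlt
      exact (hu.2.trans_le (hh₁.antitone hlt.le)).not_ge hx.1.le⟩
    simpa using measure_mono (μ := volume) this
  have l2 : ENNReal.ofReal z ≤ volume {y | 0 < y ∧ x < h₂ y} := by
    have : Ioc 0 z ⊆ {y | 0 < y ∧ x < h₂ y} := fun u hu =>
      ⟨hu.1, (hx.2.trans hαz).trans_le (hh₂.antitone hu.2)⟩
    simpa using measure_mono (μ := volume) this
  rw [e] at l1
  exact ((ENNReal.ofReal_lt_ofReal_iff hz0).2 hz).not_ge (l2.trans l1)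

/-- The lump sum at `t₀` and the flow `f` make all constraints up to `t₀` bind. -/
theorem condWeight_binding (hw : IsWeighting w) (hr : IsRenewalDensity w r)
    (ht₀ : IsStoppingHorizon r t₀) {t : ℝ} (ht : t ∈ Icc 0 t₀) :
    (∫⁻ s in Ioc 0 t₀, condWeight w t (Real.exp (-s)) * ENNReal.ofReal (r (t₀ - s))) +
      condWeight w t (Real.exp (-t₀)) = 1 := by
  obtain ⟨hi, he⟩ := hr.solvesBindingEq ht₀.mem_Icc
  have hm : ∀ s, t ≤ s → Real.exp t * Real.exp (-s) ∈ Icc (0 : ℝ) 1 := fun s hs =>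
    ⟨by positivity, by rw [← Real.exp_add, Real.exp_le_one_iff]; linarith⟩
  have hc : ∀ s, t ≤ s → condWeight w t (Real.exp (-s)) =
      ENNReal.ofReal (w (Real.exp (-s + t))) := fun s hs => by
    rw [condWeight_of_mem ⟨(Real.exp_pos _).le, Real.exp_le_exp.2 (by linarith)⟩,
      ← Real.exp_add, add_comm]
  have hif : IntervalIntegrable (fun s => r (t₀ - s)) volume t t₀ :=
    ((intervalIntegrable_iff_integrableOn_Icc_of_le ht₀.pos.le).2 hi).mono_set
      (by rw [uIcc_of_le ht.2, uIcc_of_le ht₀.pos.le]; exact Icc_subset_Icc ht.1 le_rfl)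
  have hm' : ∀ s ∈ Icc t t₀, Real.exp (-s + t) ∈ Icc (0 : ℝ) 1 := fun s hs => by
    rw [add_comm, Real.exp_add]; exact hm s hs.1
  have hiw : IntervalIntegrable (fun s => w (Real.exp (-s + t)) * r (t₀ - s)) volume t t₀ := by
    refine hif.continuousOn_mul ?_
    rw [uIcc_of_le ht.2]
    exact hw.continuousOn.comp (by fun_prop) hm'
  have e1 : ∫⁻ s in Ioc 0 t₀, condWeight w t (Real.exp (-s)) * ENNReal.ofReal (r (t₀ - s)) =
      ∫⁻ s in Ioc t t₀, ENNReal.ofReal (w (Real.exp (-s + t)) * r (t₀ - s)) := by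
    rw [← lintegral_indicator measurableSet_Ioc, ← lintegral_indicator measurableSet_Ioc]
    have hne : ∀ᵐ s : ℝ, s ≠ t := by simp [ae_iff, measure_singleton]
    refine lintegral_congr_ae ?_
    filter_upwards [hne] with s hs
    by_cases h1 : s ∈ Ioc t t₀
    · rw [indicator_of_mem h1, indicator_of_mem (show s ∈ Ioc 0 t₀ from
        ⟨ht.1.trans_lt h1.1, h1.2⟩), hc s h1.1.le,
        ENNReal.ofReal_mul (hw.nonneg (hm' s ⟨h1.1.le, h1.2⟩))]
    · rw [indicator_of_notMem h1, indicator_apply]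
      split_ifs with h2
      · have : s < t := lt_of_le_of_ne (by by_contra! h; exact h1 ⟨h, h2.2⟩) hs
        rw [condWeight_of_lt (Real.exp_lt_exp.2 (by linarith)), zero_mul]
      · rfl
  have hpos : ∀ s ∈ Ioc t t₀, 0 ≤ w (Real.exp (-s + t)) * r (t₀ - s) := fun s hs =>
    mul_nonneg (hw.nonneg (hm' s ⟨hs.1.le, hs.2⟩)) (hr.nonneg _)
  rw [e1, hc t₀ ht.2, ← ofReal_integral_eq_lintegral_ofReal
    ((intervalIntegrable_iff_integrableOn_Ioc_of_le ht.2).1 hiw)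
    ((ae_restrict_iff' measurableSet_Ioc).2 (Eventually.of_forall hpos)),
    ← ENNReal.ofReal_add (setIntegral_nonneg measurableSet_Ioc hpos)
      (hw.nonneg (hm' t₀ ⟨ht.2, le_rfl⟩)), ← intervalIntegral.integral_of_le ht.2, add_comm,
    he t ht, ENNReal.ofReal_one]

/-- A tail function with the quantiles of the candidate optimum makes every constraint bind. -/
theorem condMean_eq_of_volume (hw : IsWeighting w) (hr : IsRenewalDensity w r)
    (ht₀ : IsStoppingHorizon r t₀) (hθ : 0 < θ) (hh : IsTail h)
    (hrange : ∀ y, 0 < y → h y = 0 ∨ Real.exp (-t₀) ≤ h y)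
    (hlev : ∀ a ∈ Ico 0 t₀, volume {y | 0 < y ∧ Real.exp (-a) ≤ h y} =
      ENNReal.ofReal (θ * ∫ s in (0 : ℝ)..a, r (t₀ - s)))
    (htot : volume {y | 0 < y ∧ 0 < h y} =
      ENNReal.ofReal (θ * (1 + ∫ s in (0 : ℝ)..t₀, r (t₀ - s)))) {t : ℝ} (ht : t ∈ Icc 0 t₀) :
    condMean w h t = ENNReal.ofReal θ := by
  obtain ⟨hi, -⟩ := hr.solvesBindingEq ht₀.mem_Icc
  have hif : ∀ a ∈ Icc 0 t₀, IntervalIntegrable (fun s => r (t₀ - s)) volume 0 a := fun a ha =>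
    ((intervalIntegrable_iff_integrableOn_Icc_of_le ht₀.pos.le).2 hi).mono_set
      (by rw [uIcc_of_le ha.1, uIcc_of_le ht₀.pos.le]; exact Icc_subset_Icc le_rfl ha.2)
  have mf : Measurable fun s => ENNReal.ofReal (r (t₀ - s)) :=
    (hr.measurable.comp (measurable_const.sub measurable_id)).ennreal_ofReal
  have hlf : ∀ a ∈ Icc 0 t₀, ∫⁻ s in Ioc 0 a, ENNReal.ofReal (r (t₀ - s)) =
      ENNReal.ofReal (∫ s in (0 : ℝ)..a, r (t₀ - s)) := fun a ha => by
    rw [intervalIntegral.integral_of_le ha.1, ofReal_integral_eq_lintegral_ofReal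
      ((intervalIntegrable_iff_integrableOn_Ioc_of_le ha.1).1 (hif a ha))
      (Eventually.of_forall fun s => hr.nonneg _)]
  set S : Set ℝ := {y | 0 < y ∧ 0 < h y} with hS
  have mS : MeasurableSet S := (measurableSet_lt measurable_const measurable_id).inter
    (measurableSet_lt measurable_const hh.measurable)
  have ml : Measurable fun y => -Real.log (h y) := hh.measurable.log.neg
  -- The constraint at `t` sees `h` only through the distribution of `-log h` on its support. The
  -- hypotheses identify this distribution with `θ` times the flow on `(0, t₀]` plus an atom at
  -- `t₀`, for which `condWeight_binding` evaluates the constraint.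
  set m : Measure ℝ := (volume.restrict S).map fun y => -Real.log (h y) with hm
  set f : ℝ → ℝ≥0∞ := fun s => ENNReal.ofReal (r (t₀ - s)) with hf
  set m' : Measure ℝ := ENNReal.ofReal θ •
    ((volume.restrict (Ioc 0 t₀)).withDensity f + Measure.dirac t₀) with hm'
  have hfin : IsFiniteMeasure m := by
    refine ⟨?_⟩
    rw [hm, Measure.map_apply ml MeasurableSet.univ, preimage_univ, Measure.restrict_apply_univ,
      htot]
    exact ENNReal.ofReal_lt_top
  have hmm : m = m' := by
    refine Measure.ext_of_Iic m m' fun a => ?_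
    rw [hm, Measure.map_apply ml measurableSet_Iic,
      Measure.restrict_apply (ml measurableSet_Iic), hm', Measure.smul_apply, Measure.add_apply,
      withDensity_apply _ measurableSet_Iic, Measure.restrict_restrict measurableSet_Iic,
      Measure.dirac_apply' _ measurableSet_Iic, smul_eq_mul]
    have hset : (fun y => -Real.log (h y)) ⁻¹' Iic a ∩ S = {y | 0 < y ∧ Real.exp (-a) ≤ h y} := by
      ext y
      simp only [mem_inter_iff, mem_preimage, mem_Iic, hS, mem_ofPred_eq]
      constructor
      · rintro ⟨h1, h2, h3⟩
        exact ⟨h2, (Real.le_log_iff_exp_le h3).1 (by linarith)⟩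
      · rintro ⟨h1, h2⟩
        have h3 : 0 < h y := (Real.exp_pos _).trans_le h2
        have := (Real.le_log_iff_exp_le h3).2 h2
        exact ⟨by linarith, h1, h3⟩
    rw [hset]
    rcases lt_or_ge a 0 with ha | ha
    · have e1 : {y | 0 < y ∧ Real.exp (-a) ≤ h y} = ∅ := by
        refine eq_empty_of_forall_notMem fun y hy => ?_
        have : 1 < Real.exp (-a) := Real.one_lt_exp_iff.2 (by linarith)
        linarith [hy.2, (hh.mem y).2]
      have e2 : Iic a ∩ Ioc 0 t₀ = ∅ := by
        refine eq_empty_of_forall_notMem fun y hy => ?_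
        linarith [hy.1.out, hy.2.1]
      rw [e1, e2, indicator_of_notMem (by simpa using ha.trans ht₀.pos)]
      simp
    rcases lt_or_ge a t₀ with hat | hat
    · have e2 : Iic a ∩ Ioc 0 t₀ = Ioc 0 a := by
        ext y
        simp only [mem_inter_iff, mem_Iic, mem_Ioc]
        exact ⟨fun h => ⟨h.2.1, h.1⟩, fun h => ⟨h.2, h.1, h.2.trans hat.le⟩⟩
      rw [hlev a ⟨ha, hat⟩, e2, indicator_of_notMem (by simpa using hat), add_zero,
        hlf a ⟨ha, hat.le⟩, ENNReal.ofReal_mul hθ.le]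
    · have e1 : {y | 0 < y ∧ Real.exp (-a) ≤ h y} = S := by
        ext y
        simp only [hS, mem_ofPred_eq]
        refine ⟨fun h' => ⟨h'.1, (Real.exp_pos _).trans_le h'.2⟩, fun h' => ⟨h'.1, ?_⟩⟩
        rcases hrange y h'.1 with h0 | h0
        · exact absurd h0 h'.2.ne'
        · exact (Real.exp_le_exp.2 (by linarith)).trans h0
      have e2 : Iic a ∩ Ioc 0 t₀ = Ioc 0 t₀ :=
        inter_eq_right.2 fun y hy => hy.2.trans hat
      have hn : 0 ≤ ∫ s in (0 : ℝ)..t₀, r (t₀ - s) :=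
        intervalIntegral.integral_nonneg ht₀.pos.le fun s _ => hr.nonneg _
      rw [e1, htot, e2, indicator_of_mem (by simpa using hat), hlf t₀ ⟨ht₀.pos.le, le_rfl⟩,
        ENNReal.ofReal_mul hθ.le, ENNReal.ofReal_add zero_le_one hn, ENNReal.ofReal_one,
        add_comm, Pi.one_apply]
  have mc : Measurable fun s => condWeight w t (Real.exp (-s)) :=
    hw.measurable_condWeight.comp (measurable_const.prodMk (by fun_prop))
  have e1 : condMean w h t = ∫⁻ s, condWeight w t (Real.exp (-s)) ∂m := by
    rw [hm, lintegral_map mc ml, ← lintegral_indicator mS, condMean,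
      ← lintegral_indicator measurableSet_Ioi]
    refine lintegral_congr fun y => ?_
    by_cases hy : y ∈ S
    · rw [indicator_of_mem hy, indicator_of_mem (show y ∈ Ioi (0 : ℝ) from hy.1), neg_neg,
        Real.exp_log hy.2]
    · rw [indicator_of_notMem hy, indicator_apply]
      split_ifs with h0
      · have : h y = 0 := le_antisymm (not_lt.1 fun h' => hy ⟨h0, h'⟩) (hh.mem y).1
        rw [this, hw.condWeight_zero_right]
      · rfl
  rw [e1, hmm, hm', lintegral_smul_measure, lintegral_add_measure, lintegral_dirac' _ mc,
    lintegral_withDensity_eq_lintegral_mul _ mf mc]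
  have := condWeight_binding hw hr ht₀ ht
  simp only [mul_comm (condWeight w t _)] at this
  simp only [Pi.mul_apply, hf, smul_eq_mul]
  rw [this, mul_one]

/-- On the values that `h` takes the potential is the identity, and the constraints are equalities,
so weak duality holds with equality throughout. -/
theorem lintegral_tail_eq (hw : IsWeighting w) (hr : IsRenewalDensity w r)
    (ht₀ : IsStoppingHorizon r t₀) (hh : IsTail h)
    (hrange : ∀ y, 0 < y → h y = 0 ∨ Real.exp (-t₀) ≤ h y)
    (hA : ∀ t ∈ Icc 0 t₀, condMean w h t = ENNReal.ofReal θ) :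
    ∫⁻ y in Ioi (0 : ℝ), ENNReal.ofReal (h y) = ENNReal.ofReal θ * multiplierMass r t₀ := by
  have e := lintegral_potential hw hr ht₀ hh
  have e1 : condMean w h 0 +
      ∫⁻ t in Ioc 0 t₀, condMean w h t * ENNReal.ofReal (multiplier r t) =
      ENNReal.ofReal θ * multiplierMass r t₀ := by
    rw [multiplierMass, mul_add, mul_one, hA 0 ⟨le_rfl, ht₀.pos.le⟩,
      ← lintegral_const_mul' _ _ ENNReal.ofReal_ne_top]
    congr 1
    refine setLIntegral_congr_fun measurableSet_Ioc fun t ht => ?_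
    rw [hA t ⟨ht.1.le, ht.2⟩]
  rw [← e1, ← e]
  refine setLIntegral_congr_fun measurableSet_Ioi fun y hy => ?_
  rcases hrange y hy with h0 | h0
  · rw [h0, multiplier_potential_zero hw, ENNReal.ofReal_zero]
  · rw [multiplier_potential_eq hw hr ht₀ ⟨h0, (hh.mem y).2⟩]

end tail

/-! ### Cumulative payments: left continuity and their level times. -/

section payment

variable {T : ℝ≥0 → ℝ}

theorem IsRegularPayment.zero (hT : IsRegularPayment T) : T 0 = 0 := by
  obtain ⟨f, a, J, -, -, ha, -, -, hT⟩ := hT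
  rw [hT]
  simp [fun i => (ha i).not_gt]

theorem IsRegularPayment.monotone (hT : IsRegularPayment T) : Monotone T := by
  obtain ⟨f, a, J, hf, hi, ha, hJ, hs, hT⟩ := hT
  intro s t hst
  have hst' : (s : ℝ) ≤ t := by exact_mod_cast hst
  rw [hT, hT]
  refine add_le_add ?_ ((hs s).tsum_le_tsum (fun i => ?_) (hs t))
  · exact intervalIntegral.integral_mono_interval le_rfl s.2 hst'
      (Eventually.of_forall hf) (hi t)
  · by_cases h1 : a i < s
    · rw [if_pos h1, if_pos (h1.trans_le hst')]
    · rw [if_neg h1]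
      split_ifs
      · exact hJ i
      · exact le_rfl

/-- This is left continuity: a lump sum due at `s` is not yet counted in `T s`. -/
theorem IsRegularPayment.le_of_forall_lt (hT : IsRegularPayment T) {s : ℝ≥0} {y : ℝ}
    (hs0 : 0 < s) (h : ∀ s' < s, T s' ≤ y) : T s ≤ y := by
  obtain ⟨f, a, J, hf, hi, ha, hJ, hs, hT⟩ := hT
  have hs0' : (0 : ℝ) < s := by exact_mod_cast hs0
  have h1 : Tendsto (fun x : ℝ => ∫ u in (0 : ℝ)..x, f u) (𝓝[<] (s : ℝ))
      (𝓝 (∫ u in (0 : ℝ)..s, f u)) := by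
    have hc := intervalIntegral.continuousOn_primitive_interval
      ((intervalIntegrable_iff' (by simp)).1 (hi s))
    rw [uIcc_of_le hs0'.le] at hc
    refine ((hc s ⟨hs0'.le, le_rfl⟩).mono_left ?_)
    rw [← nhdsWithin_Ico_eq_nhdsLT hs0']
    exact nhdsWithin_mono _ Ico_subset_Icc_self
  have h2 : Tendsto (fun x : ℝ => ∑' i, if a i < x then J i else 0) (𝓝[<] (s : ℝ))
      (𝓝 (∑' i, if a i < s then J i else 0)) := by
    refine tendsto_tsum_of_dominated_convergence (hs s) (fun i => ?_) ?_
    · by_cases hi : a i < s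
      · rw [if_pos hi]
        refine tendsto_const_nhds.congr' ?_
        filter_upwards [nhdsWithin_le_nhds (Ioi_mem_nhds hi)] with x hx
        rw [if_pos (show a i < x from hx)]
      · rw [if_neg hi]
        refine tendsto_const_nhds.congr' ?_
        filter_upwards [self_mem_nhdsWithin] with x hx
        rw [if_neg fun h => hi (h.trans hx)]
    · filter_upwards [self_mem_nhdsWithin] with x hx i
      by_cases hi : a i < x
      · rw [if_pos hi, if_pos (hi.trans hx), Real.norm_of_nonneg (hJ i)]
      · rw [if_neg hi, norm_zero]
        split_ifs
        · exact hJ i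
        · exact le_rfl
  rw [hT]
  refine le_of_tendsto (h1.add h2) ?_
  filter_upwards [Ico_mem_nhdsLT hs0'] with x hx
  have := h ⟨x, hx.1⟩ (by exact_mod_cast hx.2)
  exact (hT ⟨x, hx.1⟩).ge.trans this

/-- The last time at which a cumulative payment is at most `y`. -/
theorem IsRegularPayment.exists_last (hT : IsRegularPayment T) {y : ℝ} (hy : 0 ≤ y)
    (h : ∃ s, y < T s) : ∃ s, T s ≤ y ∧ ∀ t, s < t → y < T t := by
  obtain ⟨s₁, hs₁⟩ := h
  set S : Set ℝ≥0 := {s | T s ≤ y} with hS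
  have h0 : (0 : ℝ≥0) ∈ S := by simpa [hS, hT.zero] using hy
  have hb : BddAbove S := ⟨s₁, fun s hs => by
    by_contra! hlt
    exact (hs₁.trans_le (hT.monotone hlt.le)).not_ge hs⟩
  refine ⟨sSup S, ?_, fun t ht => ?_⟩
  · rcases eq_or_lt_of_le (zero_le (a := sSup S)) with he | hpos
    · rw [← he]; exact h0
    · refine hT.le_of_forall_lt hpos fun s' hs' => ?_
      obtain ⟨u, hu, hlt⟩ := exists_lt_of_lt_csSup ⟨0, h0⟩ hs'
      exact (hT.monotone hlt.le).trans hu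
  · by_contra! hle
    exact ht.not_ge (le_csSup hb hle)

theorem payAt_top : payAt T ⊤ = ⨆ s : ℝ≥0, (T s : EReal) := if_pos rfl

theorem payAt_coe (t : ℝ≥0) : payAt T t = (T t : EReal) := by
  rw [payAt, if_neg ENNReal.coe_ne_top, ENNReal.toNNReal_coe]

theorem monotone_payAt (hT : Monotone T) : Monotone (payAt T) := by
  intro s t hst
  induction t with
  | top =>
    induction s with
    | top => exact le_rfl
    | coe s => rw [payAt_coe, payAt_top]; exact le_iSup (fun s => (T s : EReal)) s
  | coe t =>
    induction s with
    | top => exact absurd hst (by simp)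
    | coe s =>
      rw [payAt_coe, payAt_coe]
      exact EReal.coe_le_coe_iff.2 (hT (by exact_mod_cast hst))

/-- Payment events become survival events of `τ`; this is how conditioning on time is converted into
conditioning on the level of payments. -/
theorem lt_payAt_iff {y : ℝ} {s : ℝ≥0} (hT : Monotone T) (h1 : T s ≤ y)
    (h2 : ∀ t, s < t → y < T t) (t : ℝ≥0∞) : (y : EReal) < payAt T t ↔ (s : ℝ≥0∞) < t := by
  constructor
  · intro h
    by_contra! hle
    have := monotone_payAt hT hle
    rw [payAt_coe] at this
    exact (h.trans_le this).not_ge (EReal.coe_le_coe_iff.2 h1)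
  · intro h
    obtain ⟨u, hu1, hu2⟩ := ENNReal.lt_iff_exists_nnreal_btwn.1 h
    have h3 := monotone_payAt hT hu2.le
    rw [payAt_coe] at h3
    exact lt_of_lt_of_le (EReal.coe_lt_coe_iff.2 (h2 u (by exact_mod_cast hu1))) h3

end payment

/-! ### Dynamic individual rationality in terms of the tail of the total payment. -/

section process

universe u

variable {Ω : Type u} [MeasurableSpace Ω] {w : ℝ → ℝ} {P : Measure Ω} {θ : ℝ}

/-- The tail function `y ↦ P(Z > y)`. -/
noncomputable def tailProb (P : Measure Ω) (Z : Ω → EReal) (y : ℝ) : ℝ :=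
  P.real {ω | (y : EReal) < Z ω}

theorem isTail_tailProb (P : Measure Ω) [IsProbabilityMeasure P] (Z : Ω → EReal) :
    IsTail (tailProb P Z) :=
  ⟨fun _ _ hxy => measureReal_mono fun _ hω => lt_of_le_of_lt (EReal.coe_le_coe_iff.2 hxy) hω,
    fun _ => measureReal_mem_Icc P _⟩

/-- Right continuity of the tail, from continuity of `P` along the increasing events at levels `y +
1/(n+1)`. -/
theorem exists_lt_tailProb [IsProbabilityMeasure P] (Z : Ω → EReal) (y c : ℝ)
    (h : c < tailProb P Z y) : ∃ z > y, c < tailProb P Z z := by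
  set s : ℕ → Set Ω := fun n => {ω | ((y + 1 / ((n : ℝ) + 1) : ℝ) : EReal) < Z ω} with hs
  have hm : Monotone s := fun m n hmn ω hω => lt_of_le_of_lt
    (EReal.coe_le_coe_iff.2 (add_le_add_right (Nat.one_div_le_one_div hmn) y)) hω
  have hU : ⋃ n, s n = {ω | (y : EReal) < Z ω} := by
    ext ω
    simp only [hs, mem_iUnion, mem_ofPred_eq]
    constructor
    · rintro ⟨n, hn⟩
      refine lt_trans (EReal.coe_lt_coe_iff.2 ?_) hn
      have := Nat.one_div_pos_of_nat (α := ℝ) (n := n)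
      linarith
    · intro hω
      obtain ⟨x, hx1, hx2⟩ := EReal.lt_iff_exists_real_btwn.1 hω
      obtain ⟨n, hn⟩ := exists_nat_one_div_lt (sub_pos.2 (EReal.coe_lt_coe_iff.1 hx1))
      exact ⟨n, lt_trans (EReal.coe_lt_coe_iff.2 (by linarith)) hx2⟩
  have ht := tendsto_measure_iUnion_atTop (μ := P) hm
  rw [hU] at ht
  have ht' := (ENNReal.tendsto_toReal (measure_ne_top P _)).comp ht
  obtain ⟨n, hn⟩ := (ht'.eventually_const_lt h).exists
  refine ⟨y + 1 / ((n : ℝ) + 1), ?_, hn⟩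
  have := Nat.one_div_pos_of_nat (α := ℝ) (n := n)
  linarith

theorem revenue_eq_lintegral_tailProb [IsProbabilityMeasure P] (Z : Ω → EReal) :
    revenue P Z = ∫⁻ y in Ioi (0 : ℝ), ENNReal.ofReal (tailProb P Z y) := by
  refine lintegral_congr fun y => ?_
  rw [tailProb, ofReal_measureReal]

theorem setLIntegral_comp_add_left (F : ℝ → ℝ≥0∞) (c : ℝ) :
    ∫⁻ y in Ioi (0 : ℝ), F (c + y) = ∫⁻ y in Ioi c, F y := by
  rw [← lintegral_indicator measurableSet_Ioi, ← lintegral_indicator measurableSet_Ioi,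
    ← lintegral_add_left_eq_self ((Ioi c).indicator F) c]
  refine lintegral_congr fun y => ?_
  by_cases hy : 0 < y
  · rw [indicator_of_mem (by exact hy), indicator_of_mem (by simpa using hy)]
  · rw [indicator_of_notMem (by exact hy), indicator_of_notMem (by simpa using hy)]

variable {τ : Ω → ℝ≥0∞} {T : ℝ≥0 → ℝ}

theorem measurableSet_lt_time (hτ : Measurable τ) (s : ℝ≥0) :
    MeasurableSet {ω | (s : ℝ≥0∞) < τ ω} := measurableSet_lt measurable_const hτ

theorem measurable_totalPayment (hτ : Measurable τ) (hT : IsRegularPayment T) :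
    Measurable (totalPayment τ T) := (monotone_payAt hT.monotone).measurable.comp hτ

theorem lt_of_lt_payAt {s : ℝ≥0} (hT : Monotone T) {t : ℝ≥0∞}
    (h : (T s : EReal) < payAt T t) : (s : ℝ≥0∞) < t := by
  by_contra! hle
  have := monotone_payAt hT hle
  rw [payAt_coe] at this
  exact h.not_ge this

/-- The distorted mean of the remaining payment, conditional on `τ > s`. -/
theorem distortedMean_cond [IsProbabilityMeasure P] (hτ : Measurable τ)
    (hT : IsRegularPayment T) (s : ℝ≥0) :
    distortedMean w (ProbabilityTheory.cond P {ω | (s : ℝ≥0∞) < τ ω})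
      (fun ω => payAt T (τ ω) - (T s : EReal)) =
    ∫⁻ y in Ioi (T s), ENNReal.ofReal
      (w (tailProb P (totalPayment τ T) y / P.real {ω | (s : ℝ≥0∞) < τ ω})) := by
  rw [← setLIntegral_comp_add_left]
  refine setLIntegral_congr_fun measurableSet_Ioi fun y hy => ?_
  have hset : {ω | (s : ℝ≥0∞) < τ ω} ∩ {ω | (y : EReal) < payAt T (τ ω) - (T s : EReal)} =
      {ω | ((T s + y : ℝ) : EReal) < totalPayment τ T ω} := by
    ext ω
    simp only [mem_inter_iff, mem_ofPred_eq, totalPayment]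
    have e : (y : EReal) < payAt T (τ ω) - (T s : EReal) ↔
        ((T s + y : ℝ) : EReal) < payAt T (τ ω) := by
      generalize payAt T (τ ω) = z
      induction z with
      | bot => simp
      | top => simpa using EReal.coe_lt_top (T s + y)
      | coe z =>
        rw [← EReal.coe_sub, EReal.coe_lt_coe_iff, EReal.coe_lt_coe_iff]
        constructor <;> intro h <;> linarith
    rw [e]
    refine ⟨fun h => h.2, fun h => ⟨lt_of_lt_payAt hT.monotone (lt_trans ?_ h), h⟩⟩
    exact EReal.coe_lt_coe_iff.2 (by linarith [hy.out])
  congr 2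
  rw [measureReal_def, ProbabilityTheory.cond_apply (measurableSet_lt_time hτ s), hset,
    ENNReal.toReal_mul, ENNReal.toReal_inv, tailProb, measureReal_def, measureReal_def,
    div_eq_inv_mul]

theorem jointCPT_dynamicNet_nonneg_iff (hw : IsWeighting w)
    (hsymm : ∀ p ∈ Icc (0 : ℝ) 1, w p + w (1 - p) = 1) [IsProbabilityMeasure P] (hθ : 0 < θ)
    (hτ : Measurable τ) (hT : IsRegularPayment T) {s : ℝ≥0}
    (hs : 0 < P {ω | (s : ℝ≥0∞) < τ ω}) :
    0 ≤ jointCPT w w 1 (ProbabilityTheory.cond P {ω | (s : ℝ≥0∞) < τ ω}) (dynamicNet θ τ T s) ↔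
      distortedMean w (ProbabilityTheory.cond P {ω | (s : ℝ≥0∞) < τ ω})
        (fun ω => payAt T (τ ω) - (T s : EReal) +
          ({ω | τ ω = ⊤}.indicator (fun _ => θ) ω : ℝ)) ≤ ENNReal.ofReal θ := by
  have := ProbabilityTheory.cond_isProbabilityMeasure (μ := P) hs.ne'
  refine jointCPT_nonneg_iff hw hsymm hθ
    ((measurable_totalPayment hτ hT).sub measurable_const) ?_
    (measurableSet_eq_fun hτ measurable_const) fun ω => ?_
  · filter_upwards [ProbabilityTheory.ae_cond_mem (measurableSet_lt_time hτ s)] with ω hω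
    have h1 := monotone_payAt hT.monotone (le_of_lt hω)
    rw [payAt_coe] at h1
    have h2 := EReal.sub_le_sub h1 (le_refl (T s : EReal))
    rwa [← EReal.coe_sub, sub_self, EReal.coe_zero] at h2
  · rw [dynamicNet]
    congr 2
    by_cases h : τ ω = ⊤
    · rw [if_neg (by simp [h]), indicator_of_notMem (by simpa using h)]
    · rw [if_pos (lt_top_iff_ne_top.2 h), indicator_of_mem (by simpa using h)]

theorem JointDIR.distortedMean_le (hw : IsWeighting w)
    (hsymm : ∀ p ∈ Icc (0 : ℝ) 1, w p + w (1 - p) = 1) [IsProbabilityMeasure P] (hθ : 0 < θ)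
    (hτ : Measurable τ) (hT : IsRegularPayment T) (hD : JointDIR w w 1 θ P τ T) {s : ℝ≥0}
    (hs : 0 < P {ω | (s : ℝ≥0∞) < τ ω}) :
    ∫⁻ y in Ioi (T s), ENNReal.ofReal
      (w (tailProb P (totalPayment τ T) y / P.real {ω | (s : ℝ≥0∞) < τ ω})) ≤
      ENNReal.ofReal θ := by
  have := ProbabilityTheory.cond_isProbabilityMeasure (μ := P) hs.ne'
  rw [← distortedMean_cond hτ hT]
  refine le_trans (distortedMean_mono hw (Eventually.of_forall fun ω => ?_))
    ((jointCPT_dynamicNet_nonneg_iff hw hsymm hθ hτ hT hs).1 (hD s hs))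
  refine le_add_of_nonneg_right ?_
  exact_mod_cast indicator_nonneg (fun _ _ => hθ.le) ω

/-- Dynamic individual rationality bounds all conditional distorted means of the tail function. -/
theorem JointDIR.condMean_le (hw : IsWeighting w)
    (hsymm : ∀ p ∈ Icc (0 : ℝ) 1, w p + w (1 - p) = 1) [IsProbabilityMeasure P] (hθ : 0 < θ)
    (hτ : Measurable τ) (hT : IsRegularPayment T) (hD : JointDIR w w 1 θ P τ T) (t : ℝ) :
    condMean w (tailProb P (totalPayment τ T)) t ≤ ENNReal.ofReal θ := by
  set H := tailProb P (totalPayment τ T) with hH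
  have hh : IsTail H := isTail_tailProb P _
  set S : Set ℝ := {y | 0 ≤ y ∧ H y ≤ Real.exp (-t)} with hS
  rcases S.eq_empty_or_nonempty with hemp | hne
  · rw [condMean, setLIntegral_congr_fun (g := fun _ => 0) measurableSet_Ioi fun y hy => ?_]
    · simp
    · refine condWeight_of_lt ?_
      by_contra! hle
      exact (hemp.subset (show y ∈ S from ⟨le_of_lt hy, hle⟩)).elim
  have hbdd : BddBelow S := ⟨0, fun y hy => hy.1⟩
  -- The first level at which the tail is at most `e^{-t}`; below it `condWeight` vanishes.
  set y₀ := sInf S with hy₀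
  have hy0 : 0 ≤ y₀ := le_csInf hne fun y hy => hy.1
  have hHy : H y₀ ≤ Real.exp (-t) := by
    by_contra! hlt
    obtain ⟨z, hz, hlt'⟩ := exists_lt_tailProb (totalPayment τ T) y₀ _ hlt
    obtain ⟨y, hy, hyz⟩ := exists_lt_of_csInf_lt hne hz
    exact (hlt'.trans_le (hh.antitone hyz.le)).not_ge hy.2
  have hbelow : ∀ y, 0 < y → y < y₀ → condWeight w t (H y) = 0 := fun y hy hlt => by
    refine condWeight_of_lt ?_
    by_contra! hle
    exact hlt.not_ge (csInf_le hbdd ⟨hy.le, hle⟩)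
  rcases (hh.mem y₀).1.eq_or_lt with h0 | h0
  · rw [condMean, setLIntegral_congr_fun (g := fun _ => 0) measurableSet_Ioi fun y hy => ?_]
    · simp
    · rcases lt_or_ge y y₀ with hlt | hge
      · exact hbelow y hy hlt
      · have : H y = 0 := le_antisymm ((hh.antitone hge).trans h0.ge) (hh.mem y).1
        simp only [this]
        exact hw.condWeight_zero_right t
  have hex : ∃ s, y₀ < T s := by
    have hne' : {ω | (y₀ : EReal) < totalPayment τ T ω}.Nonempty := by
      by_contra hemp
      rw [not_nonempty_iff_eq_empty] at hemp
      rw [hH, tailProb, hemp, measureReal_empty] at h0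
      exact lt_irrefl _ h0
    obtain ⟨ω, hω⟩ := hne'
    simp only [mem_ofPred_eq, totalPayment] at hω
    induction hz : τ ω with
    | top =>
      rw [hz, payAt_top, lt_iSup_iff] at hω
      obtain ⟨s, hs⟩ := hω
      exact ⟨s, EReal.coe_lt_coe_iff.1 hs⟩
    | coe s =>
      rw [hz, payAt_coe] at hω
      exact ⟨s, EReal.coe_lt_coe_iff.1 hω⟩
  -- At this time `τ > s` is the event that the payment exceeds `y₀`, of probability `H y₀ ≤
  -- e^{-t}`. The constraint at `s` therefore weights `H y / H y₀`, which is at least `e^t * H y`.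
  obtain ⟨s, hs1, hs2⟩ := hT.exists_last hy0 hex
  have hset : {ω | (y₀ : EReal) < totalPayment τ T ω} = {ω | (s : ℝ≥0∞) < τ ω} := by
    ext ω
    exact lt_payAt_iff hT.monotone hs1 hs2 (τ ω)
  have hP : P.real {ω | (s : ℝ≥0∞) < τ ω} = H y₀ := by rw [hH, tailProb, hset]
  have hpos : 0 < P {ω | (s : ℝ≥0∞) < τ ω} := by
    rw [← hP, measureReal_def] at h0
    exact (ENNReal.toReal_pos_iff.1 h0).1
  refine le_trans ?_ (hD.distortedMean_le hw hsymm hθ hτ hT hpos)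
  rw [hP, condMean, ← lintegral_indicator measurableSet_Ioi,
    ← lintegral_indicator measurableSet_Ioi]
  have hneq : ∀ᵐ y : ℝ, y ≠ y₀ := by simp [ae_iff, measure_singleton]
  refine lintegral_mono_ae ?_
  filter_upwards [hneq] with y hyne
  rw [indicator_apply]
  split_ifs with hy
  · rcases lt_or_gt_of_ne hyne with hlt | hgt
    · rw [hbelow y hy hlt]; exact zero_le
    · have hle : H y ≤ H y₀ := hh.antitone hgt.le
      rw [indicator_of_mem (show y ∈ Ioi (T s) from hs1.trans_lt hgt),
        condWeight_of_mem ⟨(hh.mem y).1, hle.trans hHy⟩]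
      have h1 : H y / H y₀ ∈ Icc (0 : ℝ) 1 :=
        ⟨div_nonneg (hh.mem y).1 h0.le, div_le_one_of_le₀ hle h0.le⟩
      have h2 : Real.exp t * H y ≤ H y / H y₀ := by
        rw [le_div_iff₀ h0]
        have : Real.exp t * H y₀ ≤ 1 := by
          have := mul_le_mul_of_nonneg_left hHy (Real.exp_pos t).le
          rwa [← Real.exp_add, add_neg_cancel, Real.exp_zero] at this
        nlinarith [(hh.mem y).1]
      exact ENNReal.ofReal_le_ofReal (hw.strictMonoOn.monotoneOn
        ⟨mul_nonneg (Real.exp_pos t).le (hh.mem y).1, h2.trans h1.2⟩ h1 h2)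
  · exact zero_le

/-- A process with sure delivery whose tail function satisfies the conditional bounds is
dynamically individually rational. -/
theorem jointDIR_of_condMean_le (hw : IsWeighting w)
    (hsymm : ∀ p ∈ Icc (0 : ℝ) 1, w p + w (1 - p) = 1) [IsProbabilityMeasure P] (hθ : 0 < θ)
    (hτ : Measurable τ) (hT : IsRegularPayment T) (hfin : P {ω | τ ω = ⊤} = 0) {t₀ : ℝ}
    (hrange : ∀ y, 0 ≤ y → tailProb P (totalPayment τ T) y = 0 ∨
      Real.exp (-t₀) ≤ tailProb P (totalPayment τ T) y)
    (hA : ∀ t ∈ Icc 0 t₀, condMean w (tailProb P (totalPayment τ T)) t ≤ ENNReal.ofReal θ) :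
    JointDIR w w 1 θ P τ T := by
  intro s hs
  have := ProbabilityTheory.cond_isProbabilityMeasure (μ := P) hs.ne'
  set H := tailProb P (totalPayment τ T) with hH
  have hh : IsTail H := isTail_tailProb P _
  have hTs : 0 ≤ T s := by rw [← hT.zero]; exact hT.monotone zero_le
  rw [jointCPT_dynamicNet_nonneg_iff hw hsymm hθ hτ hT hs]
  have hN : ∀ᵐ ω ∂(ProbabilityTheory.cond P {ω | (s : ℝ≥0∞) < τ ω}), ω ∉ {ω | τ ω = ⊤} :=
    ProbabilityTheory.cond_absolutelyContinuous.ae_le (measure_eq_zero_iff_ae_notMem.1 hfin)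
  refine (distortedMean_mono hw
    (Z' := fun ω => payAt T (τ ω) - (T s : EReal)) ?_).trans ?_
  · filter_upwards [hN] with ω hω
    rw [indicator_of_notMem (s := {ω | τ ω = ⊤}) hω]
    simp
  rw [distortedMean_cond hτ hT, ← hH]
  set p := P.real {ω | (s : ℝ≥0∞) < τ ω} with hp
  have hp0 : 0 < p := ENNReal.toReal_pos hs.ne' (measure_ne_top _ _)
  -- Surviving past `s` is at least as likely as paying more than `T s`, so the conditional weights
  -- at `s` are at most those at the `t` with `e^{-t} = H (T s)`. The range condition puts this `t`
  -- in `[0, t₀]` unless the tail has already vanished.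
  have hqp : H (T s) ≤ p :=
    measureReal_mono fun ω hω => lt_of_lt_payAt hT.monotone hω
  rcases hrange (T s) hTs with h0 | h0
  · rw [setLIntegral_congr_fun (g := fun _ => 0) measurableSet_Ioi fun y hy => ?_]
    · simp
    · have : H y = 0 := le_antisymm ((hh.antitone (le_of_lt hy)).trans h0.le) (hh.mem y).1
      simp [this, hw.map_zero]
  · have hq0 : 0 < H (T s) := (Real.exp_pos _).trans_le h0
    obtain ⟨t, ht⟩ := exists_exp_neg_eq hq0
    have ht0 : 0 ≤ t := by
      have := (hh.mem (T s)).2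
      rw [ht, Real.exp_le_one_iff] at this
      linarith
    have htt : t ≤ t₀ := by
      rw [ht] at h0
      linarith [Real.exp_le_exp.1 h0]
    refine le_trans ?_ (hA t ⟨ht0, htt⟩)
    rw [condMean, ← lintegral_indicator measurableSet_Ioi, ← lintegral_indicator measurableSet_Ioi]
    refine lintegral_mono fun y => ?_
    rw [indicator_apply]
    split_ifs with hy
    · have hle : H y ≤ Real.exp (-t) := ht ▸ hh.antitone (le_of_lt hy)
      rw [indicator_of_mem (show y ∈ Ioi (0 : ℝ) from hTs.trans_lt hy),
        condWeight_of_mem ⟨(hh.mem y).1, hle⟩]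
      have e : Real.exp t * H y = H y / H (T s) := by
        rw [ht, Real.exp_neg, div_inv_eq_mul, mul_comm]
      rw [e]
      have h1 : H y / p ≤ H y / H (T s) := div_le_div_of_nonneg_left (hh.mem y).1 hq0 hqp
      have h2 : H y / H (T s) ≤ 1 :=
        div_le_one_of_le₀ (hh.antitone (le_of_lt hy)) hq0.le
      exact ENNReal.ofReal_le_ofReal (hw.strictMonoOn.monotoneOn
        ⟨div_nonneg (hh.mem y).1 hp0.le, h1.trans h2⟩
        ⟨div_nonneg (hh.mem y).1 hq0.le, h2⟩ h1)
    · exact zero_le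

/-- If the conditional bound at time `0` binds, delivery is almost sure. -/
theorem JointDIR.measure_eq_top_eq_zero (hw : IsWeighting w)
    (hsymm : ∀ p ∈ Icc (0 : ℝ) 1, w p + w (1 - p) = 1) [IsProbabilityMeasure P] (hθ : 0 < θ)
    (hτ : Measurable τ) (hT : IsRegularPayment T) (hD : JointDIR w w 1 θ P τ T)
    (h0 : condMean w (tailProb P (totalPayment τ T)) 0 = ENNReal.ofReal θ) :
    P {ω | τ ω = ⊤} = 0 := by
  set A : Set Ω := {ω | ((0 : ℝ≥0) : ℝ≥0∞) < τ ω} with hA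
  have hsub : {ω | τ ω = ⊤} ⊆ A := fun ω hω => by
    have hω' : τ ω = ⊤ := hω
    simp [hA, hω']
  by_cases hs : P A = 0
  · exact measure_mono_null hsub hs
  have hs' : 0 < P A := pos_iff_ne_zero.2 hs
  have := ProbabilityTheory.cond_isProbabilityMeasure (μ := P) hs
  have hh : IsTail (tailProb P (totalPayment τ T)) := isTail_tailProb P _
  have hp0 : 0 < P.real A := ENNReal.toReal_pos hs (measure_ne_top _ _)
  have hp1 : P.real A ≤ 1 := measureReal_le_one
  -- Conditioning on `τ > 0` can only increase the tail, so the payment alone already exhausts `θ`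
  -- and no room is left for the loss of the good.
  have hge : ENNReal.ofReal θ ≤ distortedMean w (ProbabilityTheory.cond P A)
      (fun ω => payAt T (τ ω) - (T 0 : EReal)) := by
    rw [distortedMean_cond hτ hT, hT.zero, ← h0, condMean]
    refine setLIntegral_mono' measurableSet_Ioi fun y hy => ?_
    rw [condWeight_zero_left (hh.mem y)]
    have hle : tailProb P (totalPayment τ T) y ≤ P.real A := by
      refine measureReal_mono fun ω hω => lt_of_lt_payAt (T := T) hT.monotone ?_
      rw [hT.zero]
      exact lt_trans (EReal.coe_lt_coe_iff.2 hy) hω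
    refine ENNReal.ofReal_le_ofReal (hw.strictMonoOn.monotoneOn (hh.mem y)
      ⟨div_nonneg (hh.mem y).1 hp0.le, div_le_one_of_le₀ hle hp0.le⟩ ?_)
    rw [le_div_iff₀ hp0]
    nlinarith [(hh.mem y).1]
  have mN : MeasurableSet {ω | τ ω = ⊤} := measurableSet_eq_fun hτ measurable_const
  have hZ : ∀ᵐ ω ∂(ProbabilityTheory.cond P A), 0 ≤ payAt T (τ ω) - (T 0 : EReal) := by
    refine Eventually.of_forall fun ω => ?_
    have h1 := monotone_payAt hT.monotone (zero_le (a := τ ω))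
    have h2 : payAt T 0 = (T 0 : EReal) := payAt_coe 0
    rw [h2, hT.zero] at h1
    rw [hT.zero]
    simpa using h1
  have hnull := measure_eq_zero_of_distortedMean hw hθ
    ((measurable_totalPayment hτ hT).sub measurable_const) hZ mN hge
    ((jointCPT_dynamicNet_nonneg_iff hw hsymm hθ hτ hT hs').1 (hD 0 hs'))
  rw [ProbabilityTheory.cond_apply (measurableSet_lt_time hτ 0), inter_eq_right.2 hsub] at hnull
  exact (mul_eq_zero.1 hnull).resolve_left (ENNReal.inv_ne_zero.2 (measure_ne_top _ _))

end process

/-! ### The static problem. -/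

section static

universe u

variable {w : ℝ → ℝ}

/-- `μ` is the maximal ratio `p / w(p)`, attained in the open interval only at `p`. -/
structure IsMaxRatio (w : ℝ → ℝ) (μ p : ℝ) : Prop where
  mem : p ∈ Ioo (0 : ℝ) 1
  one_lt : 1 < μ
  eq : μ * w p = p
  le : ∀ x ∈ Icc (0 : ℝ) 1, x ≤ μ * w x
  unique : ∀ x ∈ Ioo (0 : ℝ) 1, μ * w x = x → x = p

/-- The ratio `x / w x` is below one on `(0, 1/2)`, equals one at `1` and exceeds one at `3/4`, so
compactness of `[1/2, 1]` gives an interior maximizer. Two maximizers `b < c` would make the divided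
difference at `0, b, y, c` a positive multiple of `y - μ * w y`, which is nonpositive. -/
theorem IsWeighting.exists_isMaxRatio (hw : IsWeighting w)
    (hsymm : ∀ p ∈ Icc (0 : ℝ) 1, w p + w (1 - p) = 1) : ∃ μ p, IsMaxRatio w μ p := by
  have hsub : Icc (1 / 2 : ℝ) 1 ⊆ Icc 0 1 := Icc_subset_Icc (by norm_num) le_rfl
  have hwpos : ∀ x ∈ Icc (1 / 2 : ℝ) 1, 0 < w x := fun x hx =>
    hw.pos ⟨by linarith [hx.1], hx.2⟩
  have hc : ContinuousOn (fun x => x / w x) (Icc (1 / 2) 1) :=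
    continuousOn_id.div (hw.continuousOn.mono hsub) fun x hx => (hwpos x hx).ne'
  obtain ⟨p, hp, hmax⟩ := isCompact_Icc.exists_isMaxOn (nonempty_Icc.2 (by norm_num)) hc
  set μ := p / w p with hμ
  have h34 := hw.lt_self hsymm (p := 3 / 4) (by norm_num)
  have h34' := hwpos (3 / 4) (by norm_num)
  have h1 : 1 < μ := by
    refine lt_of_lt_of_le ?_ (hmax (show (3 / 4 : ℝ) ∈ Icc (1 / 2) 1 by norm_num))
    simp only
    rwa [one_lt_div h34']
  have hle : ∀ x ∈ Icc (0 : ℝ) 1, x ≤ μ * w x := by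
    intro x hx
    rcases lt_or_ge x (1 / 2) with hlt | hge
    · rcases hx.1.eq_or_lt with rfl | h0
      · rw [hw.map_zero, mul_zero]
      · have := hw.self_lt hsymm ⟨h0, hlt⟩
        nlinarith
    · have := hmax (show x ∈ Icc (1 / 2 : ℝ) 1 from ⟨hge, hx.2⟩)
      exact (div_le_iff₀ (hwpos x ⟨hge, hx.2⟩)).1 this
  have heq : μ * w p = p := div_mul_cancel₀ _ (hwpos p hp).ne'
  have hp0 : 0 < p := by linarith [hp.1]
  have hp1 : p < 1 := by
    refine lt_of_le_of_ne hp.2 fun h => ?_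
    rw [h, hw.map_one] at heq
    linarith
  have huniq : ∀ b c, 0 < b → b < c → c < 1 → μ * w b = b → μ * w c = c → False := by
    intro b c hb hbc hc1 eb ec
    set y := (b + c) / 2 with hy
    have hby : b < y := by linarith
    have hyc : y < c := by linarith
    have hdd := hw.divided_difference_pos hb hby hyc hc1.le
    have hμ0 : 0 < μ := by linarith
    have ew : w b = b / μ := by rw [eq_div_iff hμ0.ne']; linarith
    have ew' : w c = c / μ := by rw [eq_div_iff hμ0.ne']; linarith
    have hy0 : 0 < y := hb.trans hby
    have n1 : y - b ≠ 0 := by linarith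
    have n2 : c - b ≠ 0 := by linarith
    have n3 : c - y ≠ 0 := by linarith
    have hc0 : c ≠ 0 := by linarith
    have e : b / μ / (b * ((y - b) * (c - b))) - w y / (y * ((y - b) * (c - y))) +
        c / μ / (c * ((c - b) * (c - y))) =
        (y - μ * w y) / (μ * (y * ((y - b) * (c - y)))) := by
      field_simp
      ring
    rw [ew, ew', e] at hdd
    have hpos : 0 < μ * (y * ((y - b) * (c - y))) :=
      mul_pos hμ0 (mul_pos hy0 (mul_pos (by linarith) (by linarith)))
    have := (div_pos_iff_of_pos_right hpos).1 hdd
    linarith [hle y ⟨hy0.le, by linarith⟩]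
  refine ⟨μ, p, ⟨hp0, hp1⟩, h1, heq, hle, fun x hx ex => ?_⟩
  rcases lt_trichotomy x p with hlt | rfl | hgt
  · exact (huniq x p hx.1 hlt hp1 ex heq).elim
  · rfl
  · exact (huniq p x hp0 hgt hx.2 heq ex).elim

variable {Ω : Type u} [MeasurableSpace Ω] {P : Measure Ω} {X T : Ω → ℝ} {θ μ p : ℝ}

theorem tailProb_coe (T : Ω → ℝ) (y : ℝ) :
    tailProb P (fun ω => (T ω : EReal)) y = P.real {ω | y < T ω} := by
  simp only [tailProb, EReal.coe_lt_coe_iff]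

theorem IsOffer.jointCPT_nonneg_iff (hw : IsWeighting w)
    (hsymm : ∀ p ∈ Icc (0 : ℝ) 1, w p + w (1 - p) = 1) [IsProbabilityMeasure P] (hθ : 0 < θ)
    (hX : IsOffer X T) :
    0 ≤ jointCPT w w 1 P (staticNet θ X T) ↔
      distortedMean w P (fun ω => (T ω : EReal) + ({ω | X ω = 0}.indicator (fun _ => θ) ω : ℝ)) ≤
        ENNReal.ofReal θ := by
  refine CPTPricing.jointCPT_nonneg_iff hw hsymm hθ hX.measurable_T.coe_real_ereal
    (Eventually.of_forall fun ω => EReal.coe_nonneg.2 (hX.nonneg ω))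
    (measurableSet_eq_fun hX.measurable_X measurable_const) fun ω => ?_
  rw [staticNet, EReal.coe_sub]
  congr 2
  rcases hX.zero_or_one ω with h | h
  · rw [h, indicator_of_notMem (by simpa using h), mul_zero]
  · rw [h, indicator_of_mem (by simp [h]), mul_one]

theorem IsFeasibleOffer.distortedMean_le (hw : IsWeighting w)
    (hsymm : ∀ p ∈ Icc (0 : ℝ) 1, w p + w (1 - p) = 1) [IsProbabilityMeasure P] (hθ : 0 < θ)
    (hX : IsFeasibleOffer w w 1 θ P X T) :
    distortedMean w P (fun ω => (T ω : EReal)) ≤ ENNReal.ofReal θ := by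
  refine (distortedMean_mono hw (Eventually.of_forall fun ω => ?_)).trans
    ((hX.offer.jointCPT_nonneg_iff hw hsymm hθ).1 hX.ir)
  refine le_add_of_nonneg_right ?_
  exact_mod_cast indicator_nonneg (fun _ _ => hθ.le) ω

theorem IsMaxRatio.ofReal_le (hμ : IsMaxRatio w μ p) {x : ℝ}
    (hx : x ∈ Icc (0 : ℝ) 1) :
    ENNReal.ofReal x ≤ ENNReal.ofReal μ * ENNReal.ofReal (w x) := by
  rw [← ENNReal.ofReal_mul (by linarith [hμ.one_lt])]
  exact ENNReal.ofReal_le_ofReal (hμ.le x hx)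

/-- Weak duality with the single multiplier `μ`, by the pointwise bound `x ≤ μ * w x`. -/
theorem IsMaxRatio.staticRevenue_le (hμ : IsMaxRatio w μ p)
    [IsProbabilityMeasure P] (T : Ω → ℝ) :
    staticRevenue P T ≤
      ENNReal.ofReal μ * distortedMean w P (fun ω => (T ω : EReal)) := by
  rw [staticRevenue, revenue_eq_lintegral_tailProb, distortedMean,
    ← lintegral_const_mul' _ _ ENNReal.ofReal_ne_top]
  exact lintegral_mono fun y => hμ.ofReal_le ((isTail_tailProb P _).mem y)

theorem IsFeasibleOffer.staticRevenue_le (hw : IsWeighting w)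
    (hsymm : ∀ p ∈ Icc (0 : ℝ) 1, w p + w (1 - p) = 1) (hμ : IsMaxRatio w μ p)
    [IsProbabilityMeasure P] (hθ : 0 < θ) (hX : IsFeasibleOffer w w 1 θ P X T) :
    staticRevenue P T ≤ ENNReal.ofReal (μ * θ) := by
  rw [ENNReal.ofReal_mul (by linarith [hμ.one_lt])]
  exact (hμ.staticRevenue_le T).trans (mul_le_mul_right (hX.distortedMean_le hw hsymm hθ) _)

theorem measure_eq_one_iff_delivery [IsProbabilityMeasure P] (hX : IsOffer X T) :
    P {ω | X ω = 1} = 1 ↔ P {ω | X ω = 0} = 0 := by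
  have : {ω | X ω = 0} = {ω | X ω = 1}ᶜ := by
    ext ω
    simp only [mem_ofPred_eq, mem_compl_iff]
    rcases hX.zero_or_one ω with h | h <;> simp [h]
  rw [this, prob_compl_eq_zero_iff (measurableSet_eq_fun hX.measurable_X measurable_const)]

theorem lintegral_step {F : ℝ → ℝ≥0∞} {c v : ℝ} (hF : ∀ y, 0 < y →
    F y = ENNReal.ofReal (if y < c then v else 0)) (hv : 0 ≤ v) :
    ∫⁻ y in Ioi (0 : ℝ), F y = ENNReal.ofReal (v * c) := by
  have : ∫⁻ y in Ioi (0 : ℝ), F y = ∫⁻ _ in Ioo 0 c, ENNReal.ofReal v := by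
    rw [← lintegral_indicator measurableSet_Ioi, ← lintegral_indicator measurableSet_Ioo]
    refine lintegral_congr fun y => ?_
    by_cases h0 : 0 < y
    · rw [indicator_of_mem (by exact h0), hF y h0]
      by_cases hc : y < c
      · rw [if_pos hc, indicator_of_mem (by exact ⟨h0, hc⟩)]
      · rw [if_neg hc, indicator_of_notMem fun h => hc h.2, ENNReal.ofReal_zero]
    · rw [indicator_of_notMem (by exact h0), indicator_of_notMem fun h => h0 h.1]
  rw [this, setLIntegral_const, Real.volume_Ioo, sub_zero, ENNReal.ofReal_mul hv]

theorem IsMaxRatio.feasible_of_tail (hw : IsWeighting w)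
    (hsymm : ∀ p ∈ Icc (0 : ℝ) 1, w p + w (1 - p) = 1) (hμ : IsMaxRatio w μ p)
    [IsProbabilityMeasure P] (hθ : 0 < θ) (hX : IsOffer X T) (h1 : P {ω | X ω = 1} = 1)
    (hT : ∀ y : ℝ, 0 ≤ y → P.real {ω | y < T ω} = if y < μ * θ / p then p else 0) :
    IsFeasibleOffer w w 1 θ P X T ∧ staticRevenue P T = ENNReal.ofReal (μ * θ) := by
  have hp := hμ.mem
  refine ⟨⟨hX, ?_⟩, ?_⟩
  · rw [hX.jointCPT_nonneg_iff hw hsymm hθ]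
    refine (distortedMean_mono hw (Z' := fun ω => (T ω : EReal)) ?_).trans ?_
    · filter_upwards [measure_eq_zero_iff_ae_notMem.1 ((measure_eq_one_iff_delivery hX).1 h1)]
        with ω hω
      rw [indicator_of_notMem (s := {ω | X ω = 0}) hω]
      simp
    · rw [distortedMean, lintegral_step (c := μ * θ / p) (v := w p) (fun y hy => ?_)
        (hw.nonneg ⟨hp.1.le, hp.2.le⟩)]
      · refine ENNReal.ofReal_le_ofReal (le_of_eq ?_)
        have hp0 := hp.1.ne'
        have e := hμ.eq
        field_simp
        linear_combination e
      · simp only [EReal.coe_lt_coe_iff]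
        rw [hT y hy.le]
        split_ifs
        · rfl
        · rw [hw.map_zero]
  · rw [staticRevenue, revenue_eq_lintegral_tailProb,
      lintegral_step (c := μ * θ / p) (v := p) (fun y hy => ?_) hp.1.le]
    · congr 1
      have hp0 := hp.1.ne'
      field_simp
    · rw [tailProb_coe, hT y hy.le]

/-- The good is always delivered: with probability `p` at price `μ * θ / p`, and otherwise free. -/
theorem IsMaxRatio.exists_offer (hw : IsWeighting w)
    (hsymm : ∀ p ∈ Icc (0 : ℝ) 1, w p + w (1 - p) = 1) (hμ : IsMaxRatio w μ p) (hθ : 0 < θ) :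
    ENNReal.ofReal (μ * θ) ∈ feasibleRevenues w w 1 θ := by
  have hp := hμ.mem
  have hc : 0 < μ * θ / p := div_pos (mul_pos (by linarith [hμ.one_lt]) hθ) hp.1
  set Q : Measure Bool := ENNReal.ofReal p • Measure.dirac true +
    ENNReal.ofReal (1 - p) • Measure.dirac false with hQ
  have hprob : IsProbabilityMeasure Q := ⟨by
    simp [hQ, ← ENNReal.ofReal_add hp.1.le (sub_nonneg.2 hp.2.le)]⟩
  set T : Bool → ℝ := fun b => if b then μ * θ / p else 0 with hT
  have hoff : IsOffer (fun _ => 1) T := by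
    refine ⟨measurable_const, measurable_of_countable _, fun _ => Or.inr rfl, fun b => ?_⟩
    cases b
    · simp [hT]
    · simpa [hT] using hc.le
  refine ⟨Bool, inferInstance, Q, hprob, fun _ => 1, T,
    hμ.feasible_of_tail hw hsymm hθ hoff ?_ fun y hy => ?_⟩
  · have : {_ω : Bool | (1 : ℝ) = 1} = univ := eq_univ_of_forall fun _ => rfl
    rw [this]
    exact measure_univ
  split_ifs with h
  · have : {b | y < T b} = {true} := by
      ext b
      cases b <;> simp [hT, hy, h]
    rw [this, measureReal_def]
    simp [hQ, hp.1.le]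
  · have : {b | y < T b} = ∅ := by
      ext b
      cases b <;> simp [hT, hy, not_lt.1 h]
    rw [this, measureReal_empty]

/-- Optimality forces equality in `x ≤ μ * w x` at almost every level; since `μ > 1` excludes the
value one, the tail is `0` or `p`. A distorted mean equal to `θ` fixes the length of its support,
and right continuity settles every level. -/
theorem IsMaxRatio.tail_of_le (hw : IsWeighting w)
    (hsymm : ∀ p ∈ Icc (0 : ℝ) 1, w p + w (1 - p) = 1) (hμ : IsMaxRatio w μ p)
    [IsProbabilityMeasure P] (hθ : 0 < θ) (hX : IsFeasibleOffer w w 1 θ P X T)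
    (hrev : ENNReal.ofReal (μ * θ) ≤ staticRevenue P T) :
    P {ω | X ω = 1} = 1 ∧
      ∀ y : ℝ, 0 ≤ y → P.real {ω | y < T ω} = if y < μ * θ / p then p else 0 := by
  have hp := hμ.mem
  have hμ0 : 0 < μ := by linarith [hμ.one_lt]
  set H := tailProb P (fun ω => (T ω : EReal)) with hH
  have hh : IsTail H := isTail_tailProb P _
  have hd := hX.distortedMean_le hw hsymm hθ
  have hle := hμ.staticRevenue_le (P := P) T
  rw [ENNReal.ofReal_mul hμ0.le] at hrev
  have hd' : ENNReal.ofReal θ ≤ distortedMean w P (fun ω => (T ω : EReal)) :=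
    (ENNReal.mul_le_mul_iff_right (by simpa using hμ0) ENNReal.ofReal_ne_top).1 (hrev.trans hle)
  have hde := le_antisymm hd hd'
  refine ⟨?_, ?_⟩
  · rw [measure_eq_one_iff_delivery hX.offer]
    exact measure_eq_zero_of_distortedMean hw hθ hX.offer.measurable_T.coe_real_ereal
      (Eventually.of_forall fun ω => EReal.coe_nonneg.2 (hX.offer.nonneg ω))
      (measurableSet_eq_fun hX.offer.measurable_X measurable_const) hd'
      ((hX.offer.jointCPT_nonneg_iff hw hsymm hθ).1 hX.ir)
  have hae : ∀ᵐ y, y ∈ Ioi (0 : ℝ) → H y = 0 ∨ H y = p := by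
    have mH : Measurable fun y => ENNReal.ofReal μ * ENNReal.ofReal (w (H y)) :=
      (hw.antitone_distorted (P := P) (fun ω => (T ω : EReal))).measurable.const_mul _
    have hfin : ∫⁻ y in Ioi (0 : ℝ), ENNReal.ofReal (H y) ≠ ∞ := by
      rw [hH, ← revenue_eq_lintegral_tailProb]
      refine (hle.trans_lt ?_).ne
      rw [hde]
      exact ENNReal.mul_lt_top ENNReal.ofReal_lt_top ENNReal.ofReal_lt_top
    have := ae_eq_of_ae_le_of_lintegral_le (μ := volume.restrict (Ioi (0 : ℝ)))
      (Eventually.of_forall fun y => hμ.ofReal_le (hh.mem y)) hfin mH.aemeasurable ?_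
    · rw [EventuallyEq, ae_restrict_iff' measurableSet_Ioi] at this
      filter_upwards [this] with y hy hy0
      have e := hy hy0
      rw [← ENNReal.ofReal_mul hμ0.le, ENNReal.ofReal_eq_ofReal_iff (hh.mem y).1
        (mul_nonneg hμ0.le (hw.nonneg (hh.mem y)))] at e
      rcases (hh.mem y).1.eq_or_lt with h0 | h0
      · exact Or.inl h0.symm
      rcases (hh.mem y).2.eq_or_lt with h1 | h1
      · rw [h1, hw.map_one] at e
        linarith [hμ.one_lt]
      · exact Or.inr (hμ.unique _ ⟨h0, h1⟩ e.symm)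
    · rw [lintegral_const_mul' _ _ ENNReal.ofReal_ne_top]
      have e1 : ∫⁻ y in Ioi (0 : ℝ), ENNReal.ofReal (w (H y)) = ENNReal.ofReal θ := hde
      rw [e1]
      refine hrev.trans (le_of_eq ?_)
      rw [staticRevenue, revenue_eq_lintegral_tailProb]
  have hwp : 0 < w p := hw.pos ⟨hp.1, hp.2.le⟩
  have hvol : volume {y | 0 < y ∧ 0 < H y} = ENNReal.ofReal (μ * θ / p) := by
    have mS : MeasurableSet {y | 0 < H y} := measurableSet_lt measurable_const hh.measurable
    have e1 : ∫⁻ y in Ioi (0 : ℝ), ENNReal.ofReal (w (H y)) =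
        ENNReal.ofReal (w p) * volume {y | 0 < y ∧ 0 < H y} := by
      have : ∫⁻ y in Ioi (0 : ℝ), {y | 0 < H y}.indicator (fun _ => ENNReal.ofReal (w p)) y =
          ENNReal.ofReal (w p) * volume {y | 0 < y ∧ 0 < H y} := by
        rw [lintegral_indicator_const mS, Measure.restrict_apply mS]
        congr 2
        ext y
        simp [and_comm]
      rw [← this]
      refine lintegral_congr_ae ((ae_restrict_iff' measurableSet_Ioi).2 ?_)
      filter_upwards [hae] with y hy hy0
      rcases hy hy0 with h0 | h0
      · rw [indicator_of_notMem (by simp [h0]), h0, hw.map_zero, ENNReal.ofReal_zero]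
      · rw [indicator_of_mem (by simp [h0, hp.1]), h0]
    have e2 : ∫⁻ y in Ioi (0 : ℝ), ENNReal.ofReal (w (H y)) = ENNReal.ofReal θ := hde
    rw [e2] at e1
    have e3 : ENNReal.ofReal θ = ENNReal.ofReal (w p) * ENNReal.ofReal (μ * θ / p) := by
      rw [← ENNReal.ofReal_mul hwp.le]
      congr 1
      have hp0 := hp.1.ne'
      have e := hμ.eq
      field_simp
      linear_combination -e
    rw [e3] at e1
    exact ((ENNReal.mul_right_inj (by simpa using hwp) ENNReal.ofReal_ne_top).1 e1).symm
  have hc : 0 < μ * θ / p := div_pos (mul_pos hμ0 hθ) hp.1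
  have hzero : ∀ y, μ * θ / p ≤ y → H y = 0 := by
    intro y hy
    by_contra hne
    obtain ⟨z, hz, hz'⟩ := exists_lt_tailProb (P := P) (fun ω => (T ω : EReal)) y 0
      (lt_of_le_of_ne (hh.mem y).1 (Ne.symm hne))
    have hsub : Ioc 0 z ⊆ {y | 0 < y ∧ 0 < H y} := fun u hu =>
      ⟨hu.1, lt_of_lt_of_le hz' (hh.antitone hu.2)⟩
    have := measure_mono (μ := volume) hsub
    rw [hvol, Real.volume_Ioc, sub_zero, ENNReal.ofReal_le_ofReal_iff hc.le] at this
    linarith [hz.lt]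
  have hpos : ∀ y, y < μ * θ / p → 0 < H y := by
    intro y hy
    by_contra! hle
    have hsub : {y | 0 < y ∧ 0 < H y} ⊆ Ioo 0 y := fun u hu => ⟨hu.1, by
      by_contra! hyu
      exact hu.2.not_ge ((hh.antitone hyu).trans hle)⟩
    have := measure_mono (μ := volume) hsub
    rw [hvol, Real.volume_Ioo, sub_zero, ENNReal.ofReal_le_ofReal_iff'] at this
    rcases this with h | h <;> linarith
  intro y hy
  rw [← tailProb_coe, ← hH]
  split_ifs with hyc
  · have key : ∀ b, y < b → ∃ x ∈ Ioo y b, H x = 0 ∨ H x = p := by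
      intro b hb
      have hv : volume (Ioo y b) ≠ 0 := by simpa [Real.volume_Ioo] using hb
      obtain ⟨x, hx, hx'⟩ := ((frequently_ae_mem_iff.2 hv).and_eventually hae).exists
      exact ⟨x, hx, hx' (hy.trans_lt hx.1)⟩
    refine le_antisymm ?_ ?_
    · by_contra! hlt
      obtain ⟨z, hz, hz'⟩ := exists_lt_tailProb (P := P) (fun ω => (T ω : EReal)) y p hlt
      obtain ⟨x, hx, hx'⟩ := key z hz
      have : p < H x := hz'.trans_le (hh.antitone hx.2.le)
      rcases hx' with h | h <;> linarith [hp.1]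
    · obtain ⟨x, hx, hx'⟩ := key _ hyc
      rcases hx' with h | h
      · exact absurd h (hpos x hx.2).ne'
      · rw [← h]; exact hh.antitone hx.1.le
  · exact hzero y (not_lt.1 hyc)

end static

/-! ### The candidate process with an exponential delivery time. -/

section star

universe u

variable {w r : ℝ → ℝ} {t₀ θ : ℝ}

/-- The optimal cumulative payment function, written with the renewal density. -/
noncomputable def starPayment (r : ℝ → ℝ) (t₀ θ : ℝ) : ℝ≥0 → ℝ :=
  paymentStar 1 θ t₀ fun s => r (t₀ - s)

/-- The flow payments up to time `a` of the optimal payment function. -/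
noncomputable def starFlow (r : ℝ → ℝ) (t₀ θ a : ℝ) : ℝ :=
  θ * ∫ s in (0 : ℝ)..a, r (t₀ - s)

theorem starPayment_of_le {t : ℝ≥0} (ht : (t : ℝ) ≤ t₀) :
    starPayment r t₀ θ t = starFlow r t₀ θ t := by
  rw [starPayment, paymentStar, if_neg ht.not_gt, min_eq_left ht, div_one, zero_add, starFlow]

theorem starPayment_of_lt {t : ℝ≥0} (ht : t₀ < t) :
    starPayment r t₀ θ t = θ * (1 + ∫ s in (0 : ℝ)..t₀, r (t₀ - s)) := by
  rw [starPayment, paymentStar, if_pos ht, min_eq_right ht.le, div_one]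

theorem intervalIntegrable_flow (hr : IsRenewalDensity w r) (ht₀ : IsStoppingHorizon r t₀) :
    IntervalIntegrable (fun s => r (t₀ - s)) volume 0 t₀ := by
  have := (hr.intervalIntegrable_of_le ht₀.mem_Icc).comp_sub_left t₀
  rw [sub_zero, sub_self] at this
  exact this.symm

theorem isRegularPayment_starPayment (hr : IsRenewalDensity w r)
    (ht₀ : IsStoppingHorizon r t₀) (hθ : 0 < θ) : IsRegularPayment (starPayment r t₀ θ) := by
  have hi := (intervalIntegrable_iff_integrableOn_Ioc_of_le ht₀.pos.le).1
    (intervalIntegrable_flow hr ht₀)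
  set φ : ℝ → ℝ := (Ioc 0 t₀).indicator fun s => θ * r (t₀ - s) with hφ
  have hint : Integrable φ :=
    (integrable_indicator_iff measurableSet_Ioc).2 (Integrable.const_mul hi θ)
  -- The only lump sum is `θ` at `t₀`, listed under index `0`; the other entries of the countable
  -- family are zero.
  refine ⟨φ, fun _ => t₀, fun i => if i = 0 then θ else 0,
    fun t => indicator_nonneg (fun s _ => mul_nonneg hθ.le (hr.nonneg _)) t,
    fun t => hint.intervalIntegrable, fun _ => ht₀.pos.le, fun i => ?_, fun t => ?_, fun t => ?_⟩
  · dsimp only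
    split_ifs
    · exact hθ.le
    · exact le_rfl
  · refine summable_of_ne_finset_zero (s := {0}) fun i hi => ?_
    rw [Finset.mem_singleton] at hi
    simp [hi]
  · have e1 : ∫ s in (0 : ℝ)..t, φ s = θ * ∫ s in (0 : ℝ)..(min (t : ℝ) t₀), r (t₀ - s) := by
      rw [intervalIntegral.integral_of_le t.coe_nonneg, hφ, setIntegral_indicator measurableSet_Ioc,
        Ioc_inter_Ioc, max_self, integral_const_mul,
        intervalIntegral.integral_of_le (le_min t.coe_nonneg ht₀.pos.le)]
    rw [e1, tsum_eq_single 0 fun i hi => by simp [hi], starPayment, paymentStar]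
    simp only [if_true, div_one]
    split_ifs <;> ring

theorem starFlow_mono (hr : IsRenewalDensity w r) (ht₀ : IsStoppingHorizon r t₀) (hθ : 0 < θ)
    {a b : ℝ} (ha : 0 ≤ a) (hab : a ≤ b) (hb : b ≤ t₀) :
    starFlow r t₀ θ a ≤ starFlow r t₀ θ b := by
  refine mul_le_mul_of_nonneg_left (intervalIntegral.integral_mono_interval le_rfl ha hab
    (Eventually.of_forall fun s => hr.nonneg _) ?_) hθ.le
  refine (intervalIntegrable_flow hr ht₀).mono_set ?_
  rw [uIcc_of_le (ha.trans hab), uIcc_of_le (ha.trans (hab.trans hb))]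
  exact Icc_subset_Icc le_rfl hb

theorem exists_starFlow_lt (hr : IsRenewalDensity w r) (ht₀ : IsStoppingHorizon r t₀)
    {a y : ℝ} (ha : a ∈ Ico 0 t₀) (hy : starFlow r t₀ θ a < y) :
    ∃ b ∈ Ioo a t₀, starFlow r t₀ θ b < y := by
  have hc := intervalIntegral.continuousOn_primitive_interval
    ((intervalIntegrable_iff' (by simp)).1 (intervalIntegrable_flow hr ht₀))
  rw [uIcc_of_le ht₀.pos.le] at hc
  have h1 : Tendsto (starFlow r t₀ θ) (𝓝[>] a) (𝓝 (starFlow r t₀ θ a)) := by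
    refine ((hc.const_smul θ) a ⟨ha.1, ha.2.le⟩).mono_left ?_
    rw [← nhdsWithin_Ioc_eq_nhdsGT ha.2]
    exact nhdsWithin_mono _ fun x hx => ⟨ha.1.trans hx.1.le, hx.2⟩
  obtain ⟨b, hb, hb'⟩ := ((h1.eventually_lt_const hy).and (Ioo_mem_nhdsGT ha.2)).exists
  exact ⟨b, hb', hb⟩

variable {Ω : Type u} [MeasurableSpace Ω] {P : Measure Ω} {τ : Ω → ℝ≥0∞}

theorem IsExponentialTime.measureReal (hτ : IsExponentialTime P τ) (t : ℝ≥0) :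
    P.real {ω | (t : ℝ≥0∞) < τ ω} = Real.exp (-t) := by
  rw [measureReal_def, hτ.2, ENNReal.toReal_ofReal (Real.exp_pos _).le]

theorem IsExponentialTime.hasRegularCDF [IsProbabilityMeasure P] (hτ : IsExponentialTime P τ) :
    HasRegularCDF P τ := by
  refine ⟨fun s => Real.exp (-s), fun _ => 0, fun _ => 0, fun t => (Real.exp_pos _).le, ?_,
    fun _ => le_rfl, fun _ => le_rfl, summable_zero, fun t => ?_⟩
  · rw [integrableOn_Ici_iff_integrableOn_Ioi]
    exact integrableOn_exp_neg_Ioi 0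
  · have e : {ω | τ ω ≤ t} = {ω | (t : ℝ≥0∞) < τ ω}ᶜ := by
      ext ω
      simp
    rw [e, probReal_compl_eq_one_sub (measurableSet_lt_time hτ.1 t), hτ.measureReal]
    simp [intervalIntegral.integral_comp_neg fun s => Real.exp s]

theorem IsExponentialTime.measure_top (hτ : IsExponentialTime P τ) : P {ω | τ ω = ⊤} = 0 := by
  have h : Tendsto (fun n : ℕ => ENNReal.ofReal (Real.exp (-(n : ℝ)))) atTop (𝓝 0) := by
    have := ENNReal.tendsto_ofReal
      (Real.tendsto_exp_neg_atTop_nhds_zero.comp tendsto_natCast_atTop_atTop)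
    rwa [ENNReal.ofReal_zero] at this
  refine le_antisymm (ge_of_tendsto' h fun n => ?_) zero_le
  have := hτ.2 n
  rw [NNReal.coe_natCast] at this
  rw [← this]
  refine measure_mono fun ω hω => ?_
  have hω' : τ ω = ⊤ := hω
  simp [hω']

theorem IsExponentialTime.isPricingProcess [IsProbabilityMeasure P]
    (hr : IsRenewalDensity w r) (ht₀ : IsStoppingHorizon r t₀) (hθ : 0 < θ)
    (hτ : IsExponentialTime P τ) : IsPricingProcess P τ (starPayment r t₀ θ) :=
  ⟨hτ.1, hτ.hasRegularCDF, isRegularPayment_starPayment hr ht₀ hθ⟩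

theorem starPayment_le (hr : IsRenewalDensity w r)
    (ht₀ : IsStoppingHorizon r t₀) (hθ : 0 < θ) (t : ℝ≥0) :
    starPayment r t₀ θ t ≤ θ * (1 + ∫ s in (0 : ℝ)..t₀, r (t₀ - s)) := by
  rcases le_or_gt (t : ℝ) t₀ with h | h
  · rw [starPayment_of_le h]
    refine (starFlow_mono hr ht₀ hθ t.2 h le_rfl).trans ?_
    rw [starFlow]
    linarith
  · rw [starPayment_of_lt h]

theorem tail_starPayment_of_total_le (hr : IsRenewalDensity w r)
    (ht₀ : IsStoppingHorizon r t₀) (hθ : 0 < θ) {y : ℝ}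
    (hy : θ * (1 + ∫ s in (0 : ℝ)..t₀, r (t₀ - s)) ≤ y) :
    tailProb P (totalPayment τ (starPayment r t₀ θ)) y = 0 := by
  have : {ω | (y : EReal) < totalPayment τ (starPayment r t₀ θ) ω} = ∅ := by
    refine eq_empty_iff_forall_notMem.2 fun ω hω => ?_
    have h1 := monotone_payAt (isRegularPayment_starPayment hr ht₀ hθ).monotone
      (le_top (a := τ ω))
    rw [payAt_top] at h1
    have h2 := hω.trans_le h1
    obtain ⟨s, hs⟩ := lt_iSup_iff.1 h2
    exact (EReal.coe_lt_coe_iff.1 hs).not_ge ((starPayment_le hr ht₀ hθ s).trans hy)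
  rw [tailProb, this, measureReal_empty]

section tail

variable [IsProbabilityMeasure P]

theorem IsExponentialTime.exp_le_tail (hr : IsRenewalDensity w r)
    (ht₀ : IsStoppingHorizon r t₀) (hθ : 0 < θ) (hτ : IsExponentialTime P τ) {a y : ℝ}
    (ha : a ∈ Icc 0 t₀) (hy : y < starFlow r t₀ θ a) :
    Real.exp (-a) ≤ tailProb P (totalPayment τ (starPayment r t₀ θ)) y := by
  have : P.real {ω | (NNReal.mk a ha.1 : ℝ≥0∞) < τ ω} = Real.exp (-a) :=
    hτ.measureReal _
  rw [← this]
  refine measureReal_mono fun ω hω => ?_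
  have h1 := monotone_payAt (isRegularPayment_starPayment hr ht₀ hθ).monotone (le_of_lt hω)
  rw [payAt_coe, starPayment_of_le (by exact ha.2)] at h1
  exact lt_of_lt_of_le (EReal.coe_lt_coe_iff.2 hy) h1

theorem IsExponentialTime.tail_lt_exp (hr : IsRenewalDensity w r)
    (ht₀ : IsStoppingHorizon r t₀) (hθ : 0 < θ) (hτ : IsExponentialTime P τ) {a y : ℝ}
    (ha : a ∈ Ico 0 t₀) (hy : starFlow r t₀ θ a < y) :
    tailProb P (totalPayment τ (starPayment r t₀ θ)) y < Real.exp (-a) := by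
  obtain ⟨b, hb, hby⟩ := exists_starFlow_lt hr ht₀ ha hy
  have hb0 : 0 ≤ b := ha.1.trans hb.1.le
  refine lt_of_le_of_lt (b := Real.exp (-b)) ?_ (Real.exp_lt_exp.2 (neg_lt_neg hb.1))
  have : P.real {ω | (NNReal.mk b hb0 : ℝ≥0∞) < τ ω} = Real.exp (-b) :=
    hτ.measureReal _
  rw [← this]
  refine measureReal_mono fun ω hω => ?_
  refine lt_of_lt_payAt (isRegularPayment_starPayment hr ht₀ hθ).monotone
    (lt_trans (EReal.coe_lt_coe_iff.2 ?_) hω)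
  rw [starPayment_of_le (by exact hb.2.le)]
  exact hby

theorem IsExponentialTime.exp_le_tail_of_lt_total (hr : IsRenewalDensity w r)
    (ht₀ : IsStoppingHorizon r t₀) (hθ : 0 < θ) (hτ : IsExponentialTime P τ) {y : ℝ}
    (hy : y < θ * (1 + ∫ s in (0 : ℝ)..t₀, r (t₀ - s))) :
    Real.exp (-t₀) ≤ tailProb P (totalPayment τ (starPayment r t₀ θ)) y := by
  have : P.real {ω | (NNReal.mk t₀ ht₀.pos.le : ℝ≥0∞) < τ ω} = Real.exp (-t₀) :=
    hτ.measureReal _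
  rw [← this]
  refine measureReal_mono fun ω hω => ?_
  obtain ⟨u, hu1, hu2⟩ := ENNReal.lt_iff_exists_nnreal_btwn.1 hω
  have h1 := monotone_payAt (isRegularPayment_starPayment hr ht₀ hθ).monotone hu2.le
  have hu3 : t₀ < u := by
    have : (⟨t₀, ht₀.pos.le⟩ : ℝ≥0) < u := by exact_mod_cast hu1
    exact this
  rw [payAt_coe, starPayment_of_lt hu3] at h1
  exact lt_of_lt_of_le (EReal.coe_lt_coe_iff.2 hy) h1

theorem IsExponentialTime.tail_range (hr : IsRenewalDensity w r)
    (ht₀ : IsStoppingHorizon r t₀) (hθ : 0 < θ) (hτ : IsExponentialTime P τ) (y : ℝ) :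
    tailProb P (totalPayment τ (starPayment r t₀ θ)) y = 0 ∨
      Real.exp (-t₀) ≤ tailProb P (totalPayment τ (starPayment r t₀ θ)) y := by
  rcases lt_or_ge y (θ * (1 + ∫ s in (0 : ℝ)..t₀, r (t₀ - s))) with h | h
  · exact Or.inr (hτ.exp_le_tail_of_lt_total hr ht₀ hθ h)
  · exact Or.inl (tail_starPayment_of_total_le hr ht₀ hθ h)

/-- Up to an endpoint, the levels where the tail is at least `e^{-a}` form the interval from `0` to
the flow paid by time `a`, so the tail has the quantiles required by `condMean_eq_of_volume`. -/
theorem IsExponentialTime.condMean_eq (hw : IsWeighting w) (hr : IsRenewalDensity w r)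
    (ht₀ : IsStoppingHorizon r t₀) (hθ : 0 < θ) (hτ : IsExponentialTime P τ) {t : ℝ}
    (ht : t ∈ Icc 0 t₀) :
    condMean w (tailProb P (totalPayment τ (starPayment r t₀ θ))) t = ENNReal.ofReal θ := by
  refine condMean_eq_of_volume hw hr ht₀ hθ (isTail_tailProb P _)
    (fun y _ => hτ.tail_range hr ht₀ hθ y) (fun a ha => ?_) ?_ ht
  · refine le_antisymm ?_ ?_
    · have hsub : {y | 0 < y ∧ Real.exp (-a) ≤
          tailProb P (totalPayment τ (starPayment r t₀ θ)) y} ⊆ Ioc 0 (starFlow r t₀ θ a) :=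
        fun y hy => ⟨hy.1, by
          by_contra! hlt
          exact (hτ.tail_lt_exp hr ht₀ hθ ha hlt).not_ge hy.2⟩
      have := measure_mono (μ := volume) hsub
      rwa [Real.volume_Ioc, sub_zero] at this
    · have hsub : Ioo 0 (starFlow r t₀ θ a) ⊆ {y | 0 < y ∧ Real.exp (-a) ≤
          tailProb P (totalPayment τ (starPayment r t₀ θ)) y} :=
        fun y hy => ⟨hy.1, hτ.exp_le_tail hr ht₀ hθ ⟨ha.1, ha.2.le⟩ hy.2⟩
      have := measure_mono (μ := volume) hsub
      rwa [Real.volume_Ioo, sub_zero] at this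
  · have : {y | 0 < y ∧ 0 < tailProb P (totalPayment τ (starPayment r t₀ θ)) y} =
        Ioo 0 (θ * (1 + ∫ s in (0 : ℝ)..t₀, r (t₀ - s))) := by
      ext y
      refine and_congr_right fun _ => ⟨fun h => ?_, fun h => ?_⟩
      · by_contra! hle
        exact h.ne' (tail_starPayment_of_total_le hr ht₀ hθ hle)
      · exact (Real.exp_pos _).trans_le (hτ.exp_le_tail_of_lt_total hr ht₀ hθ h)
    rw [this, Real.volume_Ioo, sub_zero]

theorem IsExponentialTime.jointDIR (hw : IsWeighting w)
    (hsymm : ∀ p ∈ Icc (0 : ℝ) 1, w p + w (1 - p) = 1) (hr : IsRenewalDensity w r)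
    (ht₀ : IsStoppingHorizon r t₀) (hθ : 0 < θ) (hτ : IsExponentialTime P τ) :
    JointDIR w w 1 θ P τ (starPayment r t₀ θ) :=
  jointDIR_of_condMean_le hw hsymm hθ hτ.1 (isRegularPayment_starPayment hr ht₀ hθ)
    hτ.measure_top (fun y _ => hτ.tail_range hr ht₀ hθ y)
    fun _ ht => (hτ.condMean_eq hw hr ht₀ hθ ht).le

theorem IsExponentialTime.revenue_eq (hw : IsWeighting w) (hr : IsRenewalDensity w r)
    (ht₀ : IsStoppingHorizon r t₀) (hθ : 0 < θ) (hτ : IsExponentialTime P τ) :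
    revenue P (totalPayment τ (starPayment r t₀ θ)) =
      ENNReal.ofReal θ * multiplierMass r t₀ := by
  rw [revenue_eq_lintegral_tailProb]
  exact lintegral_tail_eq hw hr ht₀ (isTail_tailProb P _)
    (fun y _ => hτ.tail_range hr ht₀ hθ y) fun t ht => hτ.condMean_eq hw hr ht₀ hθ ht

theorem JointDIR.revenue_le (hw : IsWeighting w)
    (hsymm : ∀ p ∈ Icc (0 : ℝ) 1, w p + w (1 - p) = 1) (hr : IsRenewalDensity w r)
    (ht₀ : IsStoppingHorizon r t₀) (hθ : 0 < θ) {T : ℝ≥0 → ℝ} (hT : IsPricingProcess P τ T)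
    (hD : JointDIR w w 1 θ P τ T) :
    revenue P (totalPayment τ T) ≤ ENNReal.ofReal θ * multiplierMass r t₀ := by
  rw [revenue_eq_lintegral_tailProb]
  exact lintegral_tail_le hw hr ht₀ (isTail_tailProb P _) fun t _ =>
    hD.condMean_le hw hsymm hθ hT.measurable hT.regular_payment t

theorem IsExponentialTime.isOptimalProcess (hw : IsWeighting w)
    (hsymm : ∀ p ∈ Icc (0 : ℝ) 1, w p + w (1 - p) = 1) (hr : IsRenewalDensity w r)
    (ht₀ : IsStoppingHorizon r t₀) (hθ : 0 < θ) (hτ : IsExponentialTime P τ) :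
    IsOptimalProcess w w 1 θ P τ (starPayment r t₀ θ) := by
  refine ⟨hτ.isPricingProcess hr ht₀ hθ, hτ.jointDIR hw hsymm hr ht₀ hθ, ?_⟩
  intro Ω' _ P' _ τ' T' hT hD
  rw [hτ.revenue_eq hw hr ht₀ hθ]
  exact hD.revenue_le hw hsymm hr ht₀ hθ hT

end tail

end star

/-! ### Attainment of the bound and characterization of all optimal processes. -/

/-- Minus the logarithm of a uniform variable is an exponential time. -/
theorem exists_isExponentialTime : ∃ (P : Measure ℝ) (τ : ℝ → ℝ≥0∞),
    IsProbabilityMeasure P ∧ IsExponentialTime P τ := by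
  refine ⟨volume.restrict (Ioo 0 1), fun x => ENNReal.ofReal (-Real.log x), ⟨by simp⟩,
    (Real.measurable_log.neg).ennreal_ofReal, fun t => ?_⟩
  have hm : MeasurableSet {x : ℝ | (t : ℝ≥0∞) < ENNReal.ofReal (-Real.log x)} :=
    measurableSet_lt measurable_const (Real.measurable_log.neg).ennreal_ofReal
  have e : {x : ℝ | (t : ℝ≥0∞) < ENNReal.ofReal (-Real.log x)} ∩ Ioo 0 1 =
      Ioo 0 (Real.exp (-t)) := by
    ext x
    simp only [mem_inter_iff, mem_ofPred_eq, mem_Ioo]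
    have key : 0 < x → ((t : ℝ≥0∞) < ENNReal.ofReal (-Real.log x) ↔ x < Real.exp (-t)) := by
      intro hx
      rw [← ENNReal.ofReal_coe_nnreal, ENNReal.ofReal_lt_ofReal_iff_of_nonneg t.coe_nonneg,
        ← Real.log_lt_iff_lt_exp hx]
      constructor <;> intro h <;> linarith
    constructor
    · rintro ⟨h1, h2, -⟩
      exact ⟨h2, (key h2).1 h1⟩
    · rintro ⟨h1, h2⟩
      exact ⟨(key h1).2 h2, h1, h2.trans_le (Real.exp_le_one_iff.2 (by simp))⟩
  rw [Measure.restrict_apply hm, e, Real.volume_Ioo, sub_zero]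

section characterization

universe u v

variable {w r : ℝ → ℝ} {t₀ θ : ℝ} {Ω : Type u} [MeasurableSpace Ω] {P : Measure Ω}
  {Ω₀ : Type v} [MeasurableSpace Ω₀] {P₀ : Measure Ω₀} {τ : Ω → ℝ≥0∞} {τ₀ : Ω₀ → ℝ≥0∞}
  [IsProbabilityMeasure P] [IsProbabilityMeasure P₀]

theorem measure_le_eq_iff_tailProb {Z : Ω → EReal} {Z₀ : Ω₀ → EReal} (mZ : Measurable Z)
    (mZ₀ : Measurable Z₀) (y : ℝ) :
    P {ω | Z ω ≤ (y : EReal)} = P₀ {ω | Z₀ ω ≤ (y : EReal)} ↔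
      tailProb P Z y = tailProb P₀ Z₀ y := by
  have e : {ω | Z ω ≤ (y : EReal)} = {ω | (y : EReal) < Z ω}ᶜ := by
    ext ω
    simp
  have e₀ : {ω | Z₀ ω ≤ (y : EReal)} = {ω | (y : EReal) < Z₀ ω}ᶜ := by
    ext ω
    simp
  rw [← ENNReal.toReal_eq_toReal_iff' (measure_ne_top _ _) (measure_ne_top _ _),
    ← measureReal_def, ← measureReal_def, e, e₀,
    probReal_compl_eq_one_sub (measurableSet_lt measurable_const mZ),
    probReal_compl_eq_one_sub (measurableSet_lt measurable_const mZ₀), tailProb, tailProb]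
  exact sub_right_inj

/-- An optimal tail and the candidate tail both attain the dual bound, hence both are binding, and
uniqueness applies in both directions. Conversely, revenue depends only on the tail, and with almost
sure delivery the conditions on the tail suffice for feasibility. -/
theorem IsExponentialTime.isOptimalProcess_iff (hw : IsWeighting w)
    (hsymm : ∀ p ∈ Icc (0 : ℝ) 1, w p + w (1 - p) = 1) (hr : IsRenewalDensity w r)
    (ht₀ : IsStoppingHorizon r t₀) (hθ : 0 < θ) (hτ₀ : IsExponentialTime P₀ τ₀) {T : ℝ≥0 → ℝ}
    (hT : IsPricingProcess P τ T) :
    IsOptimalProcess w w 1 θ P τ T ↔ P {ω | τ ω < ⊤} = 1 ∧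
      ∀ y : ℝ, 0 ≤ y → P {ω | totalPayment τ T ω ≤ (y : EReal)} =
        P₀ {ω | totalPayment τ₀ (starPayment r t₀ θ) ω ≤ (y : EReal)} := by
  have mZ := measurable_totalPayment hT.measurable hT.regular_payment
  have mZ₀ := measurable_totalPayment hτ₀.1 (isRegularPayment_starPayment hr ht₀ hθ)
  have htop : P {ω | τ ω < ⊤} = 1 ↔ P {ω | τ ω = ⊤} = 0 := by
    have : {ω | τ ω = ⊤} = {ω | τ ω < ⊤}ᶜ := by
      ext ω
      simp
    rw [this, prob_compl_eq_zero_iff (measurableSet_lt hT.measurable measurable_const)]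
  simp only [measure_le_eq_iff_tailProb mZ mZ₀, htop]
  set H := tailProb P (totalPayment τ T) with hH
  set H₀ := tailProb P₀ (totalPayment τ₀ (starPayment r t₀ θ)) with hH₀
  have hh : IsTail H := isTail_tailProb P _
  have hh₀ : IsTail H₀ := isTail_tailProb P₀ _
  have hA₀ : ∀ t ∈ Icc 0 t₀, condMean w H₀ t = ENNReal.ofReal θ := fun t ht =>
    hτ₀.condMean_eq hw hr ht₀ hθ ht
  constructor
  · rintro ⟨-, hD, hmax⟩
    -- Optimality compares with processes on spaces in `Type`, so the bound is attained on `ℝ`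
    -- instead of the given `Ω₀`, whose universe is arbitrary.
    obtain ⟨Q, σ, hQ, hσ⟩ := exists_isExponentialTime
    have hrev := hmax ℝ inferInstance Q hQ σ _ (hσ.isPricingProcess hr ht₀ hθ)
      (hσ.jointDIR hw hsymm hr ht₀ hθ)
    rw [hσ.revenue_eq hw hr ht₀ hθ, revenue_eq_lintegral_tailProb] at hrev
    have hb : IsBindingTail w H t₀ θ := isBindingTail_of_le hw hr ht₀ hh
      (fun t _ => hD.condMean_le hw hsymm hθ hT.measurable hT.regular_payment t) hrev
    have hb₀ : IsBindingTail w H₀ t₀ θ := isBindingTail_of_le hw hr ht₀ hh₀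
      (fun t ht => (hA₀ t ht).le)
      (lintegral_tail_eq hw hr ht₀ hh₀ (fun y _ => hτ₀.tail_range hr ht₀ hθ y) hA₀).ge
    exact ⟨hD.measure_eq_top_eq_zero hw hsymm hθ hT.measurable hT.regular_payment hb.zero,
      fun y hy => le_antisymm
        (hb₀.unique hw hr ht₀ hh₀ hh (exists_lt_tailProb _) hb hy)
        (hb.unique hw hr ht₀ hh hh₀ (exists_lt_tailProb _) hb₀ hy)⟩
  · rintro ⟨hfin, heq⟩
    have hcond : ∀ t, condMean w H t = condMean w H₀ t := fun t =>
      setLIntegral_congr_fun measurableSet_Ioi fun y hy => by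
        simp only [heq y (le_of_lt hy)]
    have hrev : revenue P (totalPayment τ T) = ENNReal.ofReal θ * multiplierMass r t₀ := by
      rw [← hτ₀.revenue_eq hw hr ht₀ hθ, revenue_eq_lintegral_tailProb,
        revenue_eq_lintegral_tailProb]
      exact setLIntegral_congr_fun measurableSet_Ioi fun y hy => by
        simp only [← hH, ← hH₀, heq y (le_of_lt hy)]
    refine ⟨hT, jointDIR_of_condMean_le hw hsymm hθ hT.measurable hT.regular_payment hfin
      (t₀ := t₀) (fun y hy => ?_) (fun t ht => ?_), ?_⟩
    · rw [← hH, heq y hy]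
      exact hτ₀.tail_range hr ht₀ hθ y
    · rw [← hH, hcond, hA₀ t ht]
    · intro Ω' _ P' _ τ' T' hT' hD'
      rw [hrev]
      exact hD'.revenue_le hw hsymm hr ht₀ hθ hT'

end characterization

end CPTPricing

/-! ### Assembly of the three statements. -/

theorem mainTheorem7 (w : ℝ → ℝ) (hw : CPTPricing.IsWeighting w)
    (hsymm : ∀ p ∈ Icc (0 : ℝ) 1, w p + w (1 - p) = 1)
    (lam : ℝ) (hlam : lam = 1) (θ : ℝ) (hθ : 0 < θ) :
    -- for sure delivery at a random price, joint and separate accounting give the same payoff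
    (∀ (Ω : Type*) (_ : MeasurableSpace Ω) (P : Measure Ω) (_ : IsProbabilityMeasure P)
      (T : Ω → ℝ), Measurable T → (∀ ω, 0 ≤ T ω) →
      CPTPricing.jointCPT w w lam P (CPTPricing.staticNet θ (fun _ => 1) T) =
        CPTPricing.separateCPT w w lam θ P (fun _ => 1) T) ∧
    -- the optimal static offers under joint accounting
    (∃ μ p : ℝ,
      IsGreatest ((fun x : ℝ => x / w x) '' Ioc 0 1) μ ∧
      (p ∈ Ioo (0 : ℝ) 1 ∧ μ * w p = p ∧ ∀ x ∈ Ioo (0 : ℝ) 1, μ * w x = x → x = p) ∧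
      IsGreatest (CPTPricing.feasibleRevenues w w lam θ) (ENNReal.ofReal (μ * θ / lam)) ∧
      ∀ (Ω : Type*) (_ : MeasurableSpace Ω) (P : Measure Ω) (_ : IsProbabilityMeasure P)
        (X T : Ω → ℝ), CPTPricing.IsOffer X T →
        (CPTPricing.IsOptimalOffer w w lam θ P X T ↔
          P {ω | X ω = 1} = 1 ∧
          ∀ y : ℝ, 0 ≤ y →
            P.real {ω | y < T ω} = if y < μ * θ / (p * lam) then p else 0)) ∧
    -- the optimal dynamic pricing processes under joint accounting
    (∃ p₁ : ℝ,
      (p₁ ∈ Ioo (0 : ℝ) 1 ∧ w p₁ = p₁ ∧ ∀ x ∈ Ioo (0 : ℝ) 1, w x = x → x = p₁) ∧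
      ∃ g : ℝ → ℝ,
        (CPTPricing.SolvesMultiplierEq w (-Real.log p₁) g ∧
          ContinuousOn g (Ioc 0 (-Real.log p₁)) ∧
          ∀ g' : ℝ → ℝ, CPTPricing.SolvesMultiplierEq w (-Real.log p₁) g' →
            g' =ᵐ[volume.restrict (Icc 0 (-Real.log p₁))] g) ∧
        ∃ t₀ : ℝ, IsLeast {t ∈ Ioc 0 (-Real.log p₁) | g t ≤ 0} t₀ ∧
          ∃ f : ℝ → ℝ,
            (CPTPricing.SolvesBindingEq w t₀ f ∧
              ∀ f' : ℝ → ℝ, CPTPricing.SolvesBindingEq w t₀ f' →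
                f' =ᵐ[volume.restrict (Icc 0 t₀)] f) ∧
            ∀ (Ω₀ : Type*) (_ : MeasurableSpace Ω₀) (P₀ : Measure Ω₀)
              (_ : IsProbabilityMeasure P₀) (τ₀ : Ω₀ → ℝ≥0∞),
              CPTPricing.IsExponentialTime P₀ τ₀ →
              CPTPricing.IsOptimalProcess w w lam θ P₀ τ₀
                (CPTPricing.paymentStar lam θ t₀ f) ∧
              ∀ (Ω : Type*) (_ : MeasurableSpace Ω) (P : Measure Ω)
                (_ : IsProbabilityMeasure P) (τ : Ω → ℝ≥0∞) (T : ℝ≥0 → ℝ),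
                CPTPricing.IsPricingProcess P τ T →
                (CPTPricing.IsOptimalProcess w w lam θ P τ T ↔
                  P {ω | τ ω < ⊤} = 1 ∧
                  ∀ y : ℝ, 0 ≤ y →
                    P {ω | CPTPricing.totalPayment τ T ω ≤ (y : EReal)} =
                    P₀ {ω | CPTPricing.totalPayment τ₀
                      (CPTPricing.paymentStar lam θ t₀ f) ω ≤ (y : EReal)})) := by
  subst hlam
  refine ⟨fun Ω _ P _ T mT hT => ?_, ?_, ?_⟩
  · have h := CPTPricing.jointCPT_const_sub (P := P) hw hsymm hθ
      (Z := fun ω => (T ω : EReal)) mT.coe_real_ereal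
      (Eventually.of_forall fun ω => EReal.coe_nonneg.2 (hT ω))
    have e : CPTPricing.staticNet θ (fun _ => 1) T =
        fun ω => (θ : EReal) - (T ω : EReal) := by
      funext ω
      rw [CPTPricing.staticNet, mul_one, EReal.coe_sub]
    have e1 : P.real {_ω : Ω | (1 : ℝ) = 1} = 1 := by
      rw [show {_ω : Ω | (1 : ℝ) = 1} = univ from eq_univ_of_forall fun _ => rfl]
      exact probReal_univ
    rw [e, h, CPTPricing.separateCPT, e1, hw.map_one, mul_one, ENNReal.ofReal_one, one_mul,
      CPTPricing.distortedMean]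
    simp only [EReal.coe_lt_coe_iff]
  · obtain ⟨μ, p, hμ⟩ := hw.exists_isMaxRatio hsymm
    have hwp : 0 < w p := hw.pos ⟨hμ.mem.1, hμ.mem.2.le⟩
    refine ⟨μ, p, ⟨⟨p, ⟨hμ.mem.1, hμ.mem.2.le⟩, ?_⟩, ?_⟩, ⟨hμ.mem, hμ.eq, hμ.unique⟩, ?_, ?_⟩
    · exact (div_eq_iff hwp.ne').2 hμ.eq.symm
    · rintro _ ⟨x, hx, rfl⟩
      exact (div_le_iff₀ (hw.pos hx)).2 (hμ.le x ⟨hx.1.le, hx.2⟩)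
    · rw [div_one]
      refine ⟨hμ.exists_offer hw hsymm hθ, ?_⟩
      rintro _ ⟨Ω, _, P, _, X, T, hX, rfl⟩
      exact hX.staticRevenue_le hw hsymm hμ hθ
    · intro Ω _ P _ X T hX
      rw [mul_one]
      constructor
      · rintro ⟨hf, hmax⟩
        exact hμ.tail_of_le hw hsymm hθ hf (hmax _ (hμ.exists_offer hw hsymm hθ))
      · rintro ⟨h1, hT⟩
        obtain ⟨hf, hrev⟩ := hμ.feasible_of_tail hw hsymm hθ hX h1 hT
        refine ⟨hf, ?_⟩
        rintro _ ⟨Ω', _, P', _, X', T', hX', rfl⟩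
        rw [hrev]
        exact hX'.staticRevenue_le hw hsymm hμ hθ
  · obtain ⟨r, hr⟩ := hw.exists_isRenewalDensity hsymm
    have hlog : -Real.log (1 / 2) = Real.log 2 := by
      rw [one_div, Real.log_inv, neg_neg]
    -- Symmetry makes `1/2` a fixed point, and `w` lies strictly above the diagonal before it and
    -- strictly below after it; the horizon is therefore `log 2`.
    refine ⟨1 / 2, ⟨by norm_num, CPTPricing.IsWeighting.half hsymm, fun x hx he => ?_⟩, ?_⟩
    · rcases lt_trichotomy x (1 / 2) with h | h | h
      · exact absurd he (hw.self_lt hsymm ⟨hx.1, h⟩).ne'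
      · exact h
      · exact absurd he (hw.lt_self hsymm ⟨h, hx.2⟩).ne
    rw [hlog]
    obtain ⟨t₀, ht₀⟩ := hr.exists_isLeast hw hsymm
    have hs : CPTPricing.IsStoppingHorizon r t₀ := ht₀
    refine ⟨CPTPricing.multiplier r, ⟨hr.solvesMultiplierEq hw,
      hr.continuousOn_multiplier.mono (Ioc_subset_Ioc_right CPTPricing.log_two_lt_one.le),
      fun g hg => hr.ae_eq_multiplier hw hg⟩, t₀, ht₀, fun s => r (t₀ - s),
      ⟨hr.solvesBindingEq hs.mem_Icc, fun f hf => hr.ae_eq_of_solvesBindingEq hw hs.mem_Icc hf⟩,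
      fun Ω₀ _ P₀ _ τ₀ hτ₀ => ⟨hτ₀.isOptimalProcess hw hsymm hr hs hθ,
        fun Ω _ P _ τ T hT => hτ₀.isOptimalProcess_iff hw hsymm hr hs hθ hT⟩⟩
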